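/- **Definitions.** For a ranked alphabet $\Omega$, trees over $\Omega$ are identified with their strings in prefix notation. A $k$-ary *pattern* over $\Omega$ is a tree over $\Omega\cup\{x_1,\dots,x_k\}$ (each $x_i$ of rank $0$) in which every $x_i$, $1\le i\le k$, occurs exactly once; its rank is $k$. A *multiple context-free tree grammar* (MCFTG) is a system $G=(N,\mathcal N,\Sigma,S,R)$ where $N$ (nonterminals) and $\Sigma$ (terminals) are disjoint finite ranked alphabets, $\Sigma$ contains a symbol of rank at least $1$; $\mathcal N$ is a finite set of nonempty repetition-free sequences over $N$ (*big nonterminals*), distinct ones having distinct sets of elements; $S\in\mathcal N$ is a single nonterminal of rank $0$; and $R$ is a finite set of rules $A\to(u,\mathcal L)$, where $A=(A_1,\dots,A_n)\in\mathcal N$, $u=(u_1,\dots,u_n)$ is a forest in which $u_i$ is a pattern over $N\cup\Sigma$ of rank $\mathrm{rk}(A_i)$, no nonterminal occurs more than once in $u$, and the set of *links* $\mathcal L\subseteq\mathcal N$ is such that the sets of elements of the $B\in\mathcal L$ partition the set of nonterminals occurring in $u$. The links of each rule are ordered by an arbitrary fixed linear order. For all $A\in\mathcal N$ simultaneously, $L(G,A)$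 is the smallest set of forests containing $u[B\leftarrow f(B)\mid B\in\mathcal L]$ for all rules $A\to(u,\mathcal L)$ and all $f$ with $f(B)\in L(G,B)$ for $B\in\mathcal L$ (second-order substitution: the $j$-th nonterminal of $B$ is replaced by the $j$-th pattern of $f(B)$). Put $L(G)=L(G,S)$, a set of trees over $\Sigma$. The *width* of $G$ is the maximal rank of its nonterminals, the *multiplicity* the maximal length of its big nonterminals. $G$ is *start-separated* if $S$ does not occur in the right-hand side $u$ of any rule. *Derivation trees.* View $R$ as a ranked alphabet, the rank of a rule being its number of links. $L(G_{\rm der})$ is the set of trees over $R$ generated from $S$ by the regular tree grammar with rules $A\to\rho(B_1,\dots,B_k)$ for $\rho=A\to(u,\{B_1,\dots,B_k\})\in R$ (links in order), and the value of $d=\rho(d_1,\dots,d_k)$ is $\mathrm{val}(d)=u[B_i\leftarrow\mathrm{val}(d_i)\mid 1\le i\le k]$. An *$\mathrm{LDT}^{\rm R}$-transduction* is a partial function realized by a linear deterministic top-down tree transducer with regular look-ahead. MCFTGs $G$ and $G'$ with rule sets $R$ and $R'$ are *$\mathrm{LDT}^{\rm R}$-equivalent* if they have the same terminal alphabet and there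 are $\mathrm{LDT}^{\rm R}$-transductions $M\colon T_R\to T_{R'}$ and $M'\colon T_{R'}\to T_R$ such that, for every $d\in L(G_{\rm der})$, $M(d)$ is defined, $M(d)\in L(G'_{\rm der})$ and $\mathrm{val}(M(d))=\mathrm{val}(d)$, and, for every $d'\in L(G'_{\rm der})$, $M'(d')$ is defined, $M'(d')\in L(G_{\rm der})$ and $\mathrm{val}(M'(d'))=\mathrm{val}(d')$. Let $\Delta\subseteq\Sigma$ be a set of *lexical* symbols. For a tree $t$ let $\mathrm{yd}_\Delta(t)\in\Delta^*$ be the string of occurrences of symbols of $\Delta$ in $t$, from left to right. $G$ has *finite $\Delta$-ambiguity* if $\{t\in L(G)\mid\mathrm{yd}_\Delta(t)=w\}$ is finite for every $w\in\Delta^*$. $G$ is *$\Delta$-growing* if the right-hand side of every rule $A\to(u,\emptyset)$ with $A\ne S$ contains at least two occurrences of symbols of $\Delta$, and the right-hand side of every rule with exactly one link contains at least one such occurrence. **Theorem.** (1) It is decidable, given an MCFTG $G$ with terminal alphabet $\Sigma$ and a subset $\Delta\subseteq\Sigma$, whether or not $G$ has finite $\Delta$-ambiguity. (2) For every MCFTG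 $G$ and every $\Delta\subseteq\Sigma$ such that $G$ has finite $\Delta$-ambiguity, there is a start-separated $\Delta$-growing MCFTG $G'$ that is $\mathrm{LDT}^{\rm R}$-equivalent to $G$ and has the same width and the same multiplicity as $G$. -/

import Mathlib

namespace MCFT

/-! ## Ranked trees -/

/-- Trees over the ranked set `(Γ, rk)`: a node labelled `a` has exactly `rk a` children. -/
inductive RTree (Γ : Type) (rk : Γ → ℕ) : Type
  | node (a : Γ) (ts : Fin (rk a) → RTree Γ rk) : RTree Γ rk

/-- The tree written as a string over `Γ` (prefix notation). Its entries are the labels of the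
nodes, each node contributing one entry, in left-to-right (pre-)order. -/
def RTree.str {Γ : Type} {rk : Γ → ℕ} : RTree Γ rk → List Γ
  | .node a ts => a :: (List.ofFn fun i => (ts i).str).flatten

/-- `t.Derives δ q`: the tree `t` is generated from `q` by the regular tree grammar in normal form
with nonterminals `Q` and with the rules `A → a(A₁, …, A_k)` for `δ A a ![A₁, …, A_k]`. -/
def RTree.Derives {Γ Q : Type} {rk : Γ → ℕ} (δ : Q → (a : Γ) → (Fin (rk a) → Q) → Prop) :
    RTree Γ rk → Q → Prop
  | .node a ts, q => ∃ qs : Fin (rk a) → Q, δ q a qs ∧ ∀ i, RTree.Derives δ (ts i) (qs i)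

/-- `L` is a regular tree language over the (finite) alphabet `Ω`. -/
def IsRegular {Γ : Type} {rk : Γ → ℕ} (Ω : Set Γ) (L : Set (RTree Γ rk)) : Prop :=
  ∃ (Q : Type) (_ : Finite Q) (q₀ : Q) (δ : Q → (a : Γ) → (Fin (rk a) → Q) → Prop),
    (∀ q a qs, δ q a qs → a ∈ Ω) ∧ L = {t | t.Derives δ q₀}

/-! ## Linear deterministic top-down tree transducers with regular look-ahead -/

/-- Right-hand sides `ζ` of transducer rules for an input symbol with `k` children: trees over the
output symbols in which pairs `⟨q, y_i⟩` may occur as leaves. -/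
abbrev OutTree (Q : Type) (k : ℕ) (Γ' : Type) (rk' : Γ' → ℕ) : Type :=
  RTree ((Q × Fin k) ⊕ Γ') (Sum.elim (fun _ => 0) rk')

/-- `ζ[⟨q, y_i⟩ ← g ⟨q, y_i⟩]`. -/
def OutTree.fill {Q : Type} {k : ℕ} {Γ' : Type} {rk' : Γ' → ℕ} (g : Q × Fin k → RTree Γ' rk') :
    OutTree Q k Γ' rk' → RTree Γ' rk'
  | .node (.inl p) _ => g p
  | .node (.inr a) ts => .node a fun i => OutTree.fill g (ts i)

/-- The part `(y₁ : L₁, …, y_k : L_k) : L₀ → ζ` of a transducer rule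
`⟨q, ω(y₁ : L₁, …, y_k : L_k) : L₀⟩ → ζ`. -/
structure Clause (Γ : Type) (rk : Γ → ℕ) (Γ' : Type) (rk' : Γ' → ℕ) (Q : Type) (k : ℕ) where
  look₀ : Set (RTree Γ rk)
  look : Fin k → Set (RTree Γ rk)
  out : OutTree Q k Γ' rk'

/-- A linear deterministic top-down tree transducer with regular look-ahead, from the (finite)
input alphabet `Ω` to the (finite) output alphabet `Ω'`. The rules with left-hand side
`⟨q, ω(…)⟩` are the members of `rules q ω`. -/
structure LDTR {Γ Γ' : Type} (rk : Γ → ℕ) (rk' : Γ' → ℕ) (Ω : Set Γ) (Ω' : Set Γ') where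
  Q : Type
  finite_Q : Finite Q
  q₀ : Q
  rules : Q → (ω : Γ) → Set (Clause Γ rk Γ' rk' Q (rk ω))
  finite_rules : ∀ q ω, (rules q ω).Finite
  input_mem : ∀ q ω, ∀ c ∈ rules q ω, ω ∈ Ω
  output_mem : ∀ q ω, ∀ c ∈ rules q ω, ∀ a, Sum.inr a ∈ c.out.str → a ∈ Ω'
  regular_look₀ : ∀ q ω, ∀ c ∈ rules q ω, IsRegular Ω c.look₀
  regular_look : ∀ q ω, ∀ c ∈ rules q ω, ∀ i, IsRegular Ω (c.look i)
  /-- each input variable `y_i` occurs at most once in the right-hand side -/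
  linear : ∀ q ω, ∀ c ∈ rules q ω, ∀ i,
    c.out.str.countP (fun l => Sum.elim (fun p => decide (p.2 = i)) (fun _ => false) l) ≤ 1
  deterministic : ∀ q ω, ∀ c ∈ rules q ω, ∀ c' ∈ rules q ω, c ≠ c' →
    c.look₀ ∩ c'.look₀ = ∅ ∨ ∃ i, c.look i ∩ c'.look i = ∅

/-- `M.Trans s q t` says that the `q`-translation of `s` by `M` is defined and equal to `t`. -/
def LDTR.Trans {Γ Γ' : Type} {rk : Γ → ℕ} {rk' : Γ' → ℕ} {Ω : Set Γ} {Ω' : Set Γ'}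
    (M : LDTR rk rk' Ω Ω') : RTree Γ rk → M.Q → RTree Γ' rk' → Prop
  | .node ω ts, q, t => ∃ c ∈ M.rules q ω, RTree.node ω ts ∈ c.look₀ ∧ (∀ i, ts i ∈ c.look i) ∧
      ∃ g : M.Q × Fin (rk ω) → RTree Γ' rk',
        (∀ p, Sum.inl p ∈ c.out.str → LDTR.Trans M (ts p.2) p.1 (g p)) ∧ t = c.out.fill g

/-- `M(s) = t`. -/
def LDTR.Maps {Γ Γ' : Type} {rk : Γ → ℕ} {rk' : Γ' → ℕ} {Ω : Set Γ} {Ω' : Set Γ'}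
    (M : LDTR rk rk' Ω Ω') (s : RTree Γ rk) (t : RTree Γ' rk') : Prop :=
  M.Trans s M.q₀ t

/-! ## Symbols, terms and substitution -/

/-- Symbols are taken from a fixed stock that has infinitely many symbols of every rank:
a symbol is a pair (name, rank). Every finite ranked alphabet is, up to a renaming of its symbols,
a finite subset of this stock. -/
abbrev Sym : Type := ℕ × ℕ

/-- Node labels in right-hand sides: nonterminals, terminals and variables;
`var i` is the variable `x_{i+1}`. -/
inductive Label : Type
  | nt (A : Sym) : Label
  | tm (σ : Sym) : Label
  | var (i : ℕ) : Label
  deriving DecidableEq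

def Label.rk : Label → ℕ
  | .nt A => A.2
  | .tm σ => σ.2
  | .var _ => 0

/-- Trees over nonterminals and terminals with variables. -/
abbrev Term : Type := RTree Label Label.rk

def Term.var (i : ℕ) : Term := .node (.var i) Fin.elim0

/-- All the labels of a forest, one entry for each node. -/
def forestStr (u : List Term) : List Label := u.flatMap RTree.str

/-- `t` is a `k`-ary pattern: each of `x₁, …, x_k` occurs exactly once in `t`, and no other
variable occurs in `t`. -/
def IsPattern (k : ℕ) (t : Term) : Prop :=
  ∀ i, t.str.count (.var i) = if i < k then 1 else 0

/-- First-order substitution of `f i` for the variable with index `i`. -/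
def Term.subst (f : ℕ → Term) : Term → Term
  | .node (.var i) _ => f i
  | .node (.nt A) ts => .node (.nt A) fun j => Term.subst f (ts j)
  | .node (.tm σ) ts => .node (.tm σ) fun j => Term.subst f (ts j)

/-- Second-order substitution of the pattern `h A` for each nonterminal `A`. -/
def Term.subst₂ (h : Sym → Term) : Term → Term
  | .node (.var i) ts => .node (.var i) ts
  | .node (.tm σ) ts => .node (.tm σ) fun j => Term.subst₂ h (ts j)
  | .node (.nt A) ts => (h A).subst fun i =>
      if hi : i < A.2 then Term.subst₂ h (ts ⟨i, hi⟩) else Term.var i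

/-- `A(x₁, …, x_k)`. -/
def Term.init (A : Sym) : Term := .node (.nt A) fun i => Term.var i

/-- `u[B₁ ← v₁, …, B_k ← v_k]` for sequences `B_i` of nonterminals and forests `v_i` of the same
length: the `j`-th nonterminal of `B_i` is replaced by the `j`-th tree of `v_i`. -/
def forestSubst (u : List Term) (B : List (List Sym)) (v : List (List Term)) : List Term :=
  u.map (Term.subst₂ fun A => ((B.flatten.zip v.flatten).lookup A).getD (Term.init A))

/-! ## Multiple context-free tree grammars -/

/-- A rule `A → (u, ℒ)`. The set `ℒ` of links is given as a list, that is, together with the fixed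
linear order that is used for derivation trees. -/
structure Rule where
  lhs : List Sym
  rhs : List Term
  links : List (List Sym)

/-- A rule `ρ` is well formed with respect to the nonterminals `N`, the big nonterminals `bigN`
and the terminals `Sig`. -/
structure Rule.WF (N : List Sym) (bigN : List (List Sym)) (Sig : List Sym) (ρ : Rule) : Prop where
  lhs_mem : ρ.lhs ∈ bigN
  /-- the right-hand side is a forest of patterns of the same multiple rank as the left-hand side -/
  rank_eq : List.Forall₂ (fun A u => IsPattern A.2 u) ρ.lhs ρ.rhs
  nt_mem : ∀ C, Label.nt C ∈ forestStr ρ.rhs → C ∈ N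
  tm_mem : ∀ σ, Label.tm σ ∈ forestStr ρ.rhs → σ ∈ Sig
  uniquely_labeled : ∀ C, (forestStr ρ.rhs).count (.nt C) ≤ 1
  links_mem : ∀ B ∈ ρ.links, B ∈ bigN
  links_nodup : ρ.links.Nodup
  /-- the links partition the set of nonterminals that occur in the right-hand side -/
  links_disjoint : ∀ B ∈ ρ.links, ∀ B' ∈ ρ.links, B ≠ B' → ∀ C ∈ B, C ∉ B'
  links_cover : ∀ C, Label.nt C ∈ forestStr ρ.rhs ↔ ∃ B ∈ ρ.links, C ∈ B

/-- A multiple context-free tree grammar `(N, 𝒩, Σ, S, R)`. Finite sets are given by lists;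
only membership in them matters. -/
structure MCFTG where
  N : List Sym
  bigN : List (List Sym)
  Sig : List Sym
  S : Sym
  R : List Rule
  bigN_ne_nil : ∀ A ∈ bigN, A ≠ []
  bigN_nodup : ∀ A ∈ bigN, A.Nodup
  bigN_subset : ∀ A ∈ bigN, ∀ C ∈ A, C ∈ N
  bigN_inj : ∀ A ∈ bigN, ∀ A' ∈ bigN, (∀ C, C ∈ A ↔ C ∈ A') → A = A'
  exists_rank_pos : ∃ σ ∈ Sig, 1 ≤ σ.2
  S_mem : [S] ∈ bigN
  S_rank : S.2 = 0
  rules_wf : ∀ ρ ∈ R, ρ.WF N bigN Sig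
  /-- the order of the links is determined by the rule -/
  links_order : ∀ ρ ∈ R, ∀ ρ' ∈ R, ρ.lhs = ρ'.lhs → ρ.rhs = ρ'.rhs →
    (∀ B, B ∈ ρ.links ↔ B ∈ ρ'.links) → ρ.links = ρ'.links

namespace MCFTG

/-- The width: the maximal rank of the nonterminals. -/
def width (G : MCFTG) : ℕ := (G.N.map Prod.snd).foldr max 0

/-- The multiplicity: the maximal length of the big nonterminals. -/
def multiplicity (G : MCFTG) : ℕ := (G.bigN.map List.length).foldr max 0

/-- The forest languages `L(G, A)`: the smallest family of sets of forests such that, for every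
rule `A → (u, ℒ)`, substituting in `u` a forest of `L(G, B)` for each `B ∈ ℒ` gives a forest
of `L(G, A)`. -/
inductive Gen (G : MCFTG) : List Sym → List Term → Prop
  | mk (ρ : Rule) (hρ : ρ ∈ G.R) (f : Fin ρ.links.length → List Term)
      (hf : ∀ i, Gen G (ρ.links.get i) (f i)) :
      Gen G ρ.lhs (forestSubst ρ.rhs ρ.links (List.ofFn f))

/-- The tree language `L(G)`. -/
def language (G : MCFTG) : Set Term := {t | G.Gen [G.S] [t]}

/-- The initial nonterminal does not occur in right-hand sides. -/
def StartSeparated (G : MCFTG) : Prop := ∀ ρ ∈ G.R, Label.nt G.S ∉ forestStr ρ.rhs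

end MCFTG

/-! ## Derivation trees and equivalence -/

/-- The rank of a rule, as a label of derivation trees, is its number of links. -/
def Rule.rk (ρ : Rule) : ℕ := ρ.links.length

abbrev DTree : Type := RTree Rule Rule.rk

/-- `G.IsDer d A`: `d` is generated from `A` by the derivation tree grammar of `G`, whose rules are
`A → ρ(B₁, …, B_k)` for the rules `ρ` of `G` with left-hand side `A` and links `B₁, …, B_k`. -/
def MCFTG.IsDer (G : MCFTG) : DTree → List Sym → Prop
  | .node ρ ts, A => ρ ∈ G.R ∧ ρ.lhs = A ∧ ∀ i, MCFTG.IsDer G (ts i) (ρ.links.get i)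

/-- The set `L(G_der)` of terminal derivation trees of type `S`. -/
def MCFTG.derTrees (G : MCFTG) : Set DTree := {d | G.IsDer d [G.S]}

/-- The value of a derivation tree. -/
def DTree.val : DTree → List Term
  | .node ρ ts => forestSubst ρ.rhs ρ.links (List.ofFn fun i => DTree.val (ts i))

/-- `LDT^R`-equivalence: the terminal alphabets coincide and there are value-preserving
`LDT^R`-transductions between the derivation trees, in both directions. -/
def MCFTG.LDTREquiv (G G' : MCFTG) : Prop :=
  (∀ σ, σ ∈ G.Sig ↔ σ ∈ G'.Sig) ∧
  (∃ M : LDTR Rule.rk Rule.rk {ρ | ρ ∈ G.R} {ρ | ρ ∈ G'.R}, ∀ d ∈ G.derTrees,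
    ∃ d', M.Maps d d' ∧ d' ∈ G'.derTrees ∧ DTree.val d' = DTree.val d) ∧
  (∃ M' : LDTR Rule.rk Rule.rk {ρ | ρ ∈ G'.R} {ρ | ρ ∈ G.R}, ∀ d' ∈ G'.derTrees,
    ∃ d, M'.Maps d' d ∧ d ∈ G.derTrees ∧ DTree.val d = DTree.val d')

/-! ## Lexical symbols -/

/-- The string of occurrences of symbols of `D` in a string of labels, from left to right. -/
def lexYield (D : List Sym) (w : List Label) : List Sym :=
  w.filterMap fun l => match l with
    | .tm σ => if σ ∈ D then some σ else none
    | _ => none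

/-- The number of occurrences of symbols of `D` in the right-hand side of a rule. -/
def Rule.lexCount (D : List Sym) (ρ : Rule) : ℕ := (lexYield D (forestStr ρ.rhs)).length

/-- `G` has finite `D`-ambiguity. -/
def MCFTG.FinitelyAmbiguous (G : MCFTG) (D : List Sym) : Prop :=
  ∀ w : List Sym, (∀ σ ∈ w, σ ∈ D) → {t ∈ G.language | lexYield D t.str = w}.Finite

/-- `G` is `D`-growing: non-initial terminal rules contain at least two occurrences of lexical
symbols, and monic rules at least one. -/
def MCFTG.Growing (G : MCFTG) (D : List Sym) : Prop :=
  (∀ ρ ∈ G.R, ρ.lhs ≠ [G.S] → ρ.links = [] → 2 ≤ ρ.lexCount D) ∧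
  (∀ ρ ∈ G.R, ρ.links.length = 1 → 1 ≤ ρ.lexCount D)

/-! ## Grammars as inputs of algorithms -/

def Label.code : Label → Sym ⊕ Sym ⊕ ℕ
  | .nt A => .inl A
  | .tm σ => .inr (.inl σ)
  | .var i => .inr (.inr i)

abbrev RuleCode : Type := List Sym × List (List (Sym ⊕ Sym ⊕ ℕ)) × List (List Sym)

/-- Rules as finite objects; the trees of the right-hand side are written as strings. -/
def Rule.code (ρ : Rule) : RuleCode :=
  (ρ.lhs, ρ.rhs.map (fun u => u.str.map Label.code), ρ.links)

abbrev GrammarCode : Type :=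
  List Sym × List (List Sym) × List Sym × Sym × List RuleCode

/-- The grammar written down as a finite object. -/
def MCFTG.code (G : MCFTG) : GrammarCode :=
  (G.N, G.bigN, G.Sig, G.S, G.R.map Rule.code)

end MCFT

/-!
The value of a derivation tree is linear in the values of its subtrees: no symbol is copied or
deleted. Hence the numbers of terminal and of lexical symbols in the value of a derivation tree are
the sums of the corresponding numbers over the rules in the tree (`IsDer.fwt_val`), and contexts,
that is, derivation trees with a hole, contribute a fixed number as well (`Ctx.wt_fill`).

Since there are finitely many patterns of given rank with a given number of terminals, finite
ambiguity says that the number of terminals in a derivation tree is bounded in terms of its number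
of lexical symbols. By pumping, this fails if and only if there is a context from a reachable and
productive big nonterminal to itself that has terminal symbols but no lexical symbols
(`finitelyAmbiguous_iff_noNullLoop`). For the bound in the absence of such loops, one descends from
the root to the subtree that is smallest among those of the same type with the same number of
lexical symbols; nothing is lost on the way, and that type does not occur below with this number, so
the number of available types decreases.

For decidability, only the positivity of the two numbers matters, so there are finitely many
possible facts about derivation trees and contexts. There is no loop if and only if there are sets
of such facts that are closed under the rules and show no loop; this can be checked by a search
through all sets of facts, which is primitive recursive (`decide_iff`, `primrecPred_decide`).

For the growing grammar, call a derivation tree light if it has at most one lexical symbol. If `G`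
has finite ambiguity, then the reachable light derivation trees have finitely many values
(`Bounded.finite_lightValues`), and so do the contexts without lexical symbols between reachable and
productive big nonterminals (`Bounded.finite_isNull`). The rules of the new grammar are composed of
such a null context, a rule of `G` below it, and values of light trees for some of the links of this
rule; only those are kept that satisfy the conditions for growing grammars (`newRules`). A new
initial nonterminal makes the grammar start-separated.

From `G` to the new grammar, a transducer keeps in its state the null context that has been read but
not yet produced, and determines the light subtrees and their values by look-ahead. If at a node the
composed rule violates the conditions, then exactly one subtree is not light and nothing lexical has
been read; so the null context is extended and nothing is produced (`growingTransducer_trans`).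
Conversely, each rule of the new grammar is replaced by a piece of a derivation tree of `G` of which
it is composed (`originTransducer_trans`).
-/

namespace MCFT

/-! ### Weights of trees and second-order substitution -/

/-- The sum of the weights of the nodes of a tree. -/
def RTree.wt {Γ : Type} {rk : Γ → ℕ} (φ : Γ → ℕ) (t : RTree Γ rk) : ℕ := (t.str.map φ).sum

theorem RTree.str_node {Γ : Type} {rk : Γ → ℕ} (a : Γ) (ts : Fin (rk a) → RTree Γ rk) :
    (RTree.node a ts).str = a :: (List.ofFn fun i => (ts i).str).flatten := rfl

theorem RTree.mem_str_node {Γ : Type} {rk : Γ → ℕ} (a : Γ) (ts : Fin (rk a) → RTree Γ rk) (l : Γ) :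
    l ∈ (RTree.node a ts).str ↔ l = a ∨ ∃ i, l ∈ (ts i).str := by
  simp only [RTree.str_node, List.mem_cons, List.mem_flatten, List.mem_ofFn]
  constructor
  · rintro (h | ⟨_, ⟨i, rfl⟩, h⟩)
    · exact .inl h
    · exact .inr ⟨i, h⟩
  · rintro (h | ⟨i, h⟩)
    · exact .inl h
    · exact .inr ⟨_, ⟨i, rfl⟩, h⟩

theorem RTree.wt_node {Γ : Type} {rk : Γ → ℕ} (φ : Γ → ℕ) (a : Γ)
    (ts : Fin (rk a) → RTree Γ rk) :
    (RTree.node a ts).wt φ = φ a + ∑ i, (ts i).wt φ := by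
  simp only [RTree.wt, RTree.str_node, List.map_cons, List.sum_cons, List.map_flatten,
    List.sum_flatten, List.map_ofFn, List.sum_ofFn, Function.comp_def]

theorem RTree.wt_congr {Γ : Type} {rk : Γ → ℕ} {φ ψ : Γ → ℕ} {t : RTree Γ rk}
    (h : ∀ l ∈ t.str, φ l = ψ l) : t.wt φ = t.wt ψ := by
  simp only [RTree.wt]
  rw [List.map_congr_left h]

theorem RTree.length_str_node {Γ : Type} {rk : Γ → ℕ} (a : Γ)
    (ts : Fin (rk a) → RTree Γ rk) :
    (RTree.node a ts).str.length = 1 + ∑ i, (ts i).str.length := by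
  have h : ∀ t : RTree Γ rk, t.str.length = t.wt fun _ => 1 := fun t => by simp [RTree.wt]
  rw [h, RTree.wt_node]
  simp only [h]

theorem RTree.finite_bounded {Γ : Type} {rk : Γ → ℕ} {S : Set Γ} (hS : S.Finite) (n : ℕ) :
    {t : RTree Γ rk | (∀ l ∈ t.str, l ∈ S) ∧ t.str.length ≤ n}.Finite := by
  induction n with
  | zero =>
    refine Set.Finite.subset Set.finite_empty ?_
    rintro ⟨a, ts⟩ ⟨-, h⟩
    rw [RTree.length_str_node] at h
    omega
  | succ n ih =>
    refine Set.Finite.subset (hS.biUnion (t := fun a => (fun ts => RTree.node a ts) ''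
      (Set.univ.pi fun _ : Fin (rk a) =>
        {t : RTree Γ rk | (∀ l ∈ t.str, l ∈ S) ∧ t.str.length ≤ n}))
      fun a _ => (Set.Finite.pi fun _ => ih).image _) ?_
    rintro ⟨a, ts⟩ ⟨h₁, h₂⟩
    refine Set.mem_biUnion (h₁ a ((mem_str_node _ _ _).2 (.inl rfl))) ⟨ts, fun i _ => ⟨?_, ?_⟩, rfl⟩
    · exact fun l hl => h₁ l ((mem_str_node _ _ _).2 (.inr ⟨i, hl⟩))
    · rw [RTree.length_str_node] at h₂
      have := Finset.single_le_sum (f := fun i => (ts i).str.length) (fun _ _ => Nat.zero_le _)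
        (Finset.mem_univ i)
      omega

theorem finite_lists_of_finite {α : Type} {F : Set α} (hF : F.Finite) (k : ℕ) :
    {u : List α | (∀ t ∈ u, t ∈ F) ∧ u.length ≤ k}.Finite := by
  have := hF.to_subtype
  refine ((List.finite_length_le F k).image (List.map Subtype.val)).subset ?_
  rintro u ⟨h₁, h₂⟩
  refine ⟨u.attach.map fun x => ⟨x.1, h₁ _ x.2⟩, by simpa using h₂, ?_⟩
  rw [List.map_map]
  exact List.attach_map_subtype_val u

theorem list_count_eq_sum {α : Type} [BEq α] [LawfulBEq α] [DecidableEq α] (l : α) (s : List α) :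
    s.count l = (s.map fun l' => if l' = l then 1 else 0).sum := by
  induction s with
  | nil => rfl
  | cons a s ih => rw [List.count_cons, ih, List.map_cons, List.sum_cons, add_comm]; simp

theorem list_countP_eq_sum {α : Type} (p : α → Bool) (s : List α) :
    s.countP p = (s.map fun l' => if p l' then 1 else 0).sum := by
  induction s with
  | nil => rfl
  | cons a s ih => rw [List.countP_cons, ih, List.map_cons, List.sum_cons, add_comm]

theorem count_str_eq_wt {Γ : Type} [DecidableEq Γ] {rk : Γ → ℕ} (l : Γ) (t : RTree Γ rk) :
    t.str.count l = t.wt fun l' => if l' = l then 1 else 0 := list_count_eq_sum _ _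

theorem list_sum_pos_iff {α : Type} (f : α → ℕ) (s : List α) :
    0 < (s.map f).sum ↔ ∃ a ∈ s, 0 < f a := by
  simp [pos_iff_ne_zero, List.sum_eq_zero_iff]

namespace Term

theorem node_var_eq (i : ℕ) (ts : Fin (Label.rk (.var i)) → Term) :
    (RTree.node (.var i) ts : Term) = Term.var i := by
  unfold Term.var
  congr 1
  funext j
  exact Fin.elim0 j

theorem var_subst₂ (h : Sym → Term) (i : ℕ) : (Term.var i).subst₂ h = Term.var i := rfl

theorem str_var (i : ℕ) : (Term.var i).str = [.var i] := rfl

theorem wt_var (φ : Label → ℕ) (i : ℕ) : (Term.var i).wt φ = φ (.var i) := by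
  simp [RTree.wt, str_var]

theorem subst_congr {f g : ℕ → Term} {t : Term} (h : ∀ i, .var i ∈ t.str → f i = g i) :
    t.subst f = t.subst g := by
  induction t with
  | node l ts ih =>
    have ih' := fun j => ih j fun i hi => h i ((RTree.mem_str_node _ _ _).2 (.inr ⟨j, hi⟩))
    cases l with
    | var i => exact h i ((RTree.mem_str_node _ _ _).2 (.inl rfl))
    | nt A => simp only [Term.subst, ih']
    | tm σ => simp only [Term.subst, ih']

theorem subst_var_self (t : Term) : t.subst Term.var = t := by
  induction t with
  | node l ts ih =>
    cases l with
    | var i => simp only [Term.subst, node_var_eq]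
    | nt A => simp only [Term.subst, ih]
    | tm σ => simp only [Term.subst, ih]

theorem subst_eq_self {f : ℕ → Term} {t : Term} (h : ∀ i, .var i ∈ t.str → f i = Term.var i) :
    t.subst f = t := (subst_congr h).trans (subst_var_self t)

theorem subst_subst (f g : ℕ → Term) (t : Term) :
    (t.subst f).subst g = t.subst fun i => (f i).subst g := by
  induction t with
  | node l ts ih =>
    cases l with
    | var i => simp only [Term.subst]
    | nt A => simp only [Term.subst, ih]
    | tm σ => simp only [Term.subst, ih]

theorem subst₂_congr {h g : Sym → Term} {t : Term} (hg : ∀ A, .nt A ∈ t.str → h A = g A) :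
    t.subst₂ h = t.subst₂ g := by
  induction t with
  | node l ts ih =>
    have ih' := fun j => ih j fun i hi => hg i ((RTree.mem_str_node _ _ _).2 (.inr ⟨j, hi⟩))
    cases l with
    | var i => simp only [Term.subst₂]
    | nt A => simp only [Term.subst₂, ih', hg A ((RTree.mem_str_node _ _ _).2 (.inl rfl))]
    | tm σ => simp only [Term.subst₂, ih']

theorem subst₂_eq_self {h : Sym → Term} {t : Term} (hg : ∀ A, .nt A ∈ t.str → h A = Term.init A) :
    t.subst₂ h = t := by
  induction t with
  | node l ts ih =>
    have ih' := fun j => ih j fun i hi => hg i ((RTree.mem_str_node _ _ _).2 (.inr ⟨j, hi⟩))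
    cases l with
    | var i => simp only [Term.subst₂]
    | nt A =>
      simp only [Term.subst₂, ih', hg A ((RTree.mem_str_node _ _ _).2 (.inl rfl)), Term.init,
        Term.subst, Term.var]
      congr 1
      funext j
      exact dif_pos j.2
    | tm σ => simp only [Term.subst₂, ih']

end Term

theorem IsPattern.lt {k : ℕ} {t : Term} (ht : IsPattern k t) {i : ℕ} (hi : .var i ∈ t.str) :
    i < k := by
  by_contra h
  have := ht i
  rw [if_neg h, List.count_eq_zero] at this
  exact this hi

theorem Term.init_subst₂ {h : Sym → Term} {A : Sym} (hA : IsPattern A.2 (h A)) :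
    (Term.init A).subst₂ h = h A := by
  simp only [Term.init, Term.subst₂, Term.var_subst₂]
  refine Term.subst_eq_self fun i hi => ?_
  rw [dif_pos (hA.lt hi)]

/-- A second-order substitution that respects ranks. -/
def RankPreserving (h : Sym → Term) : Prop := ∀ A : Sym, IsPattern A.2 (h A)

theorem Term.subst₂_subst {h : Sym → Term} (hh : RankPreserving h) (f : ℕ → Term) (t : Term) :
    (t.subst f).subst₂ h = (t.subst₂ h).subst fun i => (f i).subst₂ h := by
  induction t with
  | node l ts ih =>
    cases l with
    | var i => simp only [Term.subst, Term.subst₂]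
    | tm σ => simp only [Term.subst, Term.subst₂, ih]
    | nt A =>
      simp only [Term.subst, Term.subst₂, ih, Term.subst_subst]
      refine Term.subst_congr fun i hi => ?_
      rw [dif_pos ((hh A).lt hi), dif_pos ((hh A).lt hi)]

/-- Associativity of second-order substitution. -/
theorem Term.subst₂_subst₂ {h : Sym → Term} (hh : RankPreserving h) (g : Sym → Term) (t : Term) :
    (t.subst₂ g).subst₂ h = t.subst₂ fun A => (g A).subst₂ h := by
  induction t with
  | node l ts ih =>
    cases l with
    | var i => simp only [Term.subst₂]
    | tm σ => simp only [Term.subst₂, ih]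
    | nt A =>
      simp only [Term.subst₂, Term.subst₂_subst hh]
      refine Term.subst_congr fun i _ => ?_
      split
      · rw [ih]
      · rfl

/-- The weight function that agrees with `φ` except that variables have weight zero. -/
def noVar (φ : Label → ℕ) : Label → ℕ
  | .var _ => 0
  | l => φ l

theorem Term.wt_subst (φ : Label → ℕ) (f : ℕ → Term) (t : Term) :
    (t.subst f).wt φ =
      t.wt fun l => noVar φ l + (match l with | .var i => (f i).wt φ | _ => 0) := by
  induction t with
  | node l ts ih =>
    cases l with
    | var i => simp [Term.subst, RTree.wt_node, noVar, Label.rk]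
    | nt A =>
      refine (RTree.wt_node φ (Label.nt A) _).trans ?_
      simp only [ih]
      rw [RTree.wt_node]
      rfl
    | tm σ =>
      refine (RTree.wt_node φ (Label.tm σ) _).trans ?_
      simp only [ih]
      rw [RTree.wt_node]
      rfl

theorem sum_var_weights {k : ℕ} (a : ℕ → ℕ) (s : List Label) (hs : ∀ i, .var i ∈ s → i < k) :
    (s.map fun l => match l with | .var i => a i | _ => 0).sum =
      ∑ i ∈ Finset.range k, s.count (.var i) * a i := by
  induction s with
  | nil => simp
  | cons l s ih =>
    rw [List.map_cons, List.sum_cons, ih fun i hi => hs i (List.mem_cons_of_mem _ hi)]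
    cases l with
    | var j =>
      have hj := hs j List.mem_cons_self
      simp only [List.count_cons, add_mul, Finset.sum_add_distrib]
      rw [add_comm]
      congr 1
      rw [Finset.sum_eq_single j]
      · simp
      · intro i _ hij
        simp [hij.symm]
      · simp [hj]
    | nt A => simp
    | tm A => simp

theorem RTree.wt_add {Γ : Type} {rk : Γ → ℕ} (φ ψ : Γ → ℕ) (t : RTree Γ rk) :
    (t.wt fun l => φ l + ψ l) = t.wt φ + t.wt ψ := by
  simp [RTree.wt, List.sum_map_add]

theorem IsPattern.wt_subst {k : ℕ} {t : Term} (ht : IsPattern k t) (φ : Label → ℕ)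
    (f : ℕ → Term) :
    (t.subst f).wt φ = t.wt (noVar φ) + ∑ i ∈ Finset.range k, (f i).wt φ := by
  rw [Term.wt_subst, RTree.wt_add]
  congr 1
  refine (sum_var_weights _ _ fun i hi => ht.lt hi).trans (Finset.sum_congr rfl fun i hi => ?_)
  rw [ht i, if_pos (Finset.mem_range.1 hi), one_mul]

/-- The weight of a node of `t` after a second-order substitution of `h` in `t`. -/
def substWt (φ : Label → ℕ) (h : Sym → Term) : Label → ℕ
  | .nt A => (h A).wt (noVar φ)
  | l => φ l

theorem Term.wt_subst₂ (φ : Label → ℕ) {h : Sym → Term} (hh : RankPreserving h) (t : Term) :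
    (t.subst₂ h).wt φ = t.wt (substWt φ h) := by
  induction t with
  | node l ts ih =>
    cases l with
    | var i => rw [node_var_eq, var_subst₂, wt_var, wt_var]; rfl
    | tm σ =>
      refine (RTree.wt_node φ (Label.tm σ) _).trans ?_
      simp only [ih]
      rw [RTree.wt_node]
      rfl
    | nt A =>
      simp only [Term.subst₂, RTree.wt_node, (hh A).wt_subst, substWt]
      rw [Finset.sum_range]
      congr 1
      refine Finset.sum_congr rfl fun i _ => ?_
      rw [dif_pos i.2]
      exact ih i

theorem isPattern_iff {k : ℕ} {t : Term} : IsPattern k t ↔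
    ∀ i, t.wt (fun l => if l = .var i then 1 else 0) = if i < k then 1 else 0 := by
  simp only [IsPattern, count_str_eq_wt]

theorem IsPattern.subst₂ {k : ℕ} {t : Term} (ht : IsPattern k t) {h : Sym → Term}
    (hh : RankPreserving h) : IsPattern k (t.subst₂ h) := by
  rw [isPattern_iff] at ht ⊢
  intro i
  rw [← ht i, Term.wt_subst₂ _ hh]
  refine RTree.wt_congr fun l _ => ?_
  cases l with
  | nt A =>
    simp only [substWt, RTree.wt]
    rw [if_neg (by simp)]
    simp only [List.sum_eq_zero_iff, List.mem_map]
    rintro _ ⟨l, -, rfl⟩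
    cases l <;> simp [noVar]
  | var j => rfl
  | tm σ => rfl

theorem isPattern_init (A : Sym) : IsPattern A.2 (Term.init A) := by
  rw [isPattern_iff]
  intro i
  rw [Term.init, RTree.wt_node]
  simp only [Term.wt_var]
  rw [if_neg (by simp), zero_add, show (Label.nt A).rk = A.2 from rfl]
  simp only [Label.var.injEq]
  rw [← Finset.sum_range (fun j => if j = i then 1 else 0)]
  simp

theorem Term.mem_str_init {A : Sym} {l : Label} :
    l ∈ (Term.init A).str ↔ l = .nt A ∨ ∃ i < A.2, l = .var i := by
  rw [Term.init, RTree.mem_str_node]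
  refine or_congr Iff.rfl ?_
  simp only [Term.str_var, List.mem_singleton]
  exact ⟨fun ⟨i, h⟩ => ⟨i, i.2, h⟩, fun ⟨i, hi, h⟩ => ⟨⟨i, hi⟩, h⟩⟩

theorem RTree.wt_pos_iff {Γ : Type} {rk : Γ → ℕ} (φ : Γ → ℕ) (t : RTree Γ rk) :
    0 < t.wt φ ↔ ∃ l ∈ t.str, 0 < φ l := list_sum_pos_iff _ _

theorem Term.tm_mem_subst₂ {h : Sym → Term} (hh : RankPreserving h) {t : Term} {σ : Sym} :
    .tm σ ∈ (t.subst₂ h).str ↔ .tm σ ∈ t.str ∨ ∃ C, .nt C ∈ t.str ∧ .tm σ ∈ (h C).str := by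
  have key : ∀ s : Term, .tm σ ∈ s.str ↔ 0 < s.wt (noVar fun l => if l = .tm σ then 1 else 0) := by
    intro s
    rw [RTree.wt_pos_iff]
    constructor
    · exact fun hs => ⟨_, hs, by simp [noVar]⟩
    · rintro ⟨l, hl, h0⟩
      cases l with
      | var i => simp [noVar] at h0
      | tm C => simp only [noVar] at h0; split at h0 <;> simp_all
      | nt C => simp [noVar] at h0
  rw [key, Term.wt_subst₂ _ hh, RTree.wt_pos_iff]
  constructor
  · rintro ⟨l, hl, h0⟩
    cases l with
    | var i => simp [substWt, noVar] at h0
    | tm τ =>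
      simp only [substWt, noVar] at h0
      split at h0
      · left; simp_all
      · simp at h0
    | nt C =>
      refine .inr ⟨C, hl, (key _).2 ?_⟩
      simp only [substWt] at h0
      refine lt_of_lt_of_eq h0 (RTree.wt_congr fun l _ => ?_)
      cases l <;> rfl
  · rintro (hσ | ⟨C, hC, hA⟩)
    · exact ⟨_, hσ, by simp [substWt, noVar]⟩
    refine ⟨_, hC, ?_⟩
    rw [key] at hA
    refine lt_of_lt_of_eq hA (RTree.wt_congr fun l _ => ?_)
    cases l <;> rfl

/-! ### Forests and environments -/

/-- The sum of the weights of the nodes of a forest. -/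
def fwt (φ : Label → ℕ) (u : List Term) : ℕ := ((forestStr u).map φ).sum

/-- `u` is a forest of patterns of the multiple rank of `A`. -/
def IsForest (A : List Sym) (u : List Term) : Prop :=
  List.Forall₂ (fun A u => IsPattern A.2 u) A u

theorem mem_forestStr {u : List Term} {l : Label} : l ∈ forestStr u ↔ ∃ t ∈ u, l ∈ t.str := by
  simp [forestStr]

theorem fwt_eq (φ : Label → ℕ) (u : List Term) : fwt φ u = (u.map (RTree.wt φ)).sum := by
  induction u with
  | nil => rfl
  | cons t u ih =>
    rw [List.map_cons, List.sum_cons, ← ih, fwt, fwt, forestStr, List.flatMap_cons, List.map_append,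
      List.sum_append]
    rfl

theorem fwt_subst₂ (φ : Label → ℕ) {h : Sym → Term} (hh : RankPreserving h) (u : List Term) :
    fwt φ (u.map (Term.subst₂ h)) = fwt (substWt φ h) u := by
  rw [fwt_eq, fwt_eq, List.map_map]
  congr 1
  exact List.map_congr_left fun t _ => Term.wt_subst₂ φ hh t

theorem IsForest.subst₂ {A : List Sym} {u : List Term} (hu : IsForest A u) {h : Sym → Term}
    (hh : RankPreserving h) : IsForest A (u.map (Term.subst₂ h)) := by
  unfold IsForest at *
  rw [List.forall₂_map_right_iff]
  exact hu.imp fun _ _ ht => ht.subst₂ hh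

theorem isForest_init (A : List Sym) : IsForest A (A.map Term.init) := by
  unfold IsForest
  rw [List.forall₂_map_right_iff, List.forall₂_same]
  exact fun A _ => isPattern_init A

theorem map_init_subst₂ {h : Sym → Term} (hh : RankPreserving h) (A : List Sym) :
    (A.map Term.init).map (Term.subst₂ h) = A.map h := by
  rw [List.map_map]
  exact List.map_congr_left fun C _ => Term.init_subst₂ (hh C)

theorem exists_rankPreserving_of_nodup {A : List Sym} {u : List Term} (hA : A.Nodup)
    (hu : IsForest A u) : ∃ h, RankPreserving h ∧ A.map h = u := by
  induction hu with
  | nil => exact ⟨Term.init, isPattern_init, rfl⟩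
  | @cons C t A u ht _ ih =>
    obtain ⟨hC, hA⟩ := List.nodup_cons.1 hA
    obtain ⟨h, hh, rfl⟩ := ih hA
    refine ⟨Function.update h C t, fun D => ?_, ?_⟩
    · by_cases hD : D = C
      · subst hD; simpa using ht
      · simpa [hD] using hh D
    · rw [List.map_cons, Function.update_self]
      congr 1
      refine List.map_congr_left fun D hD => Function.update_of_ne ?_ _ _
      rintro rfl
      exact hC hD

theorem ofFn_eq_map {α β : Type} (B : List α) (f : α → β) (x : Fin B.length → β)
    (h : ∀ i, f (B.get i) = x i) : List.ofFn x = B.map f := by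
  conv_rhs => rw [← List.ofFn_get B, List.map_ofFn]
  congr 1
  funext i
  exact (h i).symm

theorem sum_map_eq_sum_get {α : Type} (B : List α) (f : α → ℕ) :
    (B.map f).sum = ∑ i, f (B.get i) := by
  rw [← ofFn_eq_map B f (fun i => f (B.get i)) fun _ => rfl, List.sum_ofFn]

/-- A family of forests for disjoint repetition-free sequences of nonterminals is the restriction of
a rank-preserving second-order substitution. -/
theorem exists_env {B : List (List Sym)} (hB : B.flatten.Nodup) {x : Fin B.length → List Term}
    (hx : ∀ i, IsForest (B.get i) (x i)) :
    ∃ h, RankPreserving h ∧ ∀ i, (B.get i).map h = x i := by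
  have h₂ : List.Forall₂ IsForest B (List.ofFn x) := by
    rw [List.forall₂_iff_get]
    refine ⟨by simp, fun i h₁ _ => ?_⟩
    simpa using hx ⟨i, h₁⟩
  have h₃ : IsForest B.flatten (List.ofFn x).flatten := List.rel_flatten h₂
  obtain ⟨h, hh, he⟩ := exists_rankPreserving_of_nodup hB h₃
  refine ⟨h, hh, ?_⟩
  have h₄ : B.map (List.map h) = List.ofFn x := by
    rw [List.eq_iff_flatten_eq, ← List.map_flatten, he]
    refine ⟨rfl, ?_⟩
    rw [List.map_map, ← List.forall₂_eq_eq_eq, List.forall₂_map_left_iff,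
      List.forall₂_map_right_iff]
    refine h₂.imp fun A u hAu => ?_
    simpa using hAu.length_eq
  intro i
  have := congrArg (fun l : List (List Term) => l[i.1]?) h₄
  simpa using this

theorem lookup_zip_map (A : List Sym) (h : Sym → Term) {C : Sym} (hC : C ∈ A) :
    ((A.zip (A.map h)).lookup C) = some (h C) := by
  induction A with
  | nil => simp at hC
  | cons D A ih =>
    simp only [List.map_cons, List.zip_cons_cons, List.lookup_cons]
    by_cases hD : C = D
    · subst hD; simp
    · simp only [beq_eq_false_iff_ne.2 hD]
      exact ih (by simpa [hD] using hC)

theorem forestSubst_map {u : List Term} {B : List (List Sym)} (h : Sym → Term)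
    (hB : ∀ C, .nt C ∈ forestStr u → ∃ A ∈ B, C ∈ A) :
    forestSubst u B (B.map (List.map h)) = u.map (Term.subst₂ h) := by
  refine List.map_congr_left fun t ht => Term.subst₂_congr fun C hC => ?_
  obtain ⟨A, hA, hCA⟩ := hB C (mem_forestStr.2 ⟨t, ht, hC⟩)
  rw [← List.map_flatten, lookup_zip_map _ _ (List.mem_flatten.2 ⟨A, hA, hCA⟩), Option.getD_some]

theorem forestSubst_ofFn {u : List Term} {B : List (List Sym)} (h : Sym → Term)
    (hB : ∀ C, .nt C ∈ forestStr u → ∃ A ∈ B, C ∈ A) (x : Fin B.length → List Term)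
    (hx : ∀ i, (B.get i).map h = x i) :
    forestSubst u B (List.ofFn x) = u.map (Term.subst₂ h) := by
  rw [ofFn_eq_map B (List.map h) x hx, forestSubst_map h hB]

theorem forestSubst_singleton {u : List Term} {B : List Sym} {x : List Term} (h : Sym → Term)
    (hB : ∀ C, .nt C ∈ forestStr u → C ∈ B) (hx : B.map h = x) :
    forestSubst u [B] [x] = u.map (Term.subst₂ h) := by
  subst hx
  exact forestSubst_map (B := [B]) h (by simpa using hB)

/-- No nonterminal occurs in `u`. -/
def Ground (u : List Term) : Prop := ∀ C, .nt C ∉ forestStr u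

theorem Ground.map_subst₂ {u : List Term} (hu : Ground u) (h : Sym → Term) :
    u.map (Term.subst₂ h) = u := by
  conv_rhs => rw [← List.map_id u]
  refine List.map_congr_left fun t ht => ?_
  exact Term.subst₂_eq_self fun A hA => absurd (mem_forestStr.2 ⟨t, ht, hA⟩) (hu A)

theorem map_subst₂_subst₂ {h : Sym → Term} (hh : RankPreserving h) (g : Sym → Term)
    (u : List Term) : (u.map (Term.subst₂ g)).map (Term.subst₂ h) =
      u.map (Term.subst₂ fun A => (g A).subst₂ h) := by
  rw [List.map_map]
  exact List.map_congr_left fun t _ => Term.subst₂_subst₂ hh g t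

theorem tm_mem_forest_subst₂ {h : Sym → Term} (hh : RankPreserving h) {u : List Term} {σ : Sym} :
    .tm σ ∈ forestStr (u.map (Term.subst₂ h)) ↔
      .tm σ ∈ forestStr u ∨ ∃ C, .nt C ∈ forestStr u ∧ .tm σ ∈ (h C).str := by
  simp only [mem_forestStr, List.mem_map, exists_exists_and_eq_and, Term.tm_mem_subst₂ hh]
  constructor
  · rintro ⟨t, ht, h | ⟨C, hC, hA⟩⟩
    · exact .inl ⟨t, ht, h⟩
    · exact .inr ⟨C, ⟨t, ht, hC⟩, hA⟩
  · rintro (⟨t, ht, h⟩ | ⟨C, ⟨t, ht, hC⟩, hA⟩)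
    · exact ⟨t, ht, .inl h⟩
    · exact ⟨t, ht, .inr ⟨C, hC, hA⟩⟩

/-! ### Values of rules -/

/-- The weight function that agrees with `φ` except that nonterminals have weight zero. -/
def noNt (φ : Label → ℕ) : Label → ℕ
  | .nt _ => 0
  | l => φ l

/-- The list of the nonterminals that occur in a forest. -/
def ntList (u : List Term) : List Sym :=
  (forestStr u).filterMap fun l => match l with
    | .nt C => some C
    | _ => none

theorem mem_ntList {u : List Term} {C : Sym} : C ∈ ntList u ↔ .nt C ∈ forestStr u := by
  simp only [ntList, List.mem_filterMap]
  constructor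
  · rintro ⟨l, hl, h⟩
    cases l <;> simp_all
  · exact fun h => ⟨_, h, rfl⟩

theorem count_ntList (u : List Term) (C : Sym) :
    (ntList u).count C = (forestStr u).count (.nt C) := by
  unfold ntList
  induction forestStr u with
  | nil => rfl
  | cons l s ih =>
    cases l <;> simp [List.count_cons, ih]

theorem fwt_substWt (φ : Label → ℕ) (h : Sym → Term) (u : List Term) :
    fwt (substWt φ h) u = fwt (noNt φ) u + ((ntList u).map fun C => (h C).wt (noVar φ)).sum := by
  unfold fwt ntList
  induction forestStr u with
  | nil => rfl
  | cons l s ih =>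
    cases l <;> simp [ih, substWt, noNt] <;> omega

namespace MCFTG
variable {G : MCFTG}

theorem links_flatten_nodup {ρ : Rule} (hρ : ρ ∈ G.R) : ρ.links.flatten.Nodup := by
  have wf := G.rules_wf ρ hρ
  rw [List.nodup_flatten]
  refine ⟨fun B hB => G.bigN_nodup B (wf.links_mem B hB), ?_⟩
  refine wf.links_nodup.imp_of_mem fun {B B'} hB hB' hne => ?_
  exact fun C h₁ h₂ => wf.links_disjoint B hB B' hB' hne C h₁ h₂

theorem ntList_perm {ρ : Rule} (hρ : ρ ∈ G.R) : (ntList ρ.rhs).Perm ρ.links.flatten := by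
  have wf := G.rules_wf ρ hρ
  rw [List.perm_ext_iff_of_nodup]
  · intro C
    rw [mem_ntList, wf.links_cover, List.mem_flatten]
  · rw [List.nodup_iff_count_le_one]
    intro C
    rw [count_ntList]
    exact wf.uniquely_labeled C
  · exact links_flatten_nodup hρ

/-- The substitution for the links of a rule is a single rank-preserving second-order substitution,
since the links partition the nonterminals of the right-hand side. -/
theorem exists_rule_env {ρ : Rule} (hρ : ρ ∈ G.R) {x : Fin ρ.rk → List Term}
    (hx : ∀ i, IsForest (ρ.links.get i) (x i)) :
    ∃ h, RankPreserving h ∧ (∀ i, (ρ.links.get i).map h = x i) ∧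
      forestSubst ρ.rhs ρ.links (List.ofFn x) = ρ.rhs.map (Term.subst₂ h) := by
  obtain ⟨h, hh, he⟩ := exists_env (links_flatten_nodup hρ) (x := x) hx
  exact ⟨h, hh, he,
    forestSubst_ofFn h (fun C hC => ((G.rules_wf ρ hρ).links_cover C).1 hC) x he⟩

theorem rule_isForest {ρ : Rule} (hρ : ρ ∈ G.R) {x : Fin ρ.rk → List Term}
    (hx : ∀ i, IsForest (ρ.links.get i) (x i)) :
    IsForest ρ.lhs (forestSubst ρ.rhs ρ.links (List.ofFn x)) := by
  obtain ⟨h, hh, -, he⟩ := exists_rule_env hρ hx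
  rw [he]
  exact IsForest.subst₂ (G.rules_wf ρ hρ).rank_eq hh

/-- Weights are additive in the value of a rule, since each nonterminal of the links occurs exactly
once in the right-hand side. -/
theorem rule_fwt {ρ : Rule} (hρ : ρ ∈ G.R) {x : Fin ρ.rk → List Term}
    (hx : ∀ i, IsForest (ρ.links.get i) (x i)) (φ : Label → ℕ) :
    fwt φ (forestSubst ρ.rhs ρ.links (List.ofFn x)) =
      fwt (noNt φ) ρ.rhs + ∑ i, fwt (noVar φ) (x i) := by
  obtain ⟨h, hh, hi, he⟩ := exists_rule_env hρ hx
  rw [he, fwt_subst₂ _ hh, fwt_substWt, ((ntList_perm hρ).map _).sum_eq, List.map_flatten,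
    List.sum_flatten, List.map_map, sum_map_eq_sum_get]
  congr 1
  refine Finset.sum_congr rfl fun i _ => ?_
  rw [← hi i, fwt_eq, List.map_map]
  rfl

end MCFTG

/-- The weight function with value `a σ` at terminals `σ` and zero elsewhere. -/
def termWt (a : Sym → ℕ) : Label → ℕ
  | .tm σ => a σ
  | _ => 0

theorem noVar_termWt (a : Sym → ℕ) : noVar (termWt a) = termWt a := by
  funext l; cases l <;> rfl

theorem noNt_termWt (a : Sym → ℕ) : noNt (termWt a) = termWt a := by
  funext l; cases l <;> rfl

/-- The indicator function of the label `l`. -/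
def indicator (l : Label) : Label → ℕ := fun l' => if l' = l then 1 else 0

theorem count_eq_fwt (l : Label) (u : List Term) : (forestStr u).count l = fwt (indicator l) u :=
  list_count_eq_sum _ _

theorem noVar_indicator_nt (C : Sym) : noVar (indicator (.nt C)) = indicator (.nt C) := by
  funext l; cases l <;> simp [noVar, indicator]

theorem noNt_indicator_nt (C : Sym) : noNt (indicator (.nt C)) = fun _ => 0 := by
  funext l; cases l <;> simp [noNt, indicator]

theorem fwt_zero (u : List Term) : fwt (fun _ => 0) u = 0 := by simp [fwt]

theorem ground_iff {u : List Term} : Ground u ↔ ∀ C, fwt (indicator (.nt C)) u = 0 := by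
  simp only [Ground, ← count_eq_fwt, List.count_eq_zero]

namespace MCFTG
variable {G : MCFTG}

theorem rule_tm_mem {ρ : Rule} (hρ : ρ ∈ G.R) {x : Fin ρ.rk → List Term}
    (hx : ∀ i, IsForest (ρ.links.get i) (x i))
    (hS : ∀ i σ, .tm σ ∈ forestStr (x i) → σ ∈ G.Sig) :
    ∀ σ, .tm σ ∈ forestStr (forestSubst ρ.rhs ρ.links (List.ofFn x)) → σ ∈ G.Sig := by
  obtain ⟨h, hh, hi, he⟩ := exists_rule_env hρ hx
  rw [he]
  intro σ hσ
  rw [tm_mem_forest_subst₂ hh] at hσ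
  rcases hσ with hσ | ⟨C, hC, hσ⟩
  · exact (G.rules_wf ρ hρ).tm_mem σ hσ
  · obtain ⟨B, hB, hCB⟩ := ((G.rules_wf ρ hρ).links_cover C).1 hC
    obtain ⟨i, rfl⟩ := List.get_of_mem hB
    refine hS i σ ?_
    rw [← hi i, mem_forestStr]
    exact ⟨h C, List.mem_map_of_mem hCB, hσ⟩

theorem rule_ground {ρ : Rule} (hρ : ρ ∈ G.R) {x : Fin ρ.rk → List Term}
    (hx : ∀ i, IsForest (ρ.links.get i) (x i)) (hg : ∀ i, Ground (x i)) :
    Ground (forestSubst ρ.rhs ρ.links (List.ofFn x)) := by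
  rw [ground_iff]
  intro C
  rw [rule_fwt hρ hx, noVar_indicator_nt, noNt_indicator_nt, fwt_zero, zero_add]
  exact Finset.sum_eq_zero fun i _ => ground_iff.1 (hg i) C

theorem IsDer.val_props {d : DTree} : ∀ {A : List Sym}, G.IsDer d A → IsForest A d.val ∧
    Ground d.val ∧ ∀ σ, .tm σ ∈ forestStr d.val → σ ∈ G.Sig := by
  induction d with
  | node ρ ts ih =>
    rintro A ⟨hρ, rfl, h⟩
    have h₁ := fun i => (ih i (h i)).1
    have h₂ := fun i => (ih i (h i)).2.1
    have h₃ := fun i => (ih i (h i)).2.2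
    rw [DTree.val]
    exact ⟨rule_isForest hρ h₁, rule_ground hρ h₁ h₂, rule_tm_mem hρ h₁ h₃⟩

theorem IsDer.isForest {d : DTree} {A : List Sym} (h : G.IsDer d A) : IsForest A d.val :=
  h.val_props.1

theorem IsDer.ground {d : DTree} {A : List Sym} (h : G.IsDer d A) : Ground d.val := h.val_props.2.1

theorem IsDer.mem_bigN {d : DTree} {A : List Sym} (h : G.IsDer d A) : A ∈ G.bigN := by
  cases d
  obtain ⟨hρ, rfl, -⟩ := h
  exact (G.rules_wf _ hρ).lhs_mem

/-- The weight of the terminals in the right-hand side of a rule. -/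
def _root_.MCFT.Rule.weight (a : Sym → ℕ) (ρ : Rule) : ℕ := fwt (termWt a) ρ.rhs

/-- Terminals are neither deleted nor copied when a derivation tree is evaluated. -/
theorem IsDer.fwt_val (a : Sym → ℕ) {d : DTree} : ∀ {A : List Sym}, G.IsDer d A →
    fwt (termWt a) d.val = d.wt (Rule.weight a) := by
  induction d with
  | node ρ ts ih =>
    rintro A ⟨hρ, rfl, h⟩
    refine (rule_fwt hρ (fun i => (h i).isForest) (termWt a)).trans ?_
    rw [noNt_termWt, noVar_termWt, RTree.wt_node]
    congr 1
    exact Finset.sum_congr rfl fun i _ => ih i (h i)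

/-- The forest languages consist of the values of the derivation trees. -/
theorem gen_iff {A : List Sym} {u : List Term} :
    G.Gen A u ↔ ∃ d : DTree, G.IsDer d A ∧ d.val = u := by
  constructor
  · intro h
    induction h with
    | mk ρ hρ f _ ih =>
      choose ts h₁ h₂ using ih
      refine ⟨.node ρ ts, ⟨hρ, rfl, h₁⟩, ?_⟩
      exact congrArg (fun x => forestSubst ρ.rhs ρ.links (List.ofFn x)) (funext h₂)
  · rintro ⟨d, hd, rfl⟩
    induction d generalizing A with
    | node ρ ts ih =>
      obtain ⟨hρ, rfl, h⟩ := hd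
      exact Gen.mk ρ hρ (fun i => DTree.val (ts i)) fun i => ih i (h i)

end MCFTG

/-! ### Contexts of derivation trees -/

/-- A derivation tree of height one with subtrees for all links except the one with index `idx`
(the entry of `sib` at `idx` is irrelevant). -/
structure Step where
  rule : Rule
  idx : Fin rule.rk
  sib : Fin rule.rk → DTree

/-- The derivation tree with the subtree `d` at the free position of the step. -/
def Step.fill (s : Step) (d : DTree) : DTree := .node s.rule (Function.update s.sib s.idx d)

/-- The value of `s.fill d` as a function of the value of `d`. -/
def Step.apply (s : Step) (x : List Term) : List Term :=
  forestSubst s.rule.rhs s.rule.links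
    (List.ofFn (Function.update (fun i => DTree.val (s.sib i)) s.idx x))

/-- The total weight of the rules in a step. -/
def Step.wt (f : Rule → ℕ) (s : Step) : ℕ :=
  f s.rule + ∑ j ∈ Finset.univ.erase s.idx, (s.sib j).wt f

/-- Contexts, that is, derivation trees with one hole, are given by the steps on the path from the
root to the hole. -/
abbrev Ctx : Type := List Step

/-- The derivation tree that has `d` in the hole of the context. -/
def Ctx.fill (c : Ctx) (d : DTree) : DTree := c.foldr Step.fill d

/-- The value of `c.fill d` as a function of the value of `d`. -/
def Ctx.apply (c : Ctx) (x : List Term) : List Term := c.foldr Step.apply x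

/-- The total weight of the rules in a context. -/
def Ctx.wt (f : Rule → ℕ) (c : Ctx) : ℕ := (c.map (Step.wt f)).sum

theorem Step.wt_fill (f : Rule → ℕ) (s : Step) (d : DTree) :
    (s.fill d).wt f = s.wt f + d.wt f := by
  rw [Step.fill, RTree.wt_node, Step.wt, add_assoc,
    ← Finset.sum_erase_add _ _ (Finset.mem_univ s.idx), Function.update_self]
  congr 2
  refine Finset.sum_congr rfl fun j hj => ?_
  rw [Function.update_of_ne (Finset.ne_of_mem_erase hj)]

theorem Step.val_fill (s : Step) (d : DTree) : DTree.val (s.fill d) = s.apply (DTree.val d) := by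
  refine congrArg (fun x => forestSubst s.rule.rhs s.rule.links (List.ofFn x)) (funext fun i => ?_)
  by_cases h : i = s.idx
  · subst h; simp
  · simp [h]

theorem Ctx.wt_fill (f : Rule → ℕ) (c : Ctx) (d : DTree) :
    (c.fill d).wt f = c.wt f + d.wt f := by
  induction c with
  | nil => simp [Ctx.fill, Ctx.wt]
  | cons s c ih =>
    change (s.fill (Ctx.fill c d)).wt f = _
    rw [Step.wt_fill, ih, Ctx.wt, Ctx.wt, List.map_cons, List.sum_cons, add_assoc]

theorem Ctx.val_fill (c : Ctx) (d : DTree) : DTree.val (c.fill d) = c.apply (DTree.val d) := by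
  induction c with
  | nil => rfl
  | cons s c ih =>
    change DTree.val (s.fill (Ctx.fill c d)) = s.apply (Ctx.apply c _)
    rw [Step.val_fill, ih]

theorem Ctx.fill_append (c c' : Ctx) (d : DTree) : Ctx.fill (c ++ c') d = c.fill (c'.fill d) :=
  List.foldr_append

theorem Ctx.apply_append (c c' : Ctx) (x : List Term) :
    Ctx.apply (c ++ c') x = c.apply (c'.apply x) := List.foldr_append

theorem Ctx.wt_append (f : Rule → ℕ) (c c' : Ctx) : Ctx.wt f (c ++ c') = c.wt f + c'.wt f := by
  simp [Ctx.wt]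

namespace MCFTG
variable {G : MCFTG}

/-- `s` is a step of `G` from `A` to `B`. -/
structure IsStep (G : MCFTG) (s : Step) (A B : List Sym) : Prop where
  mem : s.rule ∈ G.R
  lhs : s.rule.lhs = A
  get : s.rule.links.get s.idx = B
  sib : ∀ j, j ≠ s.idx → G.IsDer (s.sib j) (s.rule.links.get j)

/-- `c` is a context of derivation trees of `G` with type `A` at the root and type `B` at the hole.
-/
def IsCtx (G : MCFTG) : Ctx → List Sym → List Sym → Prop
  | [], A, B => A = B
  | s :: c, A, B => ∃ A', G.IsStep s A A' ∧ G.IsCtx c A' B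

theorem IsStep.fill {s : Step} {A B : List Sym} (hs : G.IsStep s A B) {d : DTree}
    (hd : G.IsDer d B) : G.IsDer (s.fill d) A := by
  refine ⟨hs.mem, hs.lhs, fun j => ?_⟩
  by_cases h : j = s.idx
  · subst h
    rw [Function.update_self]
    exact hs.get ▸ hd
  · rw [Function.update_of_ne h]
    exact hs.sib j h

theorem isStep_of_isDer {ρ : Rule} {ts : Fin ρ.rk → DTree} {A : List Sym}
    (h : G.IsDer (.node ρ ts) A) (i : Fin ρ.rk) : G.IsStep ⟨ρ, i, ts⟩ A (ρ.links.get i) :=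
  ⟨h.1, h.2.1, rfl, fun j _ => h.2.2 j⟩

theorem _root_.MCFT.Step.fill_self (ρ : Rule) (ts : Fin ρ.rk → DTree) (i : Fin ρ.rk) :
    Step.fill ⟨ρ, i, ts⟩ (ts i) = .node ρ ts := by
  simp [Step.fill]

theorem IsCtx.fill {c : Ctx} {A B : List Sym} (hc : G.IsCtx c A B) {d : DTree}
    (hd : G.IsDer d B) : G.IsDer (c.fill d) A := by
  induction c generalizing A with
  | nil => exact (show A = B from hc) ▸ hd
  | cons s c ih =>
    obtain ⟨A', hs, hc⟩ := hc
    exact hs.fill (ih hc)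

theorem IsCtx.append {c c' : Ctx} {A B C : List Sym} (hc : G.IsCtx c A B)
    (hc' : G.IsCtx c' B C) : G.IsCtx (c ++ c') A C := by
  induction c generalizing A with
  | nil => exact (show A = B from hc) ▸ hc'
  | cons s c ih =>
    obtain ⟨A', hs, hc⟩ := hc
    exact ⟨A', hs, ih hc⟩

theorem isCtx_nil (A : List Sym) : G.IsCtx [] A A := rfl

theorem IsStep.isCtx {s : Step} {A B : List Sym} (hs : G.IsStep s A B) : G.IsCtx [s] A B :=
  ⟨B, hs, rfl⟩

/-! ### Finite ambiguity and bounded derivation trees -/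

/-- The number of lexical symbols in the right-hand side of a rule. -/
def lex (D : List Sym) : Rule → ℕ := Rule.weight fun σ => if σ ∈ D then 1 else 0

/-- The number of terminal symbols in the right-hand side of a rule. -/
def tms : Rule → ℕ := Rule.weight fun _ => 1

theorem _root_.MCFT.length_lexYield (D : List Sym) (s : List Label) :
    (lexYield D s).length = (s.map (termWt fun σ => if σ ∈ D then 1 else 0)).sum := by
  unfold lexYield
  induction s with
  | nil => rfl
  | cons l s ih =>
    cases l with
    | nt A => simpa [termWt] using ih
    | var i => simpa [termWt] using ih
    | tm σ =>
      by_cases h : σ ∈ D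
      · simp [termWt, h, ih, add_comm]
      · simpa [termWt, h] using ih

theorem lexCount_eq (D : List Sym) (ρ : Rule) : ρ.lexCount D = lex D ρ := length_lexYield _ _

theorem mem_language_iff {t : Term} :
    t ∈ G.language ↔ ∃ d : DTree, G.IsDer d [G.S] ∧ DTree.val d = [t] := gen_iff

theorem IsDer.exists_val_eq {d : DTree} (hd : G.IsDer d [G.S]) :
    ∃ t : Term, DTree.val d = [t] ∧ t ∈ G.language := by
  have h := hd.isForest.length_eq
  obtain ⟨t, ht⟩ := List.length_eq_one_iff.1 h.symm
  exact ⟨t, ht, mem_language_iff.2 ⟨d, hd, ht⟩⟩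

theorem _root_.MCFT.length_le_of_count_le_one {s : List Label} (T : Finset Label)
    (h₁ : ∀ l ∈ s, l ∈ T ∨ ∃ σ, l = .tm σ) (h₂ : ∀ l ∈ T, s.count l ≤ 1) :
    s.length ≤ (s.map (termWt fun _ => 1)).sum + T.card := by
  have h₃ : s.length ≤ (s.map (termWt fun _ => 1)).sum + (s.filter (· ∈ T)).length := by
    clear h₂
    induction s with
    | nil => simp
    | cons l s ih =>
      have := ih fun l hl => h₁ l (List.mem_cons_of_mem _ hl)
      rcases h₁ l List.mem_cons_self with h | ⟨σ, rfl⟩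
      · simp only [List.length_cons, List.map_cons, List.sum_cons, List.filter_cons, h,
          decide_true, if_true]
        omega
      · simp only [List.length_cons, List.map_cons, List.sum_cons, List.filter_cons, termWt]
        split
        · simp only [List.length_cons]
          omega
        · omega
  refine h₃.trans (Nat.add_le_add_left ?_ _)
  have hn : (s.filter (· ∈ T)).Nodup := by
    rw [List.nodup_iff_count_le_one]
    intro l
    by_cases hl : l ∈ T
    · exact ((List.filter_sublist (l := s)).count_le l).trans (h₂ l hl)
    · rw [List.count_eq_zero.2 (by simp [hl])]
      exact Nat.zero_le _
  rw [← List.toFinset_card_of_nodup hn]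
  refine Finset.card_le_card fun l hl => ?_
  simp only [List.mem_toFinset, List.mem_filter, decide_eq_true_eq] at hl
  exact hl.2

/-- There are finitely many forests of given multiple rank over given finite alphabets, in which
nonterminals occur at most once and the number of terminals is bounded. -/
theorem _root_.MCFT.finite_forests (A N Sig : List Sym) (m : ℕ) :
    {u : List Term | IsForest A u ∧ (∀ C, (forestStr u).count (.nt C) ≤ 1) ∧
      (∀ C, .nt C ∈ forestStr u → C ∈ N) ∧ (∀ σ, .tm σ ∈ forestStr u → σ ∈ Sig) ∧
      fwt (termWt fun _ => 1) u ≤ m}.Finite := by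
  let K := (A.map Prod.snd).sum
  let T : Finset Label := (N.map Label.nt).toFinset ∪ (Finset.range K).image Label.var
  let L : Finset Label := T ∪ (Sig.map Label.tm).toFinset
  refine (finite_lists_of_finite (RTree.finite_bounded (rk := Label.rk) L.finite_toSet
    (m + T.card)) A.length).subset ?_
  rintro u ⟨hA, hcount, hN, hS, hm⟩
  refine ⟨fun t ht => ?_, hA.length_eq.ge⟩
  obtain ⟨k, hk, hpat⟩ : ∃ k ≤ K, IsPattern k t := by
    obtain ⟨i, hi, rfl⟩ := List.getElem_of_mem ht
    have := List.forall₂_iff_get.1 hA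
    refine ⟨_, ?_, this.2 i (by rw [this.1]; exact hi) hi⟩
    exact List.single_le_sum (fun _ _ => Nat.zero_le _) _ (List.mem_map_of_mem (List.getElem_mem _))
  have hsub : ∀ l ∈ t.str, l ∈ forestStr u := fun l hl => mem_forestStr.2 ⟨t, ht, hl⟩
  have hT : ∀ l ∈ t.str, l ∈ T ∨ ∃ σ ∈ Sig, l = .tm σ := by
    intro l hl
    cases l with
    | nt C => left; simp [T, hN C (hsub _ hl)]
    | tm σ => exact .inr ⟨σ, hS σ (hsub _ hl), rfl⟩
    | var i =>
      have := hpat.lt hl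
      left; simp [T]; omega
  constructor
  · intro l hl
    rcases hT l hl with h | ⟨σ, h, rfl⟩
    · exact Finset.mem_coe.2 (Finset.mem_union_left _ h)
    · exact Finset.mem_union_right _ (List.mem_toFinset.2 (List.mem_map_of_mem h))
  · have hle : t.wt (termWt fun _ => 1) ≤ m := by
      rw [fwt_eq] at hm
      exact (List.single_le_sum (fun _ _ => Nat.zero_le _) _ (List.mem_map_of_mem ht)).trans hm
    refine (length_le_of_count_le_one T (fun l hl => ?_) fun l hl => ?_).trans
      (Nat.add_le_add_right hle _)
    · exact (hT l hl).imp_right fun ⟨σ, _, h⟩ => ⟨σ, h⟩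
    · cases l with
      | nt C =>
        refine le_trans ?_ (hcount C)
        refine List.Sublist.count_le _ ?_
        exact List.sublist_flatten_of_mem (List.mem_map_of_mem ht)
      | tm σ => simp [T] at hl
      | var i => rw [hpat i]; split <;> omega

/-- For every `n`, the derivation trees with at most `n` lexical symbols have a bounded number of
terminal symbols. -/
def Bounded (G : MCFTG) (D : List Sym) : Prop :=
  ∀ n, ∃ m, ∀ d : DTree, G.IsDer d [G.S] → d.wt (lex D) ≤ n → d.wt tms ≤ m

/-- There are finitely many patterns of given rank with a given number of terminals, because
variables occur at most once and only terminals remain in the trees of the language. -/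
theorem finitelyAmbiguous_iff_bounded (D : List Sym) : G.FinitelyAmbiguous D ↔ G.Bounded D := by
  constructor
  · intro h n
    have hfin : {t | t ∈ G.language ∧ (lexYield D t.str).length ≤ n}.Finite := by
      refine ((finite_lists_of_finite (F := {σ | σ ∈ D}) (List.finite_toSet D) n).biUnion
        (t := fun w => {t ∈ G.language | lexYield D t.str = w}) fun w hw => h w hw.1).subset ?_
      rintro t ⟨ht, hn⟩
      refine Set.mem_biUnion (x := lexYield D t.str) ⟨fun σ hσ => ?_, hn⟩ ⟨ht, rfl⟩
      simp only [lexYield, List.mem_filterMap] at hσ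
      obtain ⟨l, -, hl⟩ := hσ
      cases l with
      | tm τ =>
        simp only [Option.ite_none_right_eq_some, Option.some.injEq] at hl
        exact hl.2 ▸ hl.1
      | nt A => simp at hl
      | var i => simp at hl
    obtain ⟨m, hm⟩ := (hfin.image fun t : Term => t.wt (termWt fun _ => 1)).bddAbove
    refine ⟨m, fun d hd hn => ?_⟩
    obtain ⟨t, ht, htL⟩ := hd.exists_val_eq
    have hval : ∀ a, d.wt (Rule.weight a) = t.wt (termWt a) := fun a => by
      rw [← hd.fwt_val, ht, fwt_eq, List.map_singleton, List.sum_singleton]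
    unfold lex tms at *
    rw [hval] at hn ⊢
    refine hm ⟨t, ⟨htL, ?_⟩, rfl⟩
    rwa [length_lexYield]
  · intro h w _
    obtain ⟨m, hm⟩ := h w.length
    refine Set.Finite.subset ((finite_forests [G.S] [] G.Sig m).preimage
      (f := fun t => [t]) (List.singleton_injective.injOn)) ?_
    rintro t ⟨ht, rfl⟩
    obtain ⟨d, hd, hdt⟩ := mem_language_iff.1 ht
    have hp := hd.val_props
    have hval : ∀ a, d.wt (Rule.weight a) = fwt (termWt a) [t] := fun a => by
      rw [← hd.fwt_val, hdt]
    rw [hdt] at hp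
    refine ⟨hp.1, fun C => ?_, fun C hC => absurd hC (hp.2.1 C), hp.2.2, ?_⟩
    · rw [List.count_eq_zero.2 (hp.2.1 C)]
      exact Nat.zero_le _
    · rw [← hval]
      refine hm d hd ?_
      rw [lex, hval, fwt_eq, length_lexYield, List.map_singleton, List.sum_singleton]
      rfl

/-- No productive and reachable type has a context to itself that has terminal symbols but no
lexical symbols. -/
def NoNullLoop (G : MCFTG) (D : List Sym) : Prop :=
  ∀ A c₀ c d, G.IsCtx c₀ [G.S] A → G.IsCtx c A A → G.IsDer d A → c.wt (lex D) = 0 → c.wt tms = 0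

/-- A loop with terminal symbols but without lexical symbols can be pumped. -/
theorem Bounded.noNullLoop {D : List Sym} (h : G.Bounded D) : G.NoNullLoop D := by
  intro A c₀ c d h₀ hc hd hlex
  by_contra hne
  obtain ⟨m, hm⟩ := h (c₀.wt (lex D) + d.wt (lex D))
  have key : ∀ k, ∃ d', G.IsDer d' A ∧ d'.wt (lex D) = d.wt (lex D) ∧ k ≤ d'.wt tms := by
    intro k
    induction k with
    | zero => exact ⟨d, hd, rfl, Nat.zero_le _⟩
    | succ k ih =>
      obtain ⟨d', h₁, h₂, h₃⟩ := ih
      refine ⟨c.fill d', hc.fill h₁, ?_, ?_⟩ <;> rw [Ctx.wt_fill] <;> omega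
  obtain ⟨d', h₁, h₂, h₃⟩ := key (m + 1)
  have := hm _ (h₀.fill h₁) (by rw [Ctx.wt_fill, h₂])
  rw [Ctx.wt_fill] at this
  omega

theorem exists_rule_bound (f : Rule → ℕ) : ∃ m, ∀ ρ ∈ G.R, f ρ ≤ m :=
  ⟨(G.R.map f).sum, fun _ hρ => List.single_le_sum (fun _ _ => Nat.zero_le _) _
    (List.mem_map_of_mem hρ)⟩

/-- A bound for the derivation trees with exactly `n` lexical symbols, in which all subtrees with
`n` lexical symbols have their type in `T`. The smallest such subtree with the type `A` of the root
has as many terminals as the whole tree, and below it the type `A` is excluded. -/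
theorem NoNullLoop.bound_aux {D : List Sym} (h : G.NoNullLoop D) (n m₀ : ℕ)
    (hm₀ : ∀ A c₀ d, G.IsCtx c₀ [G.S] A → G.IsDer d A → d.wt (lex D) < n → d.wt tms ≤ m₀)
    (T : Finset (List Sym)) :
    ∃ m, ∀ A c₀ d, G.IsCtx c₀ [G.S] A → G.IsDer d A → d.wt (lex D) = n →
      (∀ c d' B, G.IsCtx c A B → G.IsDer d' B → d = c.fill d' → d'.wt (lex D) = n → B ∈ T) →
      d.wt tms ≤ m := by
  induction T using Finset.strongInduction with
  | H T ih =>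
    have ih' : ∀ A, ∃ m, A ∈ T → ∀ B c₀ d, G.IsCtx c₀ [G.S] B → G.IsDer d B → d.wt (lex D) = n →
      (∀ c d' C, G.IsCtx c B C → G.IsDer d' C → d = c.fill d' → d'.wt (lex D) = n →
        C ∈ T.erase A) → d.wt tms ≤ m := by
      intro A
      by_cases hA : A ∈ T
      · obtain ⟨m, hm⟩ := ih (T.erase A) (Finset.erase_ssubset hA)
        exact ⟨m, fun _ => hm⟩
      · exact ⟨0, fun h => absurd h hA⟩
    choose b hb using ih'
    let K := max m₀ (T.sup b)
    obtain ⟨m, hm⟩ := G.exists_rule_bound fun ρ => tms ρ + ρ.rk * K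
    refine ⟨m, fun A c₀ d hc₀ hd hn hT => ?_⟩
    have hA : A ∈ T := hT [] d A (isCtx_nil A) hd rfl hn
    obtain ⟨c, d', hc, hd', rfl, hn'⟩ : ∃ c d', G.IsCtx c A A ∧ G.IsDer d' A ∧
        d = c.fill d' ∧ d'.wt (lex D) = n := ⟨[], d, isCtx_nil A, hd, rfl, hn⟩
    -- induction on the size of `d'` finds a smallest subtree of type `A` with `n` lexical symbols
    obtain ⟨k, hk⟩ : ∃ k, d'.str.length = k := ⟨_, rfl⟩
    induction k using Nat.strong_induction_on generalizing c d' with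
    | _ k ihk =>
    by_cases hsmall : ∃ c' d'', G.IsCtx c' A A ∧ G.IsDer d'' A ∧ d' = c'.fill d'' ∧
        d''.wt (lex D) = n ∧ d''.str.length < k
    · obtain ⟨c', d'', hc', hd'', rfl, hn'', hlt⟩ := hsmall
      rw [← Ctx.fill_append] at hd hn hT ⊢
      exact ihk _ hlt (c ++ c') d'' (hc.append hc') hd'' hn'' hd hn hT rfl
    have hc0 : c.wt tms = 0 := by
      refine h A c₀ c d' hc₀ hc hd' ?_
      rw [Ctx.wt_fill] at hn
      omega
    rw [Ctx.wt_fill, hc0, zero_add]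
    obtain ⟨ρ, ts⟩ := d'
    have hstep := fun i => isStep_of_isDer hd' i
    have hlt : ∀ i, (ts i).str.length < k := by
      intro i
      rw [← hk, RTree.length_str_node]
      have := Finset.single_le_sum (f := fun i => (ts i).str.length) (fun _ _ => Nat.zero_le _)
        (Finset.mem_univ i)
      omega
    have hle : ∀ i, (ts i).wt (lex D) ≤ n := by
      intro i
      rw [← hn', RTree.wt_node]
      exact (Finset.single_le_sum (f := fun i => (ts i).wt (lex D)) (fun _ _ => Nat.zero_le _)
        (Finset.mem_univ i)).trans (Nat.le_add_left _ _)
    rw [RTree.wt_node]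
    refine le_trans (Nat.add_le_add_left ?_ _) (hm ρ hd'.1)
    refine (Finset.sum_le_card_nsmul _ _ K fun i _ => ?_).trans (by simp)
    have hreach := (hc₀.append hc).append (hstep i).isCtx
    rcases (hle i).lt_or_eq with hi | hi
    · exact (hm₀ _ _ _ hreach (hd'.2.2 i) hi).trans (le_max_left _ _)
    · refine (hb A hA _ _ _ hreach (hd'.2.2 i) hi fun c' d'' C hc' hd'' he hn'' => ?_).trans
        ((Finset.le_sup hA).trans (le_max_right _ _))
      have hfill : RTree.node ρ ts = Ctx.fill (⟨ρ, i, ts⟩ :: c') d'' := by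
        change _ = Step.fill _ (Ctx.fill c' d'')
        rw [← he, Step.fill_self]
      have hctx : G.IsCtx (⟨ρ, i, ts⟩ :: c') A C := ⟨_, hstep i, hc'⟩
      refine Finset.mem_erase.2 ⟨?_,
        hT (c ++ (⟨ρ, i, ts⟩ :: c')) d'' C (hc.append hctx) hd'' ?_ hn''⟩
      · rintro rfl
        refine hsmall ⟨_, d'', hctx, hd'', hfill, hn'', lt_of_le_of_lt ?_ (hlt i)⟩
        have h1 : ∀ t : DTree, t.str.length = t.wt fun _ => 1 := fun t => by simp [RTree.wt]
        rw [h1, h1, he, Ctx.wt_fill]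
        exact Nat.le_add_left _ _
      · rw [Ctx.fill_append, hfill]

theorem NoNullLoop.bounded {D : List Sym} (h : G.NoNullLoop D) : G.Bounded D := by
  have key : ∀ n, ∃ m, ∀ A c₀ d, G.IsCtx c₀ [G.S] A → G.IsDer d A → d.wt (lex D) < n →
      d.wt tms ≤ m := by
    intro n
    induction n with
    | zero => exact ⟨0, fun A c₀ d _ _ h => absurd h (Nat.not_lt_zero _)⟩
    | succ n ih =>
      obtain ⟨m₀, hm₀⟩ := ih
      obtain ⟨m, hm⟩ := h.bound_aux n m₀ hm₀ G.bigN.toFinset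
      refine ⟨max m₀ m, fun A c₀ d h₀ hd hn => ?_⟩
      rcases (Nat.lt_succ_iff.1 hn).lt_or_eq with hn | hn
      · exact (hm₀ A c₀ d h₀ hd hn).trans (le_max_left _ _)
      · exact (hm A c₀ d h₀ hd hn fun c d' B _ hd' _ _ => List.mem_toFinset.2 hd'.mem_bigN).trans
          (le_max_right _ _)
  intro n
  obtain ⟨m, hm⟩ := key (n + 1)
  exact ⟨m, fun d hd hn => hm _ [] d (isCtx_nil _) hd (Nat.lt_succ_iff.2 hn)⟩

theorem finitelyAmbiguous_iff_noNullLoop (D : List Sym) :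
    G.FinitelyAmbiguous D ↔ G.NoNullLoop D :=
  (finitelyAmbiguous_iff_bounded D).trans ⟨Bounded.noNullLoop, NoNullLoop.bounded⟩

end MCFTG

/-! ### Decidability of finite ambiguity -/

theorem primrecPred_exists_mem {γ β : Type} [Primcodable γ] [Primcodable β] {f : γ → List β}
    {P : γ → β → Prop} (hf : Primrec f) (hP : PrimrecPred fun p : γ × β => P p.1 p.2) :
    PrimrecPred fun g => ∃ b ∈ f g, P g b :=
  (PrimrecRel.exists_mem_list (R := fun b g => P g b)
    (hP.comp (Primrec.pair Primrec.snd Primrec.fst))).comp hf Primrec.id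

theorem primrecPred_forall_mem {γ β : Type} [Primcodable γ] [Primcodable β] {f : γ → List β}
    {P : γ → β → Prop} (hf : Primrec f) (hP : PrimrecPred fun p : γ × β => P p.1 p.2) :
    PrimrecPred fun g => ∀ b ∈ f g, P g b :=
  (PrimrecRel.forall_mem_list (R := fun b g => P g b)
    (hP.comp (Primrec.pair Primrec.snd Primrec.fst))).comp hf Primrec.id

theorem primrecPred_mem {γ β : Type} [Primcodable γ] [Primcodable β] {f : γ → List β}
    {x : γ → β} (hf : Primrec f) (hx : Primrec x) : PrimrecPred fun g => x g ∈ f g :=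
  (primrecPred_exists_mem (P := fun g b => b = x g) hf
    (Primrec.eq.comp Primrec.snd (hx.comp Primrec.fst))).of_eq (by simp)

/-- A list of sublists of `l` that contains all filters of `l`. -/
def subs {β : Type} (l : List β) : List (List β) :=
  l.foldr (fun a acc => acc ++ acc.map (List.cons a)) [[]]

theorem filter_mem_subs {β : Type} (p : β → Bool) (l : List β) : l.filter p ∈ subs l := by
  induction l with
  | nil => simp [subs]
  | cons a l ih =>
    change _ ∈ subs l ++ (subs l).map (List.cons a)
    rw [List.filter_cons, List.mem_append]
    split
    · exact .inr (List.mem_map_of_mem ih)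
    · exact .inl ih

theorem primrec_subs {β : Type} [Primcodable β] : Primrec (subs (β := β)) := by
  refine Primrec.list_foldr (h := fun _ (p : β × List (List β)) =>
    p.2 ++ p.2.map (List.cons p.1)) Primrec.id
    (Primrec.const [[]]) ?_
  refine Primrec.list_append.comp (Primrec.snd.comp Primrec.snd)
    (Primrec.list_map (Primrec.snd.comp Primrec.snd) ?_)
  exact Primrec.list_cons.comp (Primrec.fst.comp (Primrec.snd.comp Primrec.fst)) Primrec.snd

/-- Pairs of positivity tests: whether a derivation tree or context contains lexical symbols, and
whether it contains terminal symbols. -/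
abbrev Bits : Type := Bool × Bool

/-- The pair of the positivity tests for `n` and `m`. -/
def bits (n m : ℕ) : Bits := (decide (0 < n), decide (0 < m))

/-- Disjunction in both components. -/
def Bits.or (w w' : Bits) : Bits := (w.1 || w'.1, w.2 || w'.2)

theorem bits_add (n m n' m' : ℕ) : bits (n + n') (m + m') = Bits.or (bits n m) (bits n' m') := by
  simp [bits, Bits.or]

/-- The possible disjunctions of one pair `w` with `(B, w) ∈ X` for each entry `B` of `links` except
for `e`. -/
def linkBits (X : List (List Sym × Bits)) (e : Option (List Sym)) (links : List (List Sym)) :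
    List Bits :=
  links.foldr (fun B acc => if e = some B then acc else
    X.flatMap fun x => if x.1 = B then acc.map (Bits.or x.2) else []) [(false, false)]

theorem linkBits_cons (X : List (List Sym × Bits)) (e : Option (List Sym)) (B : List Sym)
    (links : List (List Sym)) : linkBits X e (B :: links) =
      if e = some B then linkBits X e links else
        X.flatMap fun x => if x.1 = B then (linkBits X e links).map (Bits.or x.2) else [] := rfl

theorem bits_mem_linkBits {X : List (List Sym × Bits)} {e : Option (List Sym)}
    {links : List (List Sym)} (f g : List Sym → ℕ)
    (h : ∀ B ∈ links, e ≠ some B → (B, bits (f B) (g B)) ∈ X) :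
    bits (links.map fun B => if e = some B then 0 else f B).sum
      (links.map fun B => if e = some B then 0 else g B).sum ∈ linkBits X e links := by
  induction links with
  | nil => simp [linkBits, bits]
  | cons B links ih =>
    have ih := ih fun B hB => h B (List.mem_cons_of_mem _ hB)
    rw [linkBits_cons]
    simp only [List.map_cons, List.sum_cons]
    by_cases he : e = some B
    · simpa only [he, if_true, zero_add] using ih
    · simp only [he, if_false]
      rw [bits_add, List.mem_flatMap]
      refine ⟨_, h B List.mem_cons_self he, ?_⟩
      rw [if_pos rfl]
      exact List.mem_map_of_mem ih

theorem exists_of_mem_linkBits {α : Type} [Nonempty α] {P : α → List Sym → Prop} {f g : α → ℕ}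
    {X : List (List Sym × Bits)} (hX : ∀ x ∈ X, ∃ d, P d x.1 ∧ bits (f d) (g d) = x.2)
    {e : Option (List Sym)} {links : List (List Sym)} (hn : links.Nodup) {w : Bits}
    (hw : w ∈ linkBits X e links) : ∃ T : List Sym → α, (∀ B ∈ links, e ≠ some B → P (T B) B) ∧
      w = bits (links.map fun B => if e = some B then 0 else f (T B)).sum
        (links.map fun B => if e = some B then 0 else g (T B)).sum := by
  classical
  induction links generalizing w with
  | nil =>
    refine ⟨fun _ => Classical.arbitrary α, by simp, ?_⟩
    simpa [linkBits, bits] using hw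
  | cons B links ih =>
    obtain ⟨hB, hn⟩ := List.nodup_cons.1 hn
    rw [linkBits_cons] at hw
    by_cases he : e = some B
    · rw [if_pos he] at hw
      obtain ⟨T, h₁, h₂⟩ := ih hn hw
      refine ⟨T, fun C hC hne => ?_, by simpa only [List.map_cons, List.sum_cons, if_pos he,
        zero_add] using h₂⟩
      rcases List.mem_cons.1 hC with rfl | hC
      · exact absurd he hne
      · exact h₁ C hC hne
    · rw [if_neg he, List.mem_flatMap] at hw
      obtain ⟨x, hx, hw⟩ := hw
      split at hw
      · rename_i hxB
        obtain ⟨w', hw', rfl⟩ := List.mem_map.1 hw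
        obtain ⟨T, h₁, rfl⟩ := ih hn hw'
        obtain ⟨d, hd, hdw⟩ := hX x hx
        refine ⟨Function.update T B d, fun C hC hne => ?_, ?_⟩
        · rcases List.mem_cons.1 hC with rfl | hC'
          · rw [Function.update_self]
            exact hxB ▸ hd
          · rw [Function.update_of_ne (by rintro rfl; exact hB hC')]
            exact h₁ C hC' hne
        · have hupd : ∀ k : α → ℕ, (links.map fun C => if e = some C then 0 else
              k (Function.update T B d C)) = links.map fun C => if e = some C then 0 else k (T C) :=
            fun k => List.map_congr_left fun C hC => by
              rw [Function.update_of_ne (by rintro rfl; exact hB hC)]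
          rw [List.map_cons, List.sum_cons, List.map_cons, List.sum_cons, hupd, hupd, if_neg he,
            if_neg he, Function.update_self, bits_add, hdw]
      · simp at hw

instance : Nonempty DTree := ⟨.node ⟨[], [], []⟩ Fin.elim0⟩

/-- The symbol `σ` occurs as a terminal in the code of a rule. -/
def RuleCode.Has (rc : RuleCode) (σ : Sym) : Prop :=
  ∃ s ∈ rc.2.1, ∃ l ∈ s, l = Sum.inr (Sum.inl σ)

instance (rc : RuleCode) (σ : Sym) : Decidable (rc.Has σ) := by
  unfold RuleCode.Has
  infer_instance

/-- Whether the code of a rule contains symbols of `D`, and symbols of `Sig`. -/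
def RuleCode.bits (Sig D : List Sym) (rc : RuleCode) : Bits :=
  (decide (∃ σ ∈ D, rc.Has σ), decide (∃ σ ∈ Sig, rc.Has σ))

theorem Rule.has_code {ρ : Rule} {σ : Sym} : ρ.code.Has σ ↔ .tm σ ∈ forestStr ρ.rhs := by
  simp only [RuleCode.Has, Rule.code, List.mem_map, exists_exists_and_eq_and, mem_forestStr]
  refine exists_congr fun t => and_congr_right fun _ => ?_
  constructor
  · rintro ⟨l, hl, h⟩
    cases l <;> simp_all [Label.code]
  · exact fun h => ⟨_, h, rfl⟩

theorem Rule.weight_pos_iff (a : Sym → ℕ) (ρ : Rule) :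
    0 < ρ.weight a ↔ ∃ σ, .tm σ ∈ forestStr ρ.rhs ∧ 0 < a σ := by
  rw [Rule.weight, fwt, list_sum_pos_iff]
  constructor
  · rintro ⟨l, hl, h⟩
    cases l with
    | tm σ => exact ⟨σ, hl, h⟩
    | nt A => simp [termWt] at h
    | var i => simp [termWt] at h
  · rintro ⟨σ, hσ, h⟩
    exact ⟨_, hσ, h⟩

theorem MCFTG.bits_code {G : MCFTG} {ρ : Rule} (hρ : ρ ∈ G.R) (D : List Sym) :
    ρ.code.bits G.Sig D = MCFT.bits (MCFTG.lex D ρ) (MCFTG.tms ρ) := by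
  simp only [RuleCode.bits, MCFT.bits, MCFTG.lex, MCFTG.tms, Rule.has_code]
  congr 1
  · refine decide_eq_decide.2 (Iff.trans (exists_congr fun σ => ?_)
      (Rule.weight_pos_iff _ _).symm)
    split <;> simp_all
  · refine decide_eq_decide.2 (Iff.trans (exists_congr fun σ => ?_)
      (Rule.weight_pos_iff _ _).symm)
    simp only [zero_lt_one, and_true, and_iff_right_iff_imp]
    exact (G.rules_wf ρ hρ).tm_mem σ

/-- The possible facts about derivation trees. -/
def treeFacts (bigN : List (List Sym)) : List (List Sym × Bits) :=
  bigN.flatMap fun A => [false, true].flatMap fun b => [false, true].map fun b' => (A, b, b')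

/-- The possible facts about contexts. -/
def ctxFacts (bigN : List (List Sym)) : List (List Sym × List Sym × Bits) :=
  bigN.flatMap fun A => (treeFacts bigN).map (Prod.mk A)

theorem mem_treeFacts {bigN : List (List Sym)} {x : List Sym × Bits} :
    x ∈ treeFacts bigN ↔ x.1 ∈ bigN := by
  obtain ⟨A, b, b'⟩ := x
  simp only [treeFacts, List.mem_flatMap, List.mem_map, Prod.mk.injEq]
  cases b <;> cases b' <;> simp

theorem mem_ctxFacts {bigN : List (List Sym)} {x : List Sym × List Sym × Bits} :
    x ∈ ctxFacts bigN ↔ x.1 ∈ bigN ∧ x.2.1 ∈ bigN := by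
  obtain ⟨A, x⟩ := x
  simp only [ctxFacts, List.mem_flatMap, List.mem_map, mem_treeFacts, Prod.mk.injEq]
  constructor
  · rintro ⟨B, hB, y, hy, rfl, rfl⟩
    exact ⟨hB, hy⟩
  · rintro ⟨h₁, h₂⟩
    exact ⟨A, h₁, x, h₂, rfl, rfl⟩

/-- `X` is closed under the construction of derivation trees from rules. -/
def TreeClosed (c : GrammarCode × List Sym) (X : List (List Sym × Bits)) : Prop :=
  ∀ rc ∈ c.1.2.2.2.2, ∀ w ∈ linkBits X none rc.2.2, (rc.1, Bits.or (rc.bits c.1.2.2.1 c.2) w) ∈ X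

/-- `Y` contains the facts about empty contexts and is closed under adding a step at the root, given
the facts `X` about derivation trees. -/
def CtxClosed (c : GrammarCode × List Sym) (X : List (List Sym × Bits))
    (Y : List (List Sym × List Sym × Bits)) : Prop :=
  (∀ A ∈ c.1.2.1, (A, A, false, false) ∈ Y) ∧
  ∀ rc ∈ c.1.2.2.2.2, ∀ B ∈ rc.2.2, ∀ w ∈ linkBits X (some B) rc.2.2, ∀ y ∈ Y,
    ¬ y.1 = B ∨ (rc.1, y.2.1, Bits.or (Bits.or (rc.bits c.1.2.2.1 c.2) w) y.2.2) ∈ Y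

/-- The facts do not show a reachable and productive type with a loop that contains terminals but no
lexical symbols. -/
def LoopFree (c : GrammarCode × List Sym) (X : List (List Sym × Bits))
    (Y : List (List Sym × List Sym × Bits)) : Prop :=
  ∀ x ∈ X, ∀ y ∈ Y, ¬ (y.1 = [c.1.2.2.2.1] ∧ y.2.1 = x.1 ∧ (x.1, x.1, false, true) ∈ Y)

/-- The decision procedure for finite ambiguity: some set of facts about the derivation trees and
contexts is closed and shows no loop. -/
def Decide (c : GrammarCode × List Sym) : Prop :=
  ∃ X ∈ subs (treeFacts c.1.2.1), ∃ Y ∈ subs (ctxFacts c.1.2.1),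
    TreeClosed c X ∧ CtxClosed c X Y ∧ LoopFree c X Y

namespace MCFTG
variable {G : MCFTG}

theorem sum_step {ρ : Rule} (hρ : ρ ∈ G.R) (i : Fin ρ.links.length)
    (f : List Sym → ℕ) :
    (ρ.links.map fun B => if some (ρ.links.get i) = some B then 0 else f B).sum =
      ∑ j ∈ Finset.univ.erase i, f (ρ.links.get j) := by
  have hn := (G.rules_wf ρ hρ).links_nodup
  rw [sum_map_eq_sum_get, ← Finset.sum_erase (a := i) Finset.univ (by simp)]
  refine Finset.sum_congr rfl fun j hj => if_neg ?_
  rw [Option.some_inj, hn.get_inj_iff]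
  exact (Finset.ne_of_mem_erase hj).symm

theorem sum_rule (ρ : Rule) (f : List Sym → ℕ) :
    (ρ.links.map fun B => if none = some B then 0 else f B).sum =
      ∑ j, f (ρ.links.get j) := by
  rw [sum_map_eq_sum_get]
  rfl

/-- A function on the links that agrees with a given function on the indices of links. -/
theorem exists_link_fun {ρ : Rule} (hρ : ρ ∈ G.R) (ts : Fin ρ.rk → DTree) :
    ∃ T : List Sym → DTree, ∀ i : Fin ρ.links.length, T (ρ.links.get i) = ts i := by
  have hinj : Function.Injective ρ.links.get :=
    List.nodup_iff_injective_get.1 (G.rules_wf ρ hρ).links_nodup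
  classical
  exact ⟨Function.extend ρ.links.get ts fun _ => .node ρ ts, fun i => hinj.extend_apply _ _ i⟩

/-- A closed set contains all true facts about derivation trees. -/
theorem TreeClosed.mem {D : List Sym} {X : List (List Sym × Bits)}
    (hX : TreeClosed (G.code, D) X) {d : DTree} :
    ∀ {A}, G.IsDer d A → (A, bits (d.wt (lex D)) (d.wt tms)) ∈ X := by
  induction d with
  | node ρ ts ih =>
    rintro A ⟨hρ, rfl, h⟩
    obtain ⟨T, hT⟩ := exists_link_fun hρ ts
    have hmem := bits_mem_linkBits (X := X) (e := none) (links := ρ.links)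
      (fun B => (T B).wt (lex D)) (fun B => (T B).wt tms) fun B hB _ => by
        obtain ⟨i, rfl⟩ := List.get_of_mem hB
        rw [hT i]
        exact ih i (h i)
    have := hX ρ.code (List.mem_map_of_mem hρ) _ hmem
    rw [show (G.code, D).1.2.2.1 = G.Sig from rfl, bits_code hρ, ← bits_add, sum_rule, sum_rule]
      at this
    simp only [hT] at this
    rw [RTree.wt_node, RTree.wt_node]
    exact this

/-- A closed set contains all true facts about contexts. -/
theorem CtxClosed.mem {D : List Sym} {X : List (List Sym × Bits)}
    {Y : List (List Sym × List Sym × Bits)}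
    (hX : TreeClosed (G.code, D) X) (hY : CtxClosed (G.code, D) X Y) {B : List Sym}
    (hB : B ∈ G.bigN) {c : Ctx} :
    ∀ {A}, G.IsCtx c A B → (A, B, bits (c.wt (lex D)) (c.wt tms)) ∈ Y := by
  induction c with
  | nil =>
    rintro A rfl
    exact hY.1 A hB
  | cons s c ih =>
    rintro A ⟨A', ⟨hρ, rfl, rfl, hsib⟩, hc⟩
    obtain ⟨T, hT⟩ := exists_link_fun hρ s.sib
    have hmem := bits_mem_linkBits (X := X) (e := some (s.rule.links.get s.idx))
      (links := s.rule.links)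
      (fun B => (T B).wt (lex D)) (fun B => (T B).wt tms) fun B hB hne => by
        obtain ⟨i, rfl⟩ := List.get_of_mem hB
        rw [hT i]
        exact TreeClosed.mem hX (hsib i fun he => hne (by rw [he]))
    rcases hY.2 s.rule.code (List.mem_map_of_mem hρ) _ (List.get_mem _ _) _ hmem _ (ih hc)
      with h | h
    · exact absurd rfl h
    · rw [show (G.code, D).1.2.2.1 = G.Sig from rfl, bits_code hρ, ← bits_add,
        sum_step hρ s.idx, sum_step hρ s.idx, ← bits_add] at h
      simp only [hT] at h
      exact h

/-- Closed sets without loops exist if and only if the sets of all true facts, which are closed,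
have no loops. -/
theorem decide_iff (D : List Sym) : Decide (G.code, D) ↔ G.FinitelyAmbiguous D := by
  classical
  rw [finitelyAmbiguous_iff_noNullLoop]
  constructor
  · rintro ⟨X, -, Y, -, hX, hY, hL⟩ A c₀ c d h₀ hc hd hlex
    by_contra hne
    have hA := hd.mem_bigN
    refine hL _ (TreeClosed.mem hX hd) _ (CtxClosed.mem hX hY hA h₀) ⟨rfl, rfl, ?_⟩
    have := CtxClosed.mem hX hY hA hc
    rw [hlex] at this
    simpa [bits, Nat.pos_of_ne_zero hne] using this
  · intro h
    let P : List Sym × Bits → Prop := fun x =>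
      ∃ d, G.IsDer d x.1 ∧ bits (d.wt (lex D)) (d.wt tms) = x.2
    let Q : List Sym × List Sym × Bits → Prop := fun y =>
      ∃ c : Ctx, G.IsCtx c y.1 y.2.1 ∧ bits (c.wt (lex D)) (c.wt tms) = y.2.2
    have hP : ∀ {x}, x ∈ (treeFacts G.bigN).filter (decide <| P ·) ↔ P x := fun {x} => by
      rw [List.mem_filter, mem_treeFacts, decide_eq_true_iff]
      exact and_iff_right_of_imp fun ⟨d, hd, _⟩ => hd.mem_bigN
    have hQ : ∀ {y}, y ∈ (ctxFacts G.bigN).filter (decide <| Q ·) ↔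
        (y.1 ∈ G.bigN ∧ y.2.1 ∈ G.bigN) ∧ Q y := fun {y} => by
      rw [List.mem_filter, mem_ctxFacts, decide_eq_true_iff]
    refine ⟨_, filter_mem_subs (fun x => decide (P x)) _, _,
      filter_mem_subs (fun y => decide (Q y)) _, ?_, ⟨?_, ?_⟩, ?_⟩
    · intro rc hrc w hw
      obtain ⟨ρ, hρ, rfl⟩ := List.mem_map.1 hrc
      obtain ⟨T, hT, rfl⟩ := exists_of_mem_linkBits (P := G.IsDer) (fun x hx => hP.1 hx)
        (G.rules_wf ρ hρ).links_nodup hw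
      refine hP.2 ⟨.node ρ fun i => T (ρ.links.get i), ⟨hρ, rfl, fun i =>
        hT _ (List.get_mem _ _) (by simp)⟩, ?_⟩
      rw [show (G.code, D).1.2.2.1 = G.Sig from rfl, bits_code hρ, ← bits_add, sum_rule, sum_rule,
        RTree.wt_node, RTree.wt_node]
      rfl
    · exact fun A hA => hQ.2 ⟨⟨hA, hA⟩, [], isCtx_nil A, rfl⟩
    · intro rc hrc B hB w hw y hy
      rw [or_iff_not_imp_left, not_not]
      rintro rfl
      obtain ⟨ρ, hρ, rfl⟩ := List.mem_map.1 hrc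
      obtain ⟨T, hT, rfl⟩ := exists_of_mem_linkBits (P := G.IsDer) (fun x hx => hP.1 hx)
        (G.rules_wf ρ hρ).links_nodup hw
      obtain ⟨⟨-, hy₂⟩, c, hc, hcw⟩ := hQ.1 hy
      obtain ⟨i, hi⟩ : ∃ i : Fin ρ.links.length, ρ.links.get i = y.1 := List.get_of_mem hB
      have hn := (G.rules_wf ρ hρ).links_nodup
      have hs : G.IsStep ⟨ρ, i, fun j => T (ρ.links.get j)⟩ ρ.lhs y.1 := by
        refine ⟨hρ, rfl, hi, fun j hj => hT _ (List.get_mem _ _) ?_⟩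
        exact fun h => hj (hn.get_inj_iff.1 (hi.trans (Option.some_inj.1 h))).symm
      refine hQ.2 ⟨⟨(G.rules_wf ρ hρ).lhs_mem, hy₂⟩,
        ⟨ρ, i, fun j => T (ρ.links.get j)⟩ :: c, ⟨_, hs, hc⟩, ?_⟩
      rw [show (G.code, D).1.2.2.1 = G.Sig from rfl, bits_code hρ, ← bits_add, ← hcw, ← bits_add,
        ← hi, sum_step hρ i, sum_step hρ i]
      rfl
    · rintro x hx y hy ⟨h₁, h₂, h₃⟩
      obtain ⟨d, hd, -⟩ := hP.1 hx
      obtain ⟨-, c₀, h₀, -⟩ := hQ.1 hy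
      obtain ⟨-, c, hc, hbits⟩ := hQ.1 h₃
      rw [h₁, h₂] at h₀
      have := h x.1 c₀ c d h₀ hc hd
      simp [bits] at hbits
      omega

end MCFTG

theorem primrec_or {γ : Type} [Primcodable γ] {f g : γ → Bits} (hf : Primrec f) (hg : Primrec g) :
    Primrec fun x => Bits.or (f x) (g x) :=
  Primrec.pair (Primrec.or.comp (Primrec.fst.comp hf) (Primrec.fst.comp hg))
    (Primrec.or.comp (Primrec.snd.comp hf) (Primrec.snd.comp hg))

theorem primrec_linkBits {γ : Type} [Primcodable γ] {X : γ → List (List Sym × Bits)}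
    {e : γ → Option (List Sym)} {links : γ → List (List Sym)} (hX : Primrec X) (he : Primrec e)
    (hl : Primrec links) : Primrec fun g => linkBits (X g) (e g) (links g) := by
  refine Primrec.list_foldr (h := fun g p => if e g = some p.1 then p.2 else
    (X g).flatMap fun x => if x.1 = p.1 then p.2.map (Bits.or x.2) else []) hl (Primrec.const _) ?_
  refine Primrec.ite (Primrec.eq.comp (he.comp Primrec.fst)
    (Primrec.option_some.comp (Primrec.fst.comp Primrec.snd))) (Primrec.snd.comp Primrec.snd) ?_
  refine Primrec.list_flatMap (hX.comp Primrec.fst) ?_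
  refine Primrec.ite (Primrec.eq.comp (Primrec.fst.comp Primrec.snd)
    (Primrec.fst.comp (Primrec.snd.comp Primrec.fst))) ?_ (Primrec.const _)
  refine Primrec.list_map (Primrec.snd.comp (Primrec.snd.comp Primrec.fst)) ?_
  exact primrec_or (Primrec.snd.comp (Primrec.snd.comp Primrec.fst)) Primrec.snd

theorem primrecPred_has {γ : Type} [Primcodable γ] {rc : γ → RuleCode} {σ : γ → Sym}
    (hrc : Primrec rc) (hσ : Primrec σ) : PrimrecPred fun g => (rc g).Has (σ g) := by
  refine primrecPred_exists_mem (Primrec.fst.comp (Primrec.snd.comp hrc)) ?_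
  refine primrecPred_exists_mem Primrec.snd (Primrec.eq.comp Primrec.snd ?_)
  exact Primrec.sumInr.comp (Primrec.sumInl.comp (hσ.comp (Primrec.fst.comp Primrec.fst)))

theorem primrec_ruleBits {γ : Type} [Primcodable γ] {Sig D : γ → List Sym} {rc : γ → RuleCode}
    (hS : Primrec Sig) (hD : Primrec D) (hrc : Primrec rc) :
    Primrec fun g => (rc g).bits (Sig g) (D g) :=
  Primrec.pair
    (primrecPred_exists_mem hD (primrecPred_has (hrc.comp Primrec.fst) Primrec.snd)).decide
    (primrecPred_exists_mem hS (primrecPred_has (hrc.comp Primrec.fst) Primrec.snd)).decide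

theorem primrec_treeFacts : Primrec treeFacts := by
  refine Primrec.list_flatMap Primrec.id ?_
  refine Primrec.list_flatMap (Primrec.const _) ?_
  refine Primrec.list_map (Primrec.const _) ?_
  exact Primrec.pair (Primrec.snd.comp (Primrec.fst.comp Primrec.fst))
    (Primrec.pair (Primrec.snd.comp Primrec.fst) Primrec.snd)

theorem primrec_ctxFacts : Primrec ctxFacts := by
  refine Primrec.list_flatMap Primrec.id ?_
  refine Primrec.list_map (primrec_treeFacts.comp Primrec.fst) ?_
  exact Primrec.pair (Primrec.snd.comp Primrec.fst) Primrec.snd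

theorem primrec_code_rules : Primrec fun c : GrammarCode × List Sym => c.1.2.2.2.2 :=
  Primrec.snd.comp (Primrec.snd.comp (Primrec.snd.comp (Primrec.snd.comp Primrec.fst)))

theorem primrec_code_sig : Primrec fun c : GrammarCode × List Sym => c.1.2.2.1 :=
  Primrec.fst.comp (Primrec.snd.comp (Primrec.snd.comp Primrec.fst))

theorem primrec_code_start : Primrec fun c : GrammarCode × List Sym => c.1.2.2.2.1 :=
  Primrec.fst.comp (Primrec.snd.comp (Primrec.snd.comp (Primrec.snd.comp Primrec.fst)))

theorem primrec_code_bigN : Primrec fun c : GrammarCode × List Sym => c.1.2.1 :=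
  Primrec.fst.comp (Primrec.snd.comp Primrec.fst)

theorem primrecPred_treeClosed {γ : Type} [Primcodable γ] {c : γ → GrammarCode × List Sym}
    {X : γ → List (List Sym × Bits)} (hc : Primrec c) (hX : Primrec X) :
    PrimrecPred fun g => TreeClosed (c g) (X g) := by
  refine primrecPred_forall_mem (primrec_code_rules.comp hc) ?_
  refine primrecPred_forall_mem (primrec_linkBits (hX.comp Primrec.fst) (Primrec.const none)
    (Primrec.snd.comp (Primrec.snd.comp Primrec.snd))) ?_
  refine primrecPred_mem (hX.comp (Primrec.fst.comp Primrec.fst)) ?_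
  have hrc : Primrec fun p : (γ × RuleCode) × Bits => p.1.2 := Primrec.snd.comp Primrec.fst
  have hc' : Primrec fun p : (γ × RuleCode) × Bits => c p.1.1 :=
    hc.comp (Primrec.fst.comp Primrec.fst)
  exact Primrec.pair (Primrec.fst.comp hrc) (primrec_or
    (primrec_ruleBits (primrec_code_sig.comp hc') (Primrec.snd.comp hc') hrc) Primrec.snd)

theorem primrecPred_ctxClosed {γ : Type} [Primcodable γ] {c : γ → GrammarCode × List Sym}
    {X : γ → List (List Sym × Bits)} {Y : γ → List (List Sym × List Sym × Bits)}
    (hc : Primrec c) (hX : Primrec X) (hY : Primrec Y) :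
    PrimrecPred fun g => CtxClosed (c g) (X g) (Y g) := by
  refine PrimrecPred.and ?_ ?_
  · refine primrecPred_forall_mem (primrec_code_bigN.comp hc) ?_
    exact primrecPred_mem (hY.comp Primrec.fst)
      (Primrec.pair Primrec.snd (Primrec.pair Primrec.snd (Primrec.const _)))
  refine primrecPred_forall_mem (primrec_code_rules.comp hc) ?_
  refine primrecPred_forall_mem (Primrec.snd.comp (Primrec.snd.comp Primrec.snd)) ?_
  refine primrecPred_forall_mem (primrec_linkBits (hX.comp (Primrec.fst.comp Primrec.fst))
    (Primrec.option_some.comp Primrec.snd)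
    (Primrec.snd.comp (Primrec.snd.comp (Primrec.snd.comp Primrec.fst)))) ?_
  refine primrecPred_forall_mem (hY.comp (Primrec.fst.comp (Primrec.fst.comp Primrec.fst))) ?_
  have hg : Primrec fun p : (((γ × RuleCode) × List Sym) × Bits) × List Sym × List Sym × Bits =>
    p.1.1.1.1 := Primrec.fst.comp (Primrec.fst.comp (Primrec.fst.comp Primrec.fst))
  have hrc : Primrec fun p : (((γ × RuleCode) × List Sym) × Bits) × List Sym × List Sym × Bits =>
    p.1.1.1.2 := Primrec.snd.comp (Primrec.fst.comp (Primrec.fst.comp Primrec.fst))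
  refine PrimrecPred.or (PrimrecPred.not (Primrec.eq.comp (Primrec.fst.comp Primrec.snd)
    (Primrec.snd.comp (Primrec.fst.comp Primrec.fst)))) ?_
  refine primrecPred_mem (hY.comp hg) (Primrec.pair (Primrec.fst.comp hrc)
    (Primrec.pair (Primrec.fst.comp (Primrec.snd.comp Primrec.snd)) ?_))
  exact primrec_or (primrec_or (primrec_ruleBits (primrec_code_sig.comp (hc.comp hg))
    (Primrec.snd.comp (hc.comp hg)) hrc) (Primrec.snd.comp Primrec.fst))
    (Primrec.snd.comp (Primrec.snd.comp Primrec.snd))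

theorem primrecPred_loopFree {γ : Type} [Primcodable γ] {c : γ → GrammarCode × List Sym}
    {X : γ → List (List Sym × Bits)} {Y : γ → List (List Sym × List Sym × Bits)}
    (hc : Primrec c) (hX : Primrec X) (hY : Primrec Y) :
    PrimrecPred fun g => LoopFree (c g) (X g) (Y g) := by
  refine primrecPred_forall_mem hX ?_
  refine primrecPred_forall_mem (hY.comp Primrec.fst) (PrimrecPred.not ?_)
  have hg : Primrec fun p : (γ × List Sym × Bits) × List Sym × List Sym × Bits => p.1.1 :=
    Primrec.fst.comp Primrec.fst
  have hx : Primrec fun p : (γ × List Sym × Bits) × List Sym × List Sym × Bits => p.1.2.1 :=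
    Primrec.fst.comp (Primrec.snd.comp Primrec.fst)
  refine PrimrecPred.and (Primrec.eq.comp (Primrec.fst.comp Primrec.snd)
    (Primrec.list_cons.comp (primrec_code_start.comp (hc.comp hg)) (Primrec.const []))) ?_
  refine PrimrecPred.and (Primrec.eq.comp (Primrec.fst.comp (Primrec.snd.comp Primrec.snd)) hx) ?_
  exact primrecPred_mem (hY.comp hg) (Primrec.pair hx (Primrec.pair hx (Primrec.const _)))

theorem primrecPred_decide : PrimrecPred Decide := by
  refine primrecPred_exists_mem (primrec_subs.comp (primrec_treeFacts.comp primrec_code_bigN)) ?_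
  refine primrecPred_exists_mem
    (primrec_subs.comp (primrec_ctxFacts.comp (primrec_code_bigN.comp Primrec.fst))) ?_
  have hc : Primrec fun p : ((GrammarCode × List Sym) × List (List Sym × Bits)) ×
    List (List Sym × List Sym × Bits) => p.1.1 := Primrec.fst.comp Primrec.fst
  have hX : Primrec fun p : ((GrammarCode × List Sym) × List (List Sym × Bits)) ×
    List (List Sym × List Sym × Bits) => p.1.2 := Primrec.snd.comp Primrec.fst
  exact (primrecPred_treeClosed hc hX).and
    ((primrecPred_ctxClosed hc hX Primrec.snd).and (primrecPred_loopFree hc hX Primrec.snd))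

namespace MCFTG
variable {G : MCFTG}

/-! ### Values of contexts -/

/-- The family of the values of all children of a step, with the forest `x` at the free position. -/
def _root_.MCFT.Step.family (s : Step) (x : List Term) : Fin s.rule.rk → List Term :=
  Function.update (fun i => DTree.val (s.sib i)) s.idx x

theorem _root_.MCFT.Step.family_self (s : Step) (x : List Term) : s.family x s.idx = x :=
  Function.update_self ..

theorem _root_.MCFT.Step.family_of_ne (s : Step) (x : List Term) {j : Fin s.rule.rk}
    (h : j ≠ s.idx) : s.family x j = DTree.val (s.sib j) := Function.update_of_ne h ..

theorem IsStep.family_isForest {s : Step} {A B : List Sym} (hs : G.IsStep s A B) {x : List Term}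
    (hx : IsForest B x) (j : Fin s.rule.rk) : IsForest (s.rule.links.get j) (s.family x j) := by
  by_cases h : j = s.idx
  · subst h
    rw [Step.family_self]
    exact hs.get ▸ hx
  · rw [Step.family_of_ne _ _ h]
    exact (hs.sib j h).isForest

theorem IsStep.apply_isForest {s : Step} {A B : List Sym} (hs : G.IsStep s A B) {x : List Term}
    (hx : IsForest B x) : IsForest A (s.apply x) :=
  hs.lhs ▸ rule_isForest hs.mem (hs.family_isForest hx)

theorem IsStep.apply_fwt {s : Step} {A B : List Sym} (hs : G.IsStep s A B) {x : List Term}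
    (hx : IsForest B x) (φ : Label → ℕ) : fwt φ (s.apply x) = fwt (noNt φ) s.rule.rhs +
      ((∑ j ∈ Finset.univ.erase s.idx, fwt (noVar φ) (DTree.val (s.sib j))) +
        fwt (noVar φ) x) := by
  refine (rule_fwt hs.mem (hs.family_isForest hx) φ).trans ?_
  rw [← Finset.sum_erase_add _ _ (Finset.mem_univ s.idx), Step.family_self]
  congr 2
  exact Finset.sum_congr rfl fun j hj => by rw [Step.family_of_ne _ _ (Finset.ne_of_mem_erase hj)]

theorem IsStep.apply_count_nt {s : Step} {A B : List Sym} (hs : G.IsStep s A B) {x : List Term}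
    (hx : IsForest B x) (C : Sym) :
    (forestStr (s.apply x)).count (.nt C) = (forestStr x).count (.nt C) := by
  rw [count_eq_fwt, count_eq_fwt, hs.apply_fwt hx, noVar_indicator_nt, noNt_indicator_nt, fwt_zero,
    zero_add, Finset.sum_eq_zero, zero_add]
  exact fun j hj => ground_iff.1 (hs.sib j (Finset.ne_of_mem_erase hj)).ground C

theorem IsStep.apply_termWt {s : Step} {A B : List Sym} (hs : G.IsStep s A B) {x : List Term}
    (hx : IsForest B x) (a : Sym → ℕ) :
    fwt (termWt a) (s.apply x) = s.wt (Rule.weight a) + fwt (termWt a) x := by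
  rw [hs.apply_fwt hx, noVar_termWt, noNt_termWt, Step.wt, ← add_assoc]
  congr 2
  exact Finset.sum_congr rfl fun j hj => (hs.sib j (Finset.ne_of_mem_erase hj)).fwt_val a

theorem IsStep.apply_tm_mem {s : Step} {A B : List Sym} (hs : G.IsStep s A B) {x : List Term}
    (hx : IsForest B x) (hS : ∀ σ, .tm σ ∈ forestStr x → σ ∈ G.Sig) :
    ∀ σ, .tm σ ∈ forestStr (s.apply x) → σ ∈ G.Sig := by
  refine rule_tm_mem (x := s.family x) hs.mem (hs.family_isForest hx) fun j => ?_
  by_cases h : j = s.idx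
  · subst h
    rwa [Step.family_self]
  · rw [Step.family_of_ne s x h]
    exact (hs.sib j h).val_props.2.2

/-- Second-order substitution in the value of a rule acts on the values of the children. -/
theorem rule_map_subst₂ {ρ : Rule} (hρ : ρ ∈ G.R) {x : Fin ρ.rk → List Term}
    (hx : ∀ i, IsForest (ρ.links.get i) (x i)) {h : Sym → Term} (hh : RankPreserving h) :
    (forestSubst ρ.rhs ρ.links (List.ofFn x)).map (Term.subst₂ h) =
      forestSubst ρ.rhs ρ.links (List.ofFn fun i => (x i).map (Term.subst₂ h)) := by
  obtain ⟨g, hg, hi, he⟩ := exists_rule_env hρ hx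
  rw [he, map_subst₂_subst₂ hh]
  refine (forestSubst_ofFn (fun A => (g A).subst₂ h)
    (fun C hC => ((G.rules_wf ρ hρ).links_cover C).1 hC) (fun i => (x i).map (Term.subst₂ h))
    fun i => ?_).symm
  rw [← hi i, List.map_map]
  rfl

theorem IsStep.apply_map_subst₂ {s : Step} {A B : List Sym} (hs : G.IsStep s A B) {x : List Term}
    (hx : IsForest B x) {h : Sym → Term} (hh : RankPreserving h) :
    (s.apply x).map (Term.subst₂ h) = s.apply (x.map (Term.subst₂ h)) := by
  refine (rule_map_subst₂ hs.mem (hs.family_isForest hx) hh).trans ?_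
  refine congrArg (fun x => forestSubst s.rule.rhs s.rule.links (List.ofFn x)) (funext fun j => ?_)
  change _ = s.family _ j
  by_cases hj : j = s.idx
  · subst hj
    rw [Step.family_self, Step.family_self]
  · rw [Step.family_of_ne _ _ hj, Step.family_of_ne _ _ hj]
    exact (hs.sib j hj).ground.map_subst₂ h

theorem IsCtx.apply_isForest {c : Ctx} {A B : List Sym} (hc : G.IsCtx c A B) {x : List Term}
    (hx : IsForest B x) : IsForest A (c.apply x) := by
  induction c generalizing A with
  | nil => exact (show A = B from hc) ▸ hx
  | cons s c ih =>
    obtain ⟨A', hs, hc⟩ := hc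
    exact hs.apply_isForest (ih hc)

theorem IsCtx.apply_count_nt {c : Ctx} {A B : List Sym} (hc : G.IsCtx c A B) {x : List Term}
    (hx : IsForest B x) (C : Sym) :
    (forestStr (c.apply x)).count (.nt C) = (forestStr x).count (.nt C) := by
  induction c generalizing A with
  | nil => rfl
  | cons s c ih =>
    obtain ⟨A', hs, hc⟩ := hc
    exact (hs.apply_count_nt (hc.apply_isForest hx) C).trans (ih hc)

theorem IsCtx.apply_termWt {c : Ctx} {A B : List Sym} (hc : G.IsCtx c A B) {x : List Term}
    (hx : IsForest B x) (a : Sym → ℕ) :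
    fwt (termWt a) (c.apply x) = c.wt (Rule.weight a) + fwt (termWt a) x := by
  induction c generalizing A with
  | nil => exact (zero_add _).symm
  | cons s c ih =>
    obtain ⟨A', hs, hc⟩ := hc
    refine (hs.apply_termWt (hc.apply_isForest hx) a).trans ?_
    rw [ih hc, Ctx.wt, Ctx.wt, List.map_cons, List.sum_cons, add_assoc]

theorem IsCtx.apply_tm_mem {c : Ctx} {A B : List Sym} (hc : G.IsCtx c A B) {x : List Term}
    (hx : IsForest B x) (hS : ∀ σ, .tm σ ∈ forestStr x → σ ∈ G.Sig) :
    ∀ σ, .tm σ ∈ forestStr (c.apply x) → σ ∈ G.Sig := by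
  induction c generalizing A with
  | nil => exact hS
  | cons s c ih =>
    obtain ⟨A', hs, hc⟩ := hc
    exact hs.apply_tm_mem (hc.apply_isForest hx) (ih hc)

theorem IsCtx.apply_map_subst₂ {c : Ctx} {A B : List Sym} (hc : G.IsCtx c A B) {x : List Term}
    (hx : IsForest B x) {h : Sym → Term} (hh : RankPreserving h) :
    (c.apply x).map (Term.subst₂ h) = c.apply (x.map (Term.subst₂ h)) := by
  induction c generalizing A with
  | nil => rfl
  | cons s c ih =>
    obtain ⟨A', hs, hc⟩ := hc
    refine (hs.apply_map_subst₂ (hc.apply_isForest hx) hh).trans ?_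
    rw [ih hc]
    rfl

theorem _root_.MCFT.tm_notMem_init (B : List Sym) (σ : Sym) :
    .tm σ ∉ forestStr (B.map Term.init) := by
  rw [mem_forestStr]
  rintro ⟨t, ht, h⟩
  obtain ⟨C, -, rfl⟩ := List.mem_map.1 ht
  rw [Term.mem_str_init] at h
  simp at h

theorem _root_.MCFT.nt_mem_init {B : List Sym} {C : Sym} :
    .nt C ∈ forestStr (B.map Term.init) ↔ C ∈ B := by
  rw [mem_forestStr]
  constructor
  · rintro ⟨t, ht, h⟩
    obtain ⟨A, hA, rfl⟩ := List.mem_map.1 ht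
    rw [Term.mem_str_init] at h
    rcases h with h | ⟨_, _, h⟩
    · cases h
      exact hA
    · cases h
  · exact fun h => ⟨_, List.mem_map_of_mem h, Term.mem_str_init.2 (.inl rfl)⟩

theorem _root_.MCFT.count_nt_init (B : List Sym) (C : Sym) :
    (forestStr (B.map Term.init)).count (.nt C) = B.count C := by
  rw [count_eq_fwt, fwt_eq, List.map_map]
  refine Eq.trans ?_ (list_count_eq_sum C B).symm
  congr 1
  refine List.map_congr_left fun A _ => ?_
  rw [Function.comp_apply, Term.init, RTree.wt_node, Finset.sum_eq_zero]
  · simp [indicator]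
  · intro i _
    rw [Term.wt_var]
    rfl

theorem _root_.MCFT.termWt_init (B : List Sym) (a : Sym → ℕ) :
    fwt (termWt a) (B.map Term.init) = 0 := by
  rw [← Nat.le_zero, ← not_lt, fwt, list_sum_pos_iff]
  rintro ⟨l, hl, h⟩
  cases l with
  | tm σ => exact tm_notMem_init B σ hl
  | nt A => exact absurd h (lt_irrefl _)
  | var i => exact absurd h (lt_irrefl _)

/-- The value of a context is determined by its value at the hole itself. -/
theorem IsCtx.forestSubst_apply_init {c : Ctx} {A B : List Sym} (hc : G.IsCtx c A B)
    (hB : B.Nodup) {x : List Term} (hx : IsForest B x) :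
    forestSubst (c.apply (B.map Term.init)) [B] [x] = c.apply x := by
  obtain ⟨h, hh, rfl⟩ := exists_rankPreserving_of_nodup hB hx
  rw [forestSubst_singleton h ?_ rfl, hc.apply_map_subst₂ (isForest_init B) hh,
    map_init_subst₂ hh]
  intro C hC
  rw [← List.count_pos_iff, hc.apply_count_nt (isForest_init B), List.count_pos_iff] at hC
  exact nt_mem_init.1 hC

/-! ### Regular sets of derivation trees -/

/-- A family of tree languages, indexed by a finite set, is regular if membership of a tree is
determined by the membership of its immediate subtrees. -/
theorem _root_.MCFT.isRegular_of_states {Γ Q : Type} {rk : Γ → ℕ} {Ω : Set Γ} [Finite Q]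
    (δ : Q → (a : Γ) → (Fin (rk a) → Q) → Prop) (P : RTree Γ rk → Q → Prop)
    (hΩ : ∀ q a qs, δ q a qs → a ∈ Ω)
    (hP : ∀ a ts q, P (.node a ts) q ↔ ∃ qs, δ q a qs ∧ ∀ i, P (ts i) (qs i)) (q : Q) :
    IsRegular Ω {t | P t q} := by
  refine ⟨Q, inferInstance, q, δ, hΩ, Set.ext fun t => ?_⟩
  change P t q ↔ t.Derives δ q
  induction t generalizing q with
  | node a ts ih => simp only [hP, RTree.Derives, ih]

theorem isRegular_isDer {A : List Sym} (hA : A ∈ G.bigN) :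
    IsRegular {ρ | ρ ∈ G.R} {d | G.IsDer d A} := by
  have : Finite {B // B ∈ G.bigN} := List.finite_toSet G.bigN
  refine isRegular_of_states (rk := Rule.rk) (Q := {B // B ∈ G.bigN})
    (fun q ρ qs => ρ ∈ G.R ∧ ρ.lhs = q.1 ∧ ∀ i, (qs i).1 = ρ.links.get i)
    (fun d q => G.IsDer d q.1) (fun _ _ _ h => h.1) (fun ρ ts q => ?_) ⟨A, hA⟩
  constructor
  · rintro ⟨hρ, h, hi⟩
    exact ⟨fun i => ⟨_, (hi i).mem_bigN⟩, ⟨hρ, h, fun _ => rfl⟩, hi⟩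
  · rintro ⟨qs, ⟨hρ, h, hq⟩, hi⟩
    exact ⟨hρ, h, fun i => hq i ▸ hi i⟩

/-- The derivation trees with at least two lexical symbols form a regular set. -/
theorem isRegular_heavy (D : List Sym) {A : List Sym} (hA : A ∈ G.bigN) :
    IsRegular {ρ | ρ ∈ G.R} {d | G.IsDer d A ∧ 2 ≤ d.wt (lex D)} := by
  have : Finite {B // B ∈ G.bigN} := List.finite_toSet G.bigN
  have key := isRegular_of_states (rk := Rule.rk) (Q := {B // B ∈ G.bigN} × Fin 3)
    (Ω := {ρ | ρ ∈ G.R})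
    (fun q ρ qs => ρ ∈ G.R ∧ ρ.lhs = q.1.1 ∧ (∀ i, (qs i).1.1 = ρ.links.get i) ∧
      q.2.1 = min 2 (lex D ρ + ∑ i, (qs i).2.1))
    (fun d q => G.IsDer d q.1.1 ∧ q.2.1 = min 2 (d.wt (lex D))) (fun _ _ _ h => h.1) ?_
    (⟨A, hA⟩, ⟨2, by omega⟩)
  · have h₂ : ∀ d : DTree, (2 = min 2 (d.wt (lex D))) ↔ 2 ≤ d.wt (lex D) := fun d => by omega
    simpa only [h₂] using key
  · -- truncation at 2 is compatible with sums
    have hmin : ∀ (n : ℕ) {k : ℕ} (f : Fin k → ℕ),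
        min 2 (n + ∑ i, min 2 (f i)) = min 2 (n + ∑ i, f i) := by
      intro n k f
      by_cases h : ∃ i, 2 ≤ f i
      · obtain ⟨i, hi⟩ := h
        have h₁ := Finset.single_le_sum (f := f) (fun _ _ => Nat.zero_le _) (Finset.mem_univ i)
        have h₂ := Finset.single_le_sum (f := fun i => min 2 (f i)) (fun _ _ => Nat.zero_le _)
          (Finset.mem_univ i)
        omega
      · push Not at h
        rw [Finset.sum_congr rfl fun i _ => min_eq_right (h i).le]
    intro ρ ts q
    constructor
    · rintro ⟨⟨hρ, h, hi⟩, hq⟩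
      refine ⟨fun i => (⟨_, (hi i).mem_bigN⟩, ⟨min 2 ((ts i).wt (lex D)), by omega⟩),
        ⟨hρ, h, fun _ => rfl, ?_⟩, fun i => ⟨hi i, rfl⟩⟩
      rw [hq, RTree.wt_node, hmin]
    · rintro ⟨qs, ⟨hρ, h, hq, hw⟩, hi⟩
      refine ⟨⟨hρ, h, fun i => hq i ▸ (hi i).1⟩, ?_⟩
      rw [hw, RTree.wt_node, ← hmin _ fun i => (ts i).wt (lex D)]
      refine congrArg (fun n => min 2 (lex D ρ + n)) (Finset.sum_congr rfl fun i _ => (hi i).2)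

/-- The pairs of a reachable big nonterminal and the value of one of its derivation trees with at
most one lexical symbol. -/
def lightValues (G : MCFTG) (D : List Sym) : Set (List Sym × List Term) :=
  {p | ∃ c d, G.IsCtx c [G.S] p.1 ∧ G.IsDer d p.1 ∧ d.wt (lex D) ≤ 1 ∧ DTree.val d = p.2}

/-- The derivation trees with a given light value form a regular set, with the light values as
states: the subtrees of a derivation tree with at most one lexical symbol have at most one
themselves. -/
theorem isRegular_light {D : List Sym} (hfin : (G.lightValues D).Finite)
    {p : List Sym × List Term} (hp : p ∈ G.lightValues D) :
    IsRegular {ρ | ρ ∈ G.R} {d | G.IsDer d p.1 ∧ DTree.val d = p.2} := by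
  have := hfin.to_subtype
  refine isRegular_of_states (rk := Rule.rk) (Q := G.lightValues D)
    (fun q ρ qs => ρ ∈ G.R ∧ ρ.lhs = q.1.1 ∧ (∀ i, (qs i).1.1 = ρ.links.get i) ∧
      forestSubst ρ.rhs ρ.links (List.ofFn fun i => (qs i).1.2) = q.1.2)
    (fun d q => G.IsDer d q.1.1 ∧ DTree.val d = q.1.2) (fun _ _ _ h => h.1)
    (fun ρ ts q => ?_) ⟨p, hp⟩
  constructor
  · rintro ⟨hd, hq⟩
    obtain ⟨c, d, hc, hd', hlex, hv⟩ := q.2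
    have hle : RTree.wt (lex D) (.node ρ ts) ≤ 1 := by
      unfold lex at hlex ⊢
      rwa [← hd.fwt_val, hq, ← hv, hd'.fwt_val]
    refine ⟨fun i => ⟨(ρ.links.get i, DTree.val (ts i)), c ++ [⟨ρ, i, ts⟩], ts i,
      hc.append (isStep_of_isDer hd i).isCtx, hd.2.2 i, ?_, rfl⟩,
      ⟨hd.1, hd.2.1, fun _ => rfl, hq⟩, fun i => ⟨hd.2.2 i, rfl⟩⟩
    rw [RTree.wt_node] at hle
    have := Finset.single_le_sum (f := fun i => (ts i).wt (lex D)) (fun _ _ => Nat.zero_le _)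
      (Finset.mem_univ i)
    omega
  · rintro ⟨qs, ⟨hρ, h, hq, hw⟩, hi⟩
    refine ⟨⟨hρ, h, fun i => hq i ▸ (hi i).1⟩, Eq.trans ?_ hw⟩
    exact congrArg (fun x => forestSubst ρ.rhs ρ.links (List.ofFn x)) (funext fun i => (hi i).2)

end MCFTG

namespace MCFTG
variable {G : MCFTG} {D : List Sym}

/-! ### The growing grammar -/

/-- The type and the value of a context without lexical symbols that leads from the big nonterminal
`src` at the root to `tgt` at the hole. If `start` holds, then it is used at the root of derivation
trees only. -/
structure NullCtx where
  start : Bool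
  src : List Sym
  tgt : List Sym
  val : List Term

/-- The context `c` has the type and the value recorded in `q`. -/
structure NullCtx.Rep (G : MCFTG) (D : List Sym) (q : NullCtx) (c : Ctx) : Prop where
  isCtx : G.IsCtx c q.src q.tgt
  lex_eq : c.wt (lex D) = 0
  apply_init : c.apply (q.tgt.map Term.init) = q.val

/-- `q` is realized by a context, its source is reachable, and its target is productive. -/
structure IsNull (G : MCFTG) (D : List Sym) (q : NullCtx) : Prop where
  start_src : q.start = true → q.src = [G.S]
  reach : ∃ c, G.IsCtx c [G.S] q.src
  rep : ∃ c, q.Rep G D c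
  prod : ∃ d, G.IsDer d q.tgt

theorem IsNull.tgt_mem {q : NullCtx} (h : G.IsNull D q) : q.tgt ∈ G.bigN :=
  h.prod.choose_spec.mem_bigN

theorem IsNull.src_mem {q : NullCtx} (h : G.IsNull D q) : q.src ∈ G.bigN := by
  obtain ⟨c, hc⟩ := h.rep
  obtain ⟨d, hd⟩ := h.prod
  exact (hc.isCtx.fill hd).mem_bigN

/-- Substituting a light derivation tree in a fixed context that starts at the initial nonterminal
shows that its number of terminals is bounded. -/
theorem Bounded.finite_lightValues (h : G.Bounded D) : (G.lightValues D).Finite := by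
  have key : ∀ B, {x | (B, x) ∈ G.lightValues D}.Finite := by
    intro B
    by_cases hB : ∃ c, G.IsCtx c [G.S] B
    · obtain ⟨c, hc⟩ := hB
      obtain ⟨m, hm⟩ := h (c.wt (lex D) + 1)
      refine (finite_forests B [] G.Sig m).subset ?_
      rintro _ ⟨-, d, -, hd, hlex, rfl⟩
      refine ⟨hd.isForest, fun C => ?_, fun C hC => absurd hC (hd.ground C), hd.val_props.2.2, ?_⟩
      · rw [List.count_eq_zero.2 (hd.ground C)]
        exact Nat.zero_le _
      · have := hm (c.fill d) (hc.fill hd) (by rw [Ctx.wt_fill]; omega)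
        rw [Ctx.wt_fill] at this
        change fwt _ _ ≤ m
        rw [hd.fwt_val]
        exact (Nat.le_add_left _ _).trans this
    · refine Set.Finite.subset Set.finite_empty ?_
      rintro x ⟨c, d, hc, -⟩
      exact hB ⟨c, hc⟩
  refine ((List.finite_toSet G.bigN).biUnion fun B _ => (key B).image (Prod.mk B)).subset ?_
  rintro ⟨B, x⟩ hp
  have ⟨_, d, _, hd, _⟩ := hp
  exact Set.mem_biUnion hd.mem_bigN ⟨x, hp, rfl⟩

/-- Finitely many values of null contexts: substituting a fixed derivation tree in the hole of a
null context, and the result in a fixed context, the number of lexical symbols does not depend on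
the null context. -/
theorem Bounded.finite_isNull (h : G.Bounded D) : {q | G.IsNull D q}.Finite := by
  have key : ∀ s A B, {u | G.IsNull D ⟨s, A, B, u⟩}.Finite := by
    intro s A B
    by_cases hAB : ∃ u, G.IsNull D ⟨s, A, B, u⟩
    · obtain ⟨u, hu⟩ := hAB
      obtain ⟨c₀, h₀⟩ := hu.reach
      obtain ⟨d, hd⟩ := hu.prod
      obtain ⟨m, hm⟩ := h (c₀.wt (lex D) + d.wt (lex D))
      refine (finite_forests A G.N G.Sig m).subset ?_
      intro u' hu'
      have hB := hu'.tgt_mem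
      obtain ⟨c, hc, hlex, hu'⟩ := hu'.rep
      simp only at hc hlex hB hu'
      subst hu'
      have hi := isForest_init B
      refine ⟨hc.apply_isForest hi, fun C => ?_, fun C hC => ?_, ?_, ?_⟩
      · rw [hc.apply_count_nt hi, count_nt_init]
        exact List.nodup_iff_count_le_one.1 (G.bigN_nodup B hB) C
      · rw [← List.count_pos_iff, hc.apply_count_nt hi, List.count_pos_iff] at hC
        exact G.bigN_subset B hB C (nt_mem_init.1 hC)
      · exact hc.apply_tm_mem hi fun σ hσ => absurd hσ (tm_notMem_init B σ)
      · rw [hc.apply_termWt hi, termWt_init]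
        have := hm (c₀.fill (c.fill d)) (h₀.fill (hc.fill hd))
          (by rw [Ctx.wt_fill, Ctx.wt_fill, hlex, zero_add])
        rw [Ctx.wt_fill, Ctx.wt_fill] at this
        change Ctx.wt tms c + 0 ≤ m
        omega
    · refine Set.Finite.subset Set.finite_empty ?_
      exact fun u hu => hAB ⟨u, hu⟩
  refine ((Set.toFinite (Set.univ : Set Bool)).biUnion fun s _ =>
    (List.finite_toSet G.bigN).biUnion fun A _ => (List.finite_toSet G.bigN).biUnion fun B _ =>
      (key s A B).image (NullCtx.mk s A B)).subset ?_
  rintro ⟨s, A, B, u⟩ hq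
  exact Set.mem_biUnion (Set.mem_univ s) (Set.mem_biUnion hq.src_mem
    (Set.mem_biUnion hq.tgt_mem ⟨u, hq, rfl⟩))

/-- The forests that are substituted for the links of a rule, where `none` stands for a link that is
kept. -/
def childForests (ρ : Rule) (v : Fin ρ.rk → Option (List Term)) (i : Fin ρ.rk) : List Term :=
  (v i).getD ((ρ.links.get i).map Term.init)

/-- The right-hand side of `ρ` after substitution of the forests `v i` for the links. -/
def absorb (ρ : Rule) (v : Fin ρ.rk → Option (List Term)) : List Term :=
  forestSubst ρ.rhs ρ.links (List.ofFn (childForests ρ v))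

open Classical in
/-- The links of `ρ` that are kept by `v`, in the order in which the big nonterminals are listed in
`G`. -/
noncomputable def keptLinks (G : MCFTG) (ρ : Rule) (v : Fin ρ.rk → Option (List Term)) :
    List (List Sym) :=
  G.bigN.dedup.filter fun B => ∃ i, v i = none ∧ ρ.links.get i = B

/-- The rule obtained by composing the null context `q` with the rule `ρ` in which forests `v` are
substituted; `S'` is the new initial nonterminal. -/
noncomputable def newRule (G : MCFTG) (S' : Sym) (q : NullCtx) (ρ : Rule)
    (v : Fin ρ.rk → Option (List Term)) : Rule where
  lhs := if q.start then [S'] else q.src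
  rhs := forestSubst q.val [q.tgt] [absorb ρ v]
  links := G.keptLinks ρ v

/-- `q` and `ρ` can be composed, and the forests of `v` are values of derivation trees with at most
one lexical symbol. -/
structure Valid (G : MCFTG) (D : List Sym) (q : NullCtx) (ρ : Rule)
    (v : Fin ρ.rk → Option (List Term)) : Prop where
  null : G.IsNull D q
  mem : ρ ∈ G.R
  lhs : ρ.lhs = q.tgt
  trees : ∃ ts : Fin ρ.rk → DTree, (∀ i, G.IsDer (ts i) (ρ.links.get i)) ∧
    ∀ i x, v i = some x → (ts i).wt (lex D) ≤ 1 ∧ DTree.val (ts i) = x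

theorem mem_keptLinks {ρ : Rule} (hρ : ρ ∈ G.R) {v : Fin ρ.rk → Option (List Term)}
    {B : List Sym} : B ∈ G.keptLinks ρ v ↔ ∃ i, v i = none ∧ ρ.links.get i = B := by
  classical
  rw [keptLinks, List.mem_filter, List.mem_dedup, decide_eq_true_iff]
  refine and_iff_right_of_imp ?_
  rintro ⟨i, -, rfl⟩
  exact (G.rules_wf ρ hρ).links_mem _ (List.get_mem _ _)

theorem keptLinks_eq_filter (ρ : Rule) (v : Fin ρ.rk → Option (List Term)) :
    G.keptLinks ρ v = G.bigN.dedup.filter (· ∈ G.keptLinks ρ v) := by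
  classical
  rw [keptLinks]
  refine List.filter_congr fun B hB => decide_eq_decide.2 ?_
  rw [List.mem_filter, decide_eq_true_iff]
  exact (and_iff_right hB).symm

theorem Rule.get_injective {ρ : Rule} (hρ : ρ ∈ G.R) {i j : Fin ρ.rk}
    (h : ρ.links.get i = ρ.links.get j) : i = j :=
  (List.Nodup.get_inj_iff (G.rules_wf ρ hρ).links_nodup).1 h

namespace Valid
variable {q : NullCtx} {ρ : Rule} {v : Fin ρ.rk → Option (List Term)}

theorem exists_trees (h : G.Valid D q ρ v) : ∃ ts : Fin ρ.rk → DTree,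
    (∀ i, G.IsDer (ts i) (ρ.links.get i)) ∧
    ∀ i, v i ≠ none → (ts i).wt (lex D) ≤ 1 ∧ childForests ρ v i = DTree.val (ts i) := by
  obtain ⟨ts, h₁, h₂⟩ := h.trees
  refine ⟨ts, h₁, fun i hi => ?_⟩
  obtain ⟨x, hx⟩ := Option.ne_none_iff_exists'.1 hi
  obtain ⟨h₃, h₄⟩ := h₂ i x hx
  refine ⟨h₃, ?_⟩
  rw [childForests, hx, h₄, Option.getD_some]

theorem _root_.MCFT.MCFTG.childForests_none {i : Fin ρ.rk} (hi : v i = none) :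
    childForests ρ v i = (ρ.links.get i).map Term.init := by
  rw [childForests, hi, Option.getD_none]

theorem childForests_isForest (h : G.Valid D q ρ v) (i : Fin ρ.rk) :
    IsForest (ρ.links.get i) (childForests ρ v i) := by
  obtain ⟨ts, h₁, h₂⟩ := h.exists_trees
  by_cases hi : v i = none
  · rw [childForests_none hi]
    exact isForest_init _
  · rw [(h₂ i hi).2]
    exact (h₁ i).isForest

theorem absorb_isForest (h : G.Valid D q ρ v) : IsForest q.tgt (absorb ρ v) :=
  h.lhs ▸ rule_isForest h.mem h.childForests_isForest

theorem rhs_eq (h : G.Valid D q ρ v) {c : Ctx} (hc : q.Rep G D c) :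
    forestSubst q.val [q.tgt] [absorb ρ v] = c.apply (absorb ρ v) := by
  rw [← hc.apply_init, hc.isCtx.forestSubst_apply_init (G.bigN_nodup _ h.null.tgt_mem)
    h.absorb_isForest]

theorem count_nt_childForests (h : G.Valid D q ρ v) (i : Fin ρ.rk) (C : Sym) :
    (forestStr (childForests ρ v i)).count (.nt C) =
      if v i = none then (ρ.links.get i).count C else 0 := by
  obtain ⟨ts, h₁, h₂⟩ := h.exists_trees
  split
  · rename_i hi
    rw [childForests_none hi, count_nt_init]
  · rename_i hi
    rw [(h₂ i hi).2]
    exact List.count_eq_zero.2 ((h₁ i).ground C)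

theorem count_nt_rhs (h : G.Valid D q ρ v) (C : Sym) :
    (forestStr (forestSubst q.val [q.tgt] [absorb ρ v])).count (.nt C) =
      ∑ i : Fin ρ.rk, if v i = none then (ρ.links.get i).count C else 0 := by
  obtain ⟨c, hc⟩ := h.null.rep
  rw [h.rhs_eq hc, hc.isCtx.apply_count_nt h.absorb_isForest, count_eq_fwt, absorb,
    rule_fwt h.mem h.childForests_isForest, noVar_indicator_nt, noNt_indicator_nt, fwt_zero,
    zero_add]
  simp only [← count_eq_fwt, h.count_nt_childForests]

theorem nt_mem_rhs (h : G.Valid D q ρ v) (C : Sym) :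
    .nt C ∈ forestStr (forestSubst q.val [q.tgt] [absorb ρ v]) ↔
      ∃ B ∈ G.keptLinks ρ v, C ∈ B := by
  rw [← List.count_pos_iff, h.count_nt_rhs, Finset.sum_pos_iff]
  constructor
  · rintro ⟨i, -, hi⟩
    split at hi
    · rename_i hv
      exact ⟨_, (mem_keptLinks h.mem).2 ⟨i, hv, rfl⟩, List.count_pos_iff.1 hi⟩
    · exact absurd hi (lt_irrefl _)
  · rintro ⟨B, hB, hC⟩
    obtain ⟨i, hi, rfl⟩ := (mem_keptLinks h.mem).1 hB
    refine ⟨i, Finset.mem_univ i, ?_⟩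
    rw [if_pos hi]
    exact List.count_pos_iff.2 hC

theorem count_nt_rhs_le_one (h : G.Valid D q ρ v) (C : Sym) :
    (forestStr (forestSubst q.val [q.tgt] [absorb ρ v])).count (.nt C) ≤ 1 := by
  rw [h.count_nt_rhs]
  have hn := List.nodup_iff_count_le_one.1 (links_flatten_nodup h.mem) C
  rw [List.count_flatten, sum_map_eq_sum_get] at hn
  refine le_trans (Finset.sum_le_sum fun i _ => ?_) hn
  split
  · exact le_rfl
  · exact Nat.zero_le _

theorem tm_mem_rhs (h : G.Valid D q ρ v) (σ : Sym)
    (hσ : .tm σ ∈ forestStr (forestSubst q.val [q.tgt] [absorb ρ v])) : σ ∈ G.Sig := by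
  obtain ⟨c, hc⟩ := h.null.rep
  obtain ⟨ts, h₁, h₂⟩ := h.exists_trees
  rw [h.rhs_eq hc] at hσ
  refine hc.isCtx.apply_tm_mem h.absorb_isForest ?_ σ hσ
  refine rule_tm_mem h.mem h.childForests_isForest fun i => ?_
  by_cases hi : v i = none
  · rw [childForests_none hi]
    exact fun σ hσ => absurd hσ (tm_notMem_init _ σ)
  · rw [(h₂ i hi).2]
    exact (h₁ i).val_props.2.2

theorem lexCount_newRule (h : G.Valid D q ρ v) (S' : Sym) {ts : Fin ρ.rk → DTree}
    (h₁ : ∀ i, G.IsDer (ts i) (ρ.links.get i))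
    (h₂ : ∀ i, v i ≠ none → childForests ρ v i = DTree.val (ts i)) :
    (G.newRule S' q ρ v).lexCount D =
      lex D ρ + ∑ i, if v i = none then 0 else (ts i).wt (lex D) := by
  obtain ⟨c, hc⟩ := h.null.rep
  rw [lexCount_eq, lex, Rule.weight, newRule, h.rhs_eq hc, hc.isCtx.apply_termWt h.absorb_isForest,
    ← lex, hc.lex_eq, zero_add, absorb, rule_fwt h.mem h.childForests_isForest, noNt_termWt,
    noVar_termWt]
  congr 1
  refine Finset.sum_congr rfl fun i _ => ?_
  split
  · rename_i hi
    rw [childForests_none hi, termWt_init]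
  · rename_i hi
    rw [h₂ i hi]
    exact (h₁ i).fwt_val _

end Valid

/-- The condition on rules in the definition of growing grammars. -/
structure GrowingRule (D : List Sym) (S' : Sym) (r : Rule) : Prop where
  terminal : r.lhs ≠ [S'] → r.links = [] → 2 ≤ r.lexCount D
  monic : r.links.length = 1 → 1 ≤ r.lexCount D

/-- The rules of the growing grammar. -/
def newRules (G : MCFTG) (D : List Sym) (S' : Sym) : Set Rule :=
  {r | ∃ q ρ v, G.Valid D q ρ v ∧ r = G.newRule S' q ρ v ∧ GrowingRule D S' r}

theorem Bounded.finite_valid (h : G.Bounded D) (q : NullCtx) (ρ : Rule) :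
    {v | G.Valid D q ρ v}.Finite := by
  refine (Set.Finite.pi fun _ : Fin ρ.rk =>
    ((h.finite_lightValues.image Prod.snd).image some).insert none).subset ?_
  intro v hv i _
  obtain ⟨ts, h₁, h₂⟩ := hv.trees
  cases hi : v i with
  | none => exact Set.mem_insert _ _
  | some x =>
    obtain ⟨h₃, h₄⟩ := h₂ i x hi
    obtain ⟨c₀, h₀⟩ := hv.null.reach
    obtain ⟨c, hc⟩ := hv.null.rep
    refine Set.mem_insert_of_mem _ ⟨x, ⟨(ρ.links.get i, x), ⟨c₀ ++ (c ++ [⟨ρ, i, ts⟩]), ts i,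
      h₀.append (hc.isCtx.append ?_), h₁ i, h₃, h₄⟩, rfl⟩, rfl⟩
    exact (IsStep.mk hv.mem hv.lhs rfl fun j _ => h₁ j).isCtx

theorem Bounded.finite_newRules (h : G.Bounded D) (S' : Sym) : (G.newRules D S').Finite := by
  refine (h.finite_isNull.biUnion fun q _ => (List.finite_toSet G.R).biUnion fun ρ _ =>
    (h.finite_valid q ρ).image (G.newRule S' q ρ)).subset ?_
  rintro r ⟨q, ρ, v, hv, rfl, -⟩
  exact Set.mem_biUnion hv.null (Set.mem_biUnion hv.mem ⟨v, hv, rfl⟩)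

theorem Valid.newRule_wf {S' : Sym} (hS : S'.2 = 0) {q : NullCtx}
    {ρ : Rule} {v : Fin ρ.rk → Option (List Term)} (h : G.Valid D q ρ v) :
    (G.newRule S' q ρ v).WF (S' :: G.N) ([S'] :: G.bigN) G.Sig := by
  have wf := G.rules_wf ρ h.mem
  have hmem : ∀ B ∈ G.keptLinks ρ v, B ∈ ρ.links := fun B hB => by
    obtain ⟨i, -, rfl⟩ := (mem_keptLinks h.mem).1 hB
    exact List.get_mem _ _
  refine ⟨?_, ?_, fun C hC => ?_, h.tm_mem_rhs, h.count_nt_rhs_le_one, fun B hB => ?_, ?_, ?_,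
    h.nt_mem_rhs⟩
  · rw [newRule]
    split
    · exact List.mem_cons_self
    · exact List.mem_cons_of_mem _ h.null.src_mem
  · obtain ⟨c, hc⟩ := h.null.rep
    have hf : IsForest q.src (G.newRule S' q ρ v).rhs := by
      rw [newRule, h.rhs_eq hc]
      exact hc.isCtx.apply_isForest h.absorb_isForest
    change IsForest (if q.start then [S'] else q.src) _
    split
    · rename_i hs
      rw [h.null.start_src hs] at hf
      unfold IsForest at *
      simpa only [List.forall₂_cons_left_iff, List.forall₂_nil_left_iff, hS, G.S_rank] using hf
    · exact hf
  · obtain ⟨B, hB, hCB⟩ := (h.nt_mem_rhs C).1 hC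
    exact List.mem_cons_of_mem _ (G.bigN_subset B (wf.links_mem B (hmem B hB)) C hCB)
  · exact List.mem_cons_of_mem _ (wf.links_mem B (hmem B hB))
  · exact (List.nodup_dedup _).filter _
  · exact fun B hB B' hB' => wf.links_disjoint B (hmem B hB) B' (hmem B' hB')

/-- The growing grammar with the new initial nonterminal `S'`. -/
noncomputable def growing (G : MCFTG) {D : List Sym} (h : G.Bounded D) {S' : Sym}
    (hN : S' ∉ G.N) (hS : S'.2 = 0) : MCFTG where
  N := S' :: G.N
  bigN := [S'] :: G.bigN
  Sig := G.Sig
  S := S'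
  R := (h.finite_newRules S').toFinset.toList
  bigN_ne_nil := by simpa using G.bigN_ne_nil
  bigN_nodup := by simpa using G.bigN_nodup
  bigN_subset A hA C hC := by
    rcases List.mem_cons.1 hA with rfl | hA
    · rw [List.mem_singleton.1 hC]
      exact List.mem_cons_self
    · exact List.mem_cons_of_mem _ (G.bigN_subset A hA C hC)
  bigN_inj A hA A' hA' hAA' := by
    have hne : ∀ B ∈ G.bigN, S' ∉ B := fun B hB h => hN (G.bigN_subset B hB _ h)
    rcases List.mem_cons.1 hA with rfl | hA <;> rcases List.mem_cons.1 hA' with rfl | hA'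
    · rfl
    · exact absurd ((hAA' S').1 (List.mem_singleton.2 rfl)) (hne _ hA')
    · exact absurd ((hAA' S').2 (List.mem_singleton.2 rfl)) (hne _ hA)
    · exact G.bigN_inj A hA A' hA' hAA'
  exists_rank_pos := G.exists_rank_pos
  S_mem := List.mem_cons_self
  S_rank := hS
  rules_wf r hr := by
    rw [Finset.mem_toList, Set.Finite.mem_toFinset] at hr
    obtain ⟨q, ρ, v, hv, rfl, -⟩ := hr
    exact hv.newRule_wf hS
  links_order r hr r' hr' _ _ hl := by
    rw [Finset.mem_toList, Set.Finite.mem_toFinset] at hr hr'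
    obtain ⟨q, ρ, v, hv, rfl, -⟩ := hr
    obtain ⟨q', ρ', v', hv', rfl, -⟩ := hr'
    change G.keptLinks ρ v = G.keptLinks ρ' v'
    rw [keptLinks_eq_filter, keptLinks_eq_filter ρ']
    exact List.filter_congr fun B _ => decide_eq_decide.2 (hl B)

theorem exists_fresh (G : MCFTG) : ∃ S' : Sym, S' ∉ G.N ∧ S'.2 = 0 := by
  refine ⟨((G.N.map Prod.fst).sum + 1, 0), fun h => ?_, rfl⟩
  have := List.single_le_sum (fun _ _ => Nat.zero_le _) _ (List.mem_map_of_mem (f := Prod.fst) h)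
  simp at this

theorem mem_growing_R (h : G.Bounded D) {S' : Sym} (hN : S' ∉ G.N) (hS : S'.2 = 0) {r : Rule} :
    r ∈ (G.growing h hN hS).R ↔ r ∈ G.newRules D S' := by
  simp [growing]

theorem growing_growing (h : G.Bounded D) {S' : Sym} (hN : S' ∉ G.N) (hS : S'.2 = 0) :
    (G.growing h hN hS).Growing D := by
  constructor <;>
  · intro r hr
    obtain ⟨q, ρ, v, -, -, hg⟩ := (mem_growing_R h hN hS).1 hr
    first
    | exact hg.terminal
    | exact hg.monic

theorem growing_startSeparated (h : G.Bounded D) {S' : Sym} (hN : S' ∉ G.N) (hS : S'.2 = 0) :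
    (G.growing h hN hS).StartSeparated := by
  intro r hr hmem
  obtain ⟨q, ρ, v, hv, rfl, -⟩ := (mem_growing_R h hN hS).1 hr
  obtain ⟨B, hB, hSB⟩ := (hv.nt_mem_rhs S').1 hmem
  obtain ⟨i, -, rfl⟩ := (mem_keptLinks hv.mem).1 hB
  exact hN (G.bigN_subset _ ((G.rules_wf ρ hv.mem).links_mem _ (List.get_mem _ _)) _ hSB)

theorem growing_width (h : G.Bounded D) {S' : Sym} (hN : S' ∉ G.N) (hS : S'.2 = 0) :
    (G.growing h hN hS).width = G.width := by
  simp [width, growing, hS]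

theorem growing_multiplicity (h : G.Bounded D) {S' : Sym} (hN : S' ∉ G.N) (hS : S'.2 = 0) :
    (G.growing h hN hS).multiplicity = G.multiplicity := by
  have key : ∀ l : List ℕ, ∀ a ∈ l, a ≤ l.foldr max 0 := by
    intro l
    induction l with
    | nil => simp
    | cons b l ih =>
      intro a ha
      rcases List.mem_cons.1 ha with rfl | ha
      · exact le_max_left _ _
      · exact (ih a ha).trans (le_max_right _ _)
  have := key _ _ (List.mem_map_of_mem (f := List.length) G.S_mem)
  simpa [multiplicity, growing] using this

end MCFTG

/-! ### Right-hand sides of transducers -/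

namespace OutTree
variable {Q : Type} {k : ℕ} {Γ : Type} {rk : Γ → ℕ}

/-- The pair `p`, consisting of a state and an input variable, as a leaf. -/
def leaf (p : Q × Fin k) : OutTree Q k Γ rk := .node (.inl p) Fin.elim0

/-- The tree with root `a` and subtrees `ts`. -/
def node (a : Γ) (ts : Fin (rk a) → OutTree Q k Γ rk) : OutTree Q k Γ rk := RTree.node (.inr a) ts

/-- A tree of output symbols as a right-hand side. -/
def const : RTree Γ rk → OutTree Q k Γ rk
  | .node a ts => node a fun i => const (ts i)

/-- The weight function that counts the occurrences of the input variable `y_i`. -/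
def varWt (i : Fin k) : (Q × Fin k) ⊕ Γ → ℕ :=
  Sum.elim (fun p => if p.2 = i then 1 else 0) fun _ => 0

theorem countP_eq_wt (i : Fin k) (t : OutTree Q k Γ rk) :
    t.str.countP (fun l => Sum.elim (fun p => decide (p.2 = i)) (fun _ => false) l) =
      t.wt (varWt i) := by
  rw [list_countP_eq_sum, RTree.wt]
  congr 1
  refine List.map_congr_left fun l _ => ?_
  cases l <;> simp [varWt]

theorem fill_node (g : Q × Fin k → RTree Γ rk) (a : Γ) (ts : Fin (rk a) → OutTree Q k Γ rk) :
    (node a ts).fill g = .node a fun i => (ts i).fill g := rfl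

theorem fill_const (g : Q × Fin k → RTree Γ rk) (t : RTree Γ rk) : (const t).fill g = t := by
  induction t with
  | node a ts ih => exact congrArg (RTree.node a) (funext ih)

theorem str_leaf (p : Q × Fin k) : (leaf p : OutTree Q k Γ rk).str = [.inl p] := rfl

theorem mem_str_node (a : Γ) (ts : Fin (rk a) → OutTree Q k Γ rk) (l : (Q × Fin k) ⊕ Γ) :
    l ∈ (node a ts).str ↔ l = .inr a ∨ ∃ i, l ∈ (ts i).str := RTree.mem_str_node _ _ _

theorem wt_node (φ : (Q × Fin k) ⊕ Γ → ℕ) (a : Γ) (ts : Fin (rk a) → OutTree Q k Γ rk) :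
    (node a ts).wt φ = φ (.inr a) + ∑ i, (ts i).wt φ := RTree.wt_node _ _ _

theorem wt_leaf (φ : (Q × Fin k) ⊕ Γ → ℕ) (p : Q × Fin k) :
    (leaf p : OutTree Q k Γ rk).wt φ = φ (.inl p) := by
  rw [RTree.wt, str_leaf, List.map_singleton, List.sum_singleton]

theorem mem_str_const {t : RTree Γ rk} {l : (Q × Fin k) ⊕ Γ} (h : l ∈ (const t).str) :
    ∃ a ∈ t.str, l = .inr a := by
  induction t with
  | node a ts ih =>
    rw [const, mem_str_node] at h
    rcases h with h | ⟨i, h⟩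
    · exact ⟨a, (RTree.mem_str_node _ _ _).2 (.inl rfl), h⟩
    · obtain ⟨b, hb, h⟩ := ih i h
      exact ⟨b, (RTree.mem_str_node _ _ _).2 (.inr ⟨i, hb⟩), h⟩

theorem varWt_const (i : Fin k) (t : RTree Γ rk) :
    (const t : OutTree Q k Γ rk).wt (varWt i) = 0 := by
  rw [← Nat.le_zero, ← not_lt, RTree.wt_pos_iff]
  rintro ⟨l, hl, h⟩
  obtain ⟨a, -, rfl⟩ := mem_str_const hl
  exact absurd h (lt_irrefl _)

end OutTree

/-- The context `c` as a part of a right-hand side, with `o` in its hole. -/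
def Ctx.toOut {Q : Type} {k : ℕ} (c : Ctx) (o : OutTree Q k Rule Rule.rk) :
    OutTree Q k Rule Rule.rk :=
  c.foldr (fun s o => OutTree.node s.rule
    (Function.update (fun j => OutTree.const (s.sib j)) s.idx o)) o

theorem Ctx.fill_toOut {Q : Type} {k : ℕ} (g : Q × Fin k → DTree) (c : Ctx)
    (o : OutTree Q k Rule Rule.rk) : (c.toOut o).fill g = c.fill (o.fill g) := by
  induction c with
  | nil => rfl
  | cons s c ih =>
    refine congrArg (RTree.node s.rule) (funext fun j => ?_)
    by_cases h : j = s.idx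
    · subst h
      rw [Function.update_self, Function.update_self]
      exact ih
    · rw [Function.update_of_ne h, Function.update_of_ne h, OutTree.fill_const]

theorem Ctx.varWt_toOut {Q : Type} {k : ℕ} (i : Fin k) (c : Ctx) (o : OutTree Q k Rule Rule.rk) :
    (c.toOut o).wt (OutTree.varWt i) = o.wt (OutTree.varWt i) := by
  induction c with
  | nil => rfl
  | cons s c ih =>
    refine (OutTree.wt_node _ _ _).trans ?_
    rw [Finset.sum_eq_single s.idx, Function.update_self]
    · exact (zero_add _).trans ih
    · intro j _ h
      rw [Function.update_of_ne h, OutTree.varWt_const]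
    · exact fun h => absurd (Finset.mem_univ _) h

namespace MCFTG
variable {G : MCFTG} {D : List Sym}

theorem IsDer.labels {d : DTree} {A : List Sym} (h : G.IsDer d A) : ∀ ρ ∈ d.str, ρ ∈ G.R := by
  induction d generalizing A with
  | node ρ ts ih =>
    intro ρ' hρ'
    rcases (RTree.mem_str_node _ _ _).1 hρ' with rfl | ⟨i, hi⟩
    · exact h.1
    · exact ih i (h.2.2 i) ρ' hi

theorem IsCtx.labels_toOut {Q : Type} {k : ℕ} {c : Ctx} {A B : List Sym} (hc : G.IsCtx c A B)
    {o : OutTree Q k Rule Rule.rk} (ho : ∀ ρ, .inr ρ ∈ o.str → ρ ∈ G.R) :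
    ∀ ρ, .inr ρ ∈ (c.toOut o).str → ρ ∈ G.R := by
  induction c generalizing A with
  | nil => exact ho
  | cons s c ih =>
    obtain ⟨A', hs, hc⟩ := hc
    intro ρ hρ
    rcases (OutTree.mem_str_node _ _ _).1 hρ with h | ⟨j, h⟩
    · cases h
      exact hs.mem
    · by_cases hj : j = s.idx
      · subst hj
        rw [Function.update_self] at h
        exact ih hc ρ h
      · rw [Function.update_of_ne hj] at h
        obtain ⟨a, ha, h⟩ := OutTree.mem_str_const h
        cases h
        exact (hs.sib j hj).labels _ ha

/-! ### From the growing grammar to the given grammar -/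

/-- The value of a rule of the growing grammar, in terms of the rule and the null context of which
it is composed. -/
theorem Valid.val_newRule {q : NullCtx} {ρ : Rule} {v : Fin ρ.rk → Option (List Term)}
    (h : G.Valid D q ρ v) {y : Fin ρ.rk → List Term} (hy : ∀ i, IsForest (ρ.links.get i) (y i))
    (hv : ∀ i, v i ≠ none → childForests ρ v i = y i)
    (w : Fin (G.keptLinks ρ v).length → List Term)
    (hw : ∀ i j, v i = none → (G.keptLinks ρ v).get j = ρ.links.get i → w j = y i) (S' : Sym)
    {c : Ctx} (hc : q.Rep G D c) :
    forestSubst (G.newRule S' q ρ v).rhs (G.keptLinks ρ v) (List.ofFn w) =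
      c.apply (forestSubst ρ.rhs ρ.links (List.ofFn y)) := by
  obtain ⟨g, hg, hi⟩ := exists_env (links_flatten_nodup h.mem) (x := y) hy
  change forestSubst (forestSubst q.val [q.tgt] [absorb ρ v]) (G.keptLinks ρ v) (List.ofFn w) = _
  rw [forestSubst_ofFn g (fun C => (h.nt_mem_rhs C).1) w ?_]
  · rw [h.rhs_eq hc, hc.isCtx.apply_map_subst₂ h.absorb_isForest hg, absorb,
      rule_map_subst₂ h.mem h.childForests_isForest hg]
    congr 3
    funext i
    by_cases hvi : v i = none
    · rw [childForests_none hvi, map_init_subst₂ hg]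
      exact hi i
    · obtain ⟨ts, h₁, h₂⟩ := h.exists_trees
      rw [(h₂ i hvi).2, (h₁ i).ground.map_subst₂, ← (h₂ i hvi).2, hv i hvi]
  · intro j
    obtain ⟨i, hvi, hij⟩ := (mem_keptLinks h.mem).1 (List.get_mem (G.keptLinks ρ v) j)
    rw [hw i j hvi hij.symm, ← hij]
    exact hi i

/-- A derivation tree of `G` with holes, for a rule `r` of the growing grammar, that has the same
value as `r`: it consists of a context, a rule below it, and derivation trees for some of the links
of this rule. The other links correspond to the links of `r`. -/
structure Origin (G : MCFTG) (S' : Sym) (r : Rule) where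
  ctx : Ctx
  rule : Rule
  trees : Fin rule.rk → DTree
  slot : Fin rule.rk → Option (Fin r.rk)
  isCtx : G.IsCtx ctx (if r.lhs = [S'] then [G.S] else r.lhs) rule.lhs
  mem : rule ∈ G.R
  isDer : ∀ i, G.IsDer (trees i) (rule.links.get i)
  slot_get : ∀ i j, slot i = some j → r.links.get j = rule.links.get i
  val_eq : ∀ w : Fin r.rk → List Term, (∀ j, IsForest (r.links.get j) (w j)) →
    forestSubst r.rhs r.links (List.ofFn w) = ctx.apply (forestSubst rule.rhs rule.links
      (List.ofFn fun i => (slot i).elim (DTree.val (trees i)) w))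

theorem nonempty_origin {S' : Sym} (hN : S' ∉ G.N) {r : Rule} (hr : r ∈ G.newRules D S') :
    Nonempty (G.Origin S' r) := by
  classical
  obtain ⟨q, ρ, v, hv, rfl, -⟩ := hr
  obtain ⟨c, hc⟩ := hv.null.rep
  obtain ⟨ts, h₁, h₂⟩ := hv.exists_trees
  have hslot : ∀ i, ∃ o : Option (Fin (G.newRule S' q ρ v).rk), (v i ≠ none → o = none) ∧
      (v i = none → ∃ j, o = some j ∧ (G.keptLinks ρ v).get j = ρ.links.get i) := by
    intro i
    by_cases hi : v i = none
    · obtain ⟨j, hj⟩ := List.get_of_mem ((mem_keptLinks hv.mem).2 ⟨i, hi, rfl⟩)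
      exact ⟨some j, fun h => absurd hi h, fun _ => ⟨j, rfl, hj⟩⟩
    · exact ⟨none, fun _ => rfl, fun h => absurd h hi⟩
  choose slot hs₁ hs₂ using hslot
  have hget : ∀ i j, slot i = some j → (G.keptLinks ρ v).get j = ρ.links.get i := by
    intro i j hij
    by_cases hi : v i = none
    · obtain ⟨j', h, h'⟩ := hs₂ i hi
      rw [hij, Option.some_inj] at h
      exact h ▸ h'
    · rw [hs₁ i hi] at hij
      cases hij
  refine ⟨⟨c, ρ, ts, slot, ?_, hv.mem, h₁, hget, fun w hw => ?_⟩⟩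
  · have : (if (G.newRule S' q ρ v).lhs = [S'] then [G.S] else (G.newRule S' q ρ v).lhs) =
        q.src := by
      rw [newRule]
      by_cases hst : q.start = true
      · simp [hst, hv.null.start_src hst]
      · have hne : q.src ≠ [S'] := fun h =>
          hN (G.bigN_subset _ hv.null.src_mem S' (h ▸ List.mem_singleton.2 rfl))
        simp [hst, hne]
    rw [this, hv.lhs]
    exact hc.isCtx
  · refine hv.val_newRule (y := fun i => (slot i).elim (DTree.val (ts i)) w) (fun i => ?_)
      (fun i hi => ?_) w (fun i j hi hij => ?_) S' hc
    · rcases hsi : slot i with - | j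
      · exact (h₁ i).isForest
      · exact hget i j hsi ▸ hw j
    · rw [hs₁ i hi]
      exact (h₂ i hi).2
    · obtain ⟨j', h, h'⟩ := hs₂ i hi
      rw [h]
      have hn : (G.keptLinks ρ v).Nodup := (List.nodup_dedup _).filter _
      rw [← hij] at h'
      rw [hn.get_inj_iff.1 h']
      rfl

/-- The right-hand side of a transducer rule that produces the derivation tree of an origin. -/
def Origin.out {S' : Sym} {r : Rule} (o : G.Origin S' r) : OutTree Unit r.rk Rule Rule.rk :=
  o.ctx.toOut (OutTree.node o.rule fun i =>
    (o.slot i).elim (OutTree.const (o.trees i)) fun j => OutTree.leaf ((), j))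

theorem Origin.fill_out {S' : Sym} {r : Rule} (o : G.Origin S' r)
    (g : Unit × Fin r.rk → DTree) : o.out.fill g =
      o.ctx.fill (.node o.rule fun i => (o.slot i).elim (o.trees i) fun j => g ((), j)) := by
  rw [out, Ctx.fill_toOut, OutTree.fill_node]
  congr 2
  funext i
  cases o.slot i with
  | none => exact OutTree.fill_const g _
  | some j => rfl

theorem Origin.labels_out {S' : Sym} {r : Rule} (o : G.Origin S' r) :
    ∀ ρ, .inr ρ ∈ o.out.str → ρ ∈ G.R := by
  refine o.isCtx.labels_toOut fun ρ hρ => ?_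
  rcases (OutTree.mem_str_node _ _ _).1 hρ with h | ⟨i, h⟩
  · cases h
    exact o.mem
  · cases hi : o.slot i with
    | none =>
      rw [hi] at h
      obtain ⟨a, ha, h⟩ := OutTree.mem_str_const h
      cases h
      exact (o.isDer i).labels _ ha
    | some j =>
      rw [hi] at h
      change _ ∈ [_] at h
      simp at h

theorem Origin.linear_out {S' : Sym} {r : Rule} (o : G.Origin S' r) (j : Fin r.rk) :
    o.out.wt (OutTree.varWt j) ≤ 1 := by
  rw [out, Ctx.varWt_toOut]
  refine (OutTree.wt_node _ _ _).trans_le ?_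
  have hle : ∀ i, ((o.slot i).elim (OutTree.const (o.trees i)) fun j =>
      (OutTree.leaf ((), j) : OutTree Unit r.rk Rule Rule.rk)).wt (OutTree.varWt j) =
        if o.slot i = some j then 1 else 0 := by
    intro i
    cases o.slot i with
    | none => exact OutTree.varWt_const j _
    | some j' =>
      refine (OutTree.wt_leaf _ _).trans ?_
      simp [OutTree.varWt]
  rw [show OutTree.varWt (Q := Unit) j (.inr o.rule) = 0 from rfl, zero_add,
    Finset.sum_congr rfl fun i _ => hle i, ← Finset.sum_filter, Finset.sum_const, smul_eq_mul,
    mul_one, Finset.card_le_one]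
  intro i hi i' hi'
  rw [Finset.mem_filter] at hi hi'
  exact Rule.get_injective o.mem ((o.slot_get i j hi.2).symm.trans (o.slot_get i' j hi'.2))

variable (h : G.Bounded D) {S' : Sym} (hN : S' ∉ G.N) (hS : S'.2 = 0)

/-- An arbitrarily chosen origin of each rule of the growing grammar. -/
noncomputable def origin (r : Rule) (hr : r ∈ (G.growing h hN hS).R) : G.Origin S' r :=
  Classical.choice (nonempty_origin hN ((mem_growing_R h hN hS).1 hr))

/-- The transducer that replaces each rule of the growing grammar by its origin. -/
noncomputable def originTransducer :
    LDTR Rule.rk Rule.rk {r | r ∈ (G.growing h hN hS).R} {ρ | ρ ∈ G.R} where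
  Q := Unit
  finite_Q := inferInstance
  q₀ := ()
  rules _ r := {c | ∃ hr : r ∈ (G.growing h hN hS).R,
    c = ⟨{d | (G.growing h hN hS).IsDer d r.lhs},
      fun i => {d | (G.growing h hN hS).IsDer d (r.links.get i)}, (origin h hN hS r hr).out⟩}
  finite_rules _ r := Set.Subsingleton.finite (by rintro _ ⟨_, rfl⟩ _ ⟨_, rfl⟩; rfl)
  input_mem := by rintro _ r _ ⟨hr, rfl⟩; exact hr
  output_mem := by rintro _ r _ ⟨hr, rfl⟩; exact (origin h hN hS r hr).labels_out
  regular_look₀ := by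
    rintro _ r _ ⟨hr, rfl⟩
    exact isRegular_isDer (((G.growing h hN hS).rules_wf r hr).lhs_mem)
  regular_look := by
    rintro _ r _ ⟨hr, rfl⟩ i
    exact isRegular_isDer (((G.growing h hN hS).rules_wf r hr).links_mem _ (List.get_mem _ _))
  linear := by
    rintro _ r _ ⟨hr, rfl⟩ i
    rw [OutTree.countP_eq_wt]
    exact (origin h hN hS r hr).linear_out i
  deterministic := by
    rintro _ r _ ⟨hr, rfl⟩ _ ⟨hr', rfl⟩ hne
    exact absurd rfl hne

/-- The new initial nonterminal is replaced by the given one; all other types are preserved. -/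
theorem originTransducer_trans {d' : DTree} : ∀ {A : List Sym}, (G.growing h hN hS).IsDer d' A →
    ∃ d, (originTransducer h hN hS).Trans d' () d ∧
      G.IsDer d (if A = [S'] then [G.S] else A) ∧ DTree.val d = DTree.val d' := by
  induction d' with
  | node r ts ih =>
    intro A hd'
    have hder := hd'
    obtain ⟨hr, rfl, hts⟩ := hd'
    have hlink : ∀ j : Fin r.rk, r.links.get j ≠ [S'] := by
      intro j hj
      refine growing_startSeparated h hN hS r hr
        ((((G.growing h hN hS).rules_wf r hr).links_cover S').2 ⟨_, List.get_mem _ j, ?_⟩)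
      exact hj.symm ▸ List.mem_singleton.2 rfl
    choose e he using fun j => ih j (hts j)
    simp only [if_neg (hlink _)] at he
    let o := origin h hN hS r hr
    have hchild : ∀ i, G.IsDer ((o.slot i).elim (o.trees i) e) (o.rule.links.get i) := by
      intro i
      cases hi : o.slot i with
      | none => exact o.isDer i
      | some j => exact o.slot_get i j hi ▸ (he j).2.1
    refine ⟨o.out.fill fun p => e p.2, ⟨_, ⟨hr, rfl⟩, hder, hts, fun p => e p.2,
      fun p _ => (he p.2).1, rfl⟩, ?_, ?_⟩
    · rw [Origin.fill_out]
      exact o.isCtx.fill ⟨o.mem, rfl, hchild⟩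
    · rw [Origin.fill_out, Ctx.val_fill]
      refine Eq.symm ((o.val_eq (fun j => DTree.val (ts j)) fun j => (hts j).isForest).trans ?_)
      refine congrArg (fun x => o.ctx.apply (forestSubst o.rule.rhs o.rule.links (List.ofFn x)))
        (funext fun i => ?_)
      change _ = DTree.val ((o.slot i).elim (o.trees i) e)
      cases o.slot i with
      | none => rfl
      | some j => exact (he j).2.2.symm

end MCFTG

/-! ### From the given grammar to the growing grammar -/

namespace MCFTG
variable {G : MCFTG} {D : List Sym}

/-- The null context that consists of the hole only. -/
def NullCtx.hole (B : List Sym) : NullCtx := ⟨false, B, B, B.map Term.init⟩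

/-- The null context with which derivation trees start. -/
def NullCtx.initial (G : MCFTG) : NullCtx := ⟨true, [G.S], [G.S], [Term.init G.S]⟩

/-- The null context `q` extended by the rule `ρ` with a hole at its `i`-th link. -/
noncomputable def extend (G : MCFTG) (S' : Sym) (q : NullCtx) (ρ : Rule)
    (v : Fin ρ.rk → Option (List Term)) (i : Fin ρ.rk) : NullCtx :=
  ⟨q.start, q.src, ρ.links.get i, (G.newRule S' q ρ v).rhs⟩

/-- The `i`-th link is the only one that is kept by `v`, and the rule obtained from `q`, `ρ` and `v`
has no lexical symbols. -/
structure Monic (G : MCFTG) (D : List Sym) (S' : Sym) (q : NullCtx) (ρ : Rule)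
    (v : Fin ρ.rk → Option (List Term)) (i : Fin ρ.rk) : Prop where
  none : v i = none
  unique : ∀ j, v j = .none → j = i
  lexCount : (G.newRule S' q ρ v).lexCount D = 0

theorem NullCtx.rep_hole (B : List Sym) : (NullCtx.hole B).Rep G D [] := ⟨rfl, rfl, rfl⟩

theorem NullCtx.rep_initial : (NullCtx.initial G).Rep G D [] := ⟨rfl, rfl, rfl⟩

namespace Valid
variable {S' : Sym} {q : NullCtx} {ρ : Rule} {v : Fin ρ.rk → Option (List Term)}

theorem exists_isCtx (h : G.Valid D q ρ v) (i : Fin ρ.rk) :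
    ∃ c, G.IsCtx c [G.S] (ρ.links.get i) := by
  obtain ⟨ts, h₁, -⟩ := h.trees
  obtain ⟨c₀, h₀⟩ := h.null.reach
  obtain ⟨c, hc⟩ := h.null.rep
  exact ⟨c₀ ++ (c ++ [⟨ρ, i, ts⟩]),
    h₀.append (hc.isCtx.append (IsStep.mk h.mem h.lhs rfl fun j _ => h₁ j).isCtx)⟩

theorem mem_lightValues (h : G.Valid D q ρ v) {i : Fin ρ.rk} {x : List Term}
    (hi : v i = some x) : (ρ.links.get i, x) ∈ G.lightValues D := by
  obtain ⟨ts, h₁, h₂⟩ := h.trees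
  obtain ⟨c, hc⟩ := h.exists_isCtx i
  exact ⟨c, ts i, hc, h₁ i, h₂ i x hi⟩

theorem isNull_hole (h : G.Valid D q ρ v) (i : Fin ρ.rk) :
    G.IsNull D (NullCtx.hole (ρ.links.get i)) := by
  obtain ⟨ts, h₁, -⟩ := h.trees
  exact ⟨fun h => absurd h Bool.false_ne_true, h.exists_isCtx i,
    ⟨[], NullCtx.rep_hole _⟩, ts i, h₁ i⟩

/-- If only one link is kept, and the light subtrees and the rule have no lexical symbols, then the
step that leads to this link extends the null context. -/
theorem rep_extend (h : G.Valid D q ρ v) {c : Ctx} (hc : q.Rep G D c) {i : Fin ρ.rk}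
    (hi : G.Monic D S' q ρ v i) {ts : Fin ρ.rk → DTree}
    (h₁ : ∀ i, G.IsDer (ts i) (ρ.links.get i))
    (h₂ : ∀ i, v i ≠ none → childForests ρ v i = DTree.val (ts i)) :
    (G.extend S' q ρ v i).Rep G D (c ++ [⟨ρ, i, ts⟩]) := by
  have hne : ∀ j, j ≠ i → v j ≠ none := fun j hj hv => hj (hi.unique j hv)
  refine ⟨hc.isCtx.append (IsStep.mk h.mem h.lhs rfl fun j _ => h₁ j).isCtx, ?_, ?_⟩
  · have hlex := hi.lexCount
    rw [h.lexCount_newRule S' h₁ h₂] at hlex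
    have hρ : lex D ρ = 0 := (Nat.add_eq_zero_iff.1 hlex).1
    have hsum := Finset.sum_eq_zero_iff.1 (Nat.add_eq_zero_iff.1 hlex).2
    rw [Ctx.wt_append, hc.lex_eq, zero_add]
    change Step.wt (lex D) ⟨ρ, i, ts⟩ + 0 = 0
    rw [add_zero, Step.wt]
    refine Nat.add_eq_zero_iff.2 ⟨hρ, Finset.sum_eq_zero fun j hj => ?_⟩
    have := hsum j (Finset.mem_univ j)
    rwa [if_neg (hne j (Finset.ne_of_mem_erase hj))] at this
  · rw [Ctx.apply_append]
    refine Eq.trans ?_ (h.rhs_eq hc).symm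
    refine congrArg (fun x => c.apply (forestSubst ρ.rhs ρ.links (List.ofFn x)))
      (funext fun j => ?_)
    by_cases hj : j = i
    · exact Eq.subst
        (motive := fun j => Step.family ⟨ρ, i, ts⟩ ((ρ.links.get i).map Term.init) j =
          childForests ρ v j) hj.symm
        ((Step.family_self ⟨ρ, i, ts⟩ _).trans (childForests_none hi.none).symm)
    · exact (Step.family_of_ne ⟨ρ, i, ts⟩ _ hj).trans (h₂ j (hne j hj)).symm

theorem isNull_extend (h : G.Valid D q ρ v) {i : Fin ρ.rk} (hi : G.Monic D S' q ρ v i) :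
    G.IsNull D (G.extend S' q ρ v i) := by
  obtain ⟨ts, h₁, h₂⟩ := h.exists_trees
  obtain ⟨c, hc⟩ := h.null.rep
  exact ⟨h.null.start_src, h.null.reach, ⟨_, h.rep_extend hc hi h₁ fun i hi => (h₂ i hi).2⟩,
    ts i, h₁ i⟩

end Valid

/-- The states of the transducer: the null contexts, and the initial one. -/
abbrev NullState (G : MCFTG) (D : List Sym) : Type :=
  {q : NullCtx // G.IsNull D q ∨ q = NullCtx.initial G}

open Classical in
/-- A null context as a state; all other values of `q` are mapped to the initial state. -/
noncomputable def toState (G : MCFTG) (D : List Sym) (q : NullCtx) : G.NullState D :=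
  if h : G.IsNull D q then ⟨q, .inl h⟩ else ⟨NullCtx.initial G, .inr rfl⟩

theorem toState_val {q : NullCtx} (h : G.IsNull D q) : (G.toState D q).1 = q := by
  rw [toState, dif_pos h]

/-- The position in `ρ` of the `j`-th link that is kept by `v`. -/
noncomputable def keptIdx {ρ : Rule} (hρ : ρ ∈ G.R) (v : Fin ρ.rk → Option (List Term))
    (j : Fin (G.keptLinks ρ v).length) : Fin ρ.rk :=
  ((mem_keptLinks hρ).1 (List.get_mem (G.keptLinks ρ v) j)).choose

theorem keptIdx_none {ρ : Rule} (hρ : ρ ∈ G.R) (v : Fin ρ.rk → Option (List Term))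
    (j : Fin (G.keptLinks ρ v).length) : v (keptIdx hρ v j) = none :=
  ((mem_keptLinks hρ).1 (List.get_mem (G.keptLinks ρ v) j)).choose_spec.1

theorem get_keptIdx {ρ : Rule} (hρ : ρ ∈ G.R) (v : Fin ρ.rk → Option (List Term))
    (j : Fin (G.keptLinks ρ v).length) :
    ρ.links.get (keptIdx hρ v j) = (G.keptLinks ρ v).get j :=
  ((mem_keptLinks hρ).1 (List.get_mem (G.keptLinks ρ v) j)).choose_spec.2

theorem keptIdx_injective {ρ : Rule} (hρ : ρ ∈ G.R) (v : Fin ρ.rk → Option (List Term)) :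
    Function.Injective (keptIdx hρ v) := by
  intro j j' hj
  have hn : (G.keptLinks ρ v).Nodup := (List.nodup_dedup _).filter _
  refine hn.get_inj_iff.1 ?_
  rw [← get_keptIdx hρ, ← get_keptIdx hρ, hj]

open Classical in
/-- The right-hand side of the transducer for the rule `ρ` in state `q`, if the children that `v`
maps to `none` have at least two lexical symbols, and the others have the value given by `v`: the
rule composed of `q`, `ρ` and `v` if it may be used in a growing grammar. Otherwise, nothing is
produced, and the state is extended by `ρ`. -/
noncomputable def nullOut (S' : Sym) (q : NullCtx) {ρ : Rule} (hρ : ρ ∈ G.R)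
    (v : Fin ρ.rk → Option (List Term))
    (h : GrowingRule D S' (G.newRule S' q ρ v) ∨ ∃ i, G.Monic D S' q ρ v i) :
    OutTree (G.NullState D) ρ.rk Rule Rule.rk :=
  if hg : GrowingRule D S' (G.newRule S' q ρ v) then
    OutTree.node (G.newRule S' q ρ v) fun j =>
      OutTree.leaf (G.toState D (NullCtx.hole ((G.keptLinks ρ v).get j)), keptIdx hρ v j)
  else
    let i := (h.resolve_left hg).choose
    OutTree.leaf (G.toState D (G.extend S' q ρ v i), i)

theorem linear_nullOut {S' : Sym} {q : NullCtx} {ρ : Rule} (hρ : ρ ∈ G.R)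
    (v : Fin ρ.rk → Option (List Term))
    (h : GrowingRule D S' (G.newRule S' q ρ v) ∨ ∃ i, G.Monic D S' q ρ v i) (i : Fin ρ.rk) :
    (nullOut S' q hρ v h).wt (OutTree.varWt i) ≤ 1 := by
  rw [nullOut]
  split
  · refine (OutTree.wt_node _ _ _).trans_le ?_
    rw [show OutTree.varWt (Q := G.NullState D) i (.inr (G.newRule S' q ρ v)) = 0 from rfl,
      zero_add]
    have hle : ∀ j : Fin (G.keptLinks ρ v).length, (OutTree.leaf (G.toState D (NullCtx.hole
        ((G.keptLinks ρ v).get j)), keptIdx hρ v j) : OutTree _ _ Rule Rule.rk).wt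
          (OutTree.varWt i) = if keptIdx hρ v j = i then 1 else 0 :=
      fun j => OutTree.wt_leaf _ _
    refine (Finset.sum_congr rfl fun j _ => hle j).trans_le ?_
    refine (Finset.sum_filter (s := (Finset.univ : Finset (Fin (G.keptLinks ρ v).length)))
      (fun j => keptIdx hρ v j = i) fun _ => 1).symm.trans_le ?_
    rw [Finset.sum_const, smul_eq_mul, mul_one, Finset.card_le_one]
    intro j hj j' hj'
    rw [Finset.mem_filter] at hj hj'
    exact keptIdx_injective hρ v (hj.2.trans hj'.2.symm)
  · refine (OutTree.wt_leaf _ _).trans_le ?_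
    change (if _ then 1 else 0) ≤ 1
    split <;> omega

theorem labels_nullOut {S' : Sym} {q : NullCtx} {ρ : Rule} (hρ : ρ ∈ G.R)
    {v : Fin ρ.rk → Option (List Term)} (hv : G.Valid D q ρ v)
    (h : GrowingRule D S' (G.newRule S' q ρ v) ∨ ∃ i, G.Monic D S' q ρ v i) {r : Rule}
    (hr : .inr r ∈ (nullOut S' q hρ v h).str) : r ∈ G.newRules D S' := by
  rw [nullOut] at hr
  split at hr
  · rename_i hg
    rcases (OutTree.mem_str_node _ _ _).1 hr with h | ⟨j, h⟩
    · cases h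
      exact ⟨q, ρ, v, hv, rfl, hg⟩
    · change _ ∈ [_] at h
      simp at h
  · change _ ∈ [_] at hr
    simp at hr

/-- The look-ahead for the `i`-th child: whether it has at least two lexical symbols, if `v i` is
`none`, and otherwise whether it has the value `v i`. -/
def nullLook (G : MCFTG) (D : List Sym) (ρ : Rule) (v : Fin ρ.rk → Option (List Term))
    (i : Fin ρ.rk) : Set DTree :=
  {d | G.IsDer d (ρ.links.get i) ∧ (v i).elim (2 ≤ d.wt (lex D)) (DTree.val d = ·)}

/-- The clause of the transducer for `q`, `ρ` and `v`. -/
noncomputable def nullClause (S' : Sym) (q : NullCtx) {ρ : Rule} (hρ : ρ ∈ G.R)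
    (v : Fin ρ.rk → Option (List Term))
    (h : GrowingRule D S' (G.newRule S' q ρ v) ∨ ∃ i, G.Monic D S' q ρ v i) :
    Clause Rule Rule.rk Rule Rule.rk (G.NullState D) ρ.rk :=
  ⟨{d | G.IsDer d ρ.lhs}, G.nullLook D ρ v, nullOut S' q hρ v h⟩

theorem Valid.isRegular_nullLook (hb : G.Bounded D) {q : NullCtx} {ρ : Rule}
    {v : Fin ρ.rk → Option (List Term)} (hv : G.Valid D q ρ v) (i : Fin ρ.rk) :
    IsRegular {ρ | ρ ∈ G.R} (G.nullLook D ρ v i) := by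
  cases hi : v i with
  | none =>
    have := isRegular_heavy (G := G) D ((G.rules_wf ρ hv.mem).links_mem _ (List.get_mem _ i))
    simpa only [nullLook, hi, Option.elim] using this
  | some x =>
    have := isRegular_light hb.finite_lightValues (hv.mem_lightValues hi)
    simpa only [nullLook, hi, Option.elim] using this

theorem Valid.val_wt_le {q : NullCtx} {ρ : Rule} {v : Fin ρ.rk → Option (List Term)}
    (hv : G.Valid D q ρ v) {i : Fin ρ.rk} {x : List Term} (hi : v i = some x) {d : DTree}
    (hd : G.IsDer d (ρ.links.get i)) (hx : DTree.val d = x) : d.wt (lex D) ≤ 1 := by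
  obtain ⟨ts, h₁, h₂⟩ := hv.trees
  obtain ⟨h₃, h₄⟩ := h₂ i x hi
  refine le_trans (le_of_eq ?_) h₃
  exact (hd.fwt_val _).symm.trans ((congrArg (fwt _) (hx.trans h₄.symm)).trans ((h₁ i).fwt_val _))

theorem Valid.nullLook_disjoint {q : NullCtx} {ρ : Rule} {v v' : Fin ρ.rk → Option (List Term)}
    (hv : G.Valid D q ρ v) (hv' : G.Valid D q ρ v') (hne : v ≠ v') :
    ∃ i, G.nullLook D ρ v i ∩ G.nullLook D ρ v' i = ∅ := by
  obtain ⟨i, hi⟩ := Function.ne_iff.1 hne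
  refine ⟨i, Set.eq_empty_of_forall_notMem ?_⟩
  rintro d ⟨⟨hd, h⟩, -, h'⟩
  cases hvi : v i with
  | none =>
    cases hvi' : v' i with
    | none => exact hi (hvi.trans hvi'.symm)
    | some x' =>
      rw [hvi] at h
      rw [hvi'] at h'
      exact absurd (hv'.val_wt_le hvi' hd h') (not_le.2 h)
  | some x =>
    cases hvi' : v' i with
    | none =>
      rw [hvi] at h
      rw [hvi'] at h'
      exact absurd (hv.val_wt_le hvi hd h) (not_le.2 h')
    | some x' =>
      rw [hvi] at h
      rw [hvi'] at h'
      change DTree.val d = x at h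
      change DTree.val d = x' at h'
      exact hi (by rw [hvi, hvi', ← h, ← h'])

variable (h : G.Bounded D) {S' : Sym} (hN : S' ∉ G.N) (hS : S'.2 = 0)

/-- The transducer that removes the subtrees with at most one lexical symbol and the rules that are
not allowed in a growing grammar. -/
noncomputable def growingTransducer :
    LDTR Rule.rk Rule.rk {ρ | ρ ∈ G.R} {r | r ∈ (G.growing h hN hS).R} where
  Q := G.NullState D
  finite_Q := by
    refine ((h.finite_isNull.insert (NullCtx.initial G)).subset ?_).to_subtype
    exact fun q hq => hq.elim (Set.mem_insert_of_mem _) fun h => h ▸ Set.mem_insert _ _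
  q₀ := ⟨NullCtx.initial G, .inr rfl⟩
  rules q ρ := {c | ∃ v, ∃ hv : G.Valid D q.1 ρ v, ∃ ho, c = nullClause S' q.1 hv.mem v ho}
  finite_rules q ρ := by
    have : Finite {v // G.Valid D q.1 ρ v} := (h.finite_valid q.1 ρ).to_subtype
    refine (Set.finite_range fun x : {x : {v // G.Valid D q.1 ρ v} // GrowingRule D S'
      (G.newRule S' q.1 ρ x.1) ∨ ∃ i, G.Monic D S' q.1 ρ x.1 i} =>
        nullClause S' q.1 x.1.2.mem x.1.1 x.2).subset ?_
    rintro _ ⟨v, hv, ho, rfl⟩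
    exact ⟨⟨⟨v, hv⟩, ho⟩, rfl⟩
  input_mem := by rintro _ _ _ ⟨v, hv, -⟩; exact hv.mem
  output_mem := by
    rintro _ _ _ ⟨v, hv, ho, rfl⟩ r hr
    exact (mem_growing_R h hN hS).2 (labels_nullOut hv.mem hv ho hr)
  regular_look₀ := by
    rintro _ ρ _ ⟨v, hv, ho, rfl⟩
    exact isRegular_isDer (G.rules_wf ρ hv.mem).lhs_mem
  regular_look := by
    rintro _ ρ _ ⟨v, hv, ho, rfl⟩ i
    exact hv.isRegular_nullLook h i
  linear := by
    rintro _ ρ _ ⟨v, hv, ho, rfl⟩ i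
    rw [OutTree.countP_eq_wt]
    exact linear_nullOut hv.mem v ho i
  deterministic := by
    rintro _ ρ _ ⟨v, hv, ho, rfl⟩ _ ⟨v', hv', ho', rfl⟩ hne
    refine .inr (hv.nullLook_disjoint hv' ?_)
    rintro rfl
    exact hne rfl

/-- A rule obtained from a derivation tree that is not light is growing, or monic and without
lexical symbols. -/
theorem Valid.growingRule_or_monic {q : NullCtx} {ρ : Rule} {v : Fin ρ.rk → Option (List Term)}
    (hv : G.Valid D q ρ v) {ts : Fin ρ.rk → DTree} (h₁ : ∀ i, G.IsDer (ts i) (ρ.links.get i))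
    (h₂ : ∀ i, v i ≠ none → childForests ρ v i = DTree.val (ts i))
    (hq : q.start = true ∨ 2 ≤ RTree.wt (lex D) (.node ρ ts : DTree)) (S' : Sym) :
    GrowingRule D S' (G.newRule S' q ρ v) ∨ ∃ i, G.Monic D S' q ρ v i := by
  rw [or_iff_not_imp_right]
  refine fun hm => ⟨fun hl hnil => ?_, fun hone => ?_⟩
  · have hq := hq.resolve_left fun hs => hl (if_pos hs)
    rw [RTree.wt_node] at hq
    rw [hv.lexCount_newRule S' h₁ h₂]
    refine hq.trans_eq (congrArg _ (Finset.sum_congr rfl fun i _ => (if_neg fun hi => ?_).symm))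
    have : ρ.links.get i ∈ G.keptLinks ρ v := (mem_keptLinks hv.mem).2 ⟨i, hi, rfl⟩
    rw [show G.keptLinks ρ v = [] from hnil] at this
    exact List.not_mem_nil this
  · by_contra hlex
    obtain ⟨B, hB⟩ := List.length_eq_one_iff.1 hone
    change G.keptLinks ρ v = [B] at hB
    obtain ⟨i, hi, rfl⟩ := (mem_keptLinks hv.mem).1 (hB ▸ List.mem_singleton.2 rfl)
    refine hm ⟨i, hi, fun j hj => ?_, by omega⟩
    have : ρ.links.get j ∈ G.keptLinks ρ v := (mem_keptLinks hv.mem).2 ⟨j, hj, rfl⟩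
    rw [hB, List.mem_singleton] at this
    exact Rule.get_injective hv.mem this

/-- In the state of a null context `c`, the transducer translates `d` to a derivation tree with the
value of `c.fill d`. Derivation trees with at most one lexical symbol are reached in initial states
only. -/
theorem growingTransducer_trans {d : DTree} : ∀ {s : G.NullState D} {q : NullCtx} {c : Ctx},
    s.1 = q → G.IsNull D q → q.Rep G D c → G.IsDer d q.tgt →
    (q.start = true ∨ 2 ≤ d.wt (lex D)) →
    ∃ d', (growingTransducer h hN hS).Trans d s d' ∧
      (G.growing h hN hS).IsDer d' (if q.start then [S'] else q.src) ∧
      DTree.val d' = DTree.val (c.fill d) := by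
  induction d with
  | node ρ ts ih =>
    rintro s q c rfl hnull hc hd hq
    let v : Fin ρ.rk → Option (List Term) := fun i =>
      if (ts i).wt (lex D) ≤ 1 then some (DTree.val (ts i)) else none
    have hnone : ∀ i, v i = none → 2 ≤ (ts i).wt (lex D) := by
      intro i hi
      by_contra hlt
      simp only [v, if_pos (show (ts i).wt (lex D) ≤ 1 by omega)] at hi
      cases hi
    have hsome : ∀ i, v i ≠ none → childForests ρ v i = DTree.val (ts i) := by
      intro i hi
      by_cases hle : (ts i).wt (lex D) ≤ 1
      · simp only [childForests, v, if_pos hle, Option.getD_some]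
      · exact absurd (if_neg hle) hi
    have hv : G.Valid D s.1 ρ v := by
      refine ⟨hnull, hd.1, hd.2.1, ts, hd.2.2, fun i x hx => ?_⟩
      by_cases hle : (ts i).wt (lex D) ≤ 1
      · simp only [v, if_pos hle, Option.some_inj] at hx
        exact ⟨hle, hx⟩
      · simp only [v, if_neg hle] at hx
        cases hx
    have hlook : ∀ i, ts i ∈ G.nullLook D ρ v i := by
      intro i
      refine ⟨hd.2.2 i, ?_⟩
      cases hi : v i with
      | none => exact hnone i hi
      | some x =>
        have := hsome i (by simp [hi])
        rw [childForests, hi] at this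
        exact this.symm
    have ho := hv.growingRule_or_monic hd.2.2 hsome hq S'
    have hd₀ : G.IsDer (.node ρ ts) ρ.lhs := ⟨hd.1, rfl, hd.2.2⟩
    -- it remains to find the translations of the children
    suffices key : ∃ g : G.NullState D × Fin ρ.rk → DTree,
        (∀ p, .inl p ∈ (nullOut S' s.1 hv.mem v ho).str →
          (growingTransducer h hN hS).Trans (ts p.2) p.1 (g p)) ∧
        (G.growing h hN hS).IsDer ((nullOut S' s.1 hv.mem v ho).fill g)
          (if s.1.start then [S'] else s.1.src) ∧
        DTree.val ((nullOut S' s.1 hv.mem v ho).fill g) = DTree.val (c.fill (.node ρ ts)) by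
      obtain ⟨g, hg, hder, hval⟩ := key
      exact ⟨_, ⟨_, ⟨v, hv, ho, rfl⟩, hd₀, hlook, g, hg, rfl⟩, hder, hval⟩
    by_cases hg : GrowingRule D S' (G.newRule S' s.1 ρ v)
    · rw [nullOut, dif_pos hg]
      have he : ∀ i, ∃ d', v i = none →
          (growingTransducer h hN hS).Trans (ts i) (G.toState D (NullCtx.hole (ρ.links.get i))) d' ∧
          (G.growing h hN hS).IsDer d' (ρ.links.get i) ∧ DTree.val d' = DTree.val (ts i) := by
        intro i
        by_cases hi : v i = none
        · obtain ⟨d', hd'⟩ := ih i (toState_val (hv.isNull_hole i)) (hv.isNull_hole i)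
            (NullCtx.rep_hole _) (hd.2.2 i) (.inr (hnone i hi))
          change _ ∧ (G.growing h hN hS).IsDer d' (ρ.links.get i) ∧ _ at hd'
          exact ⟨d', fun _ => hd'⟩
        · exact ⟨ts i, fun hi' => absurd hi' hi⟩
      choose e he using he
      have hget : ∀ j : Fin (G.keptLinks ρ v).length,
          ρ.links.get (keptIdx hv.mem v j) = (G.keptLinks ρ v).get j := get_keptIdx hv.mem v
      refine ⟨fun p => e p.2, fun p hp => ?_, ⟨?_, rfl, fun j => ?_⟩, ?_⟩
      · rcases (OutTree.mem_str_node _ _ _).1 hp with hp | ⟨j, hp⟩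
        · cases hp
        · rw [OutTree.str_leaf, List.mem_singleton, Sum.inl.injEq] at hp
          subst hp
          exact Eq.subst (motive := fun B => (growingTransducer h hN hS).Trans
            (ts (keptIdx hv.mem v j)) (G.toState D (NullCtx.hole B)) (e (keptIdx hv.mem v j)))
            (hget j) (he _ (keptIdx_none hv.mem v j)).1
      · exact (mem_growing_R h hN hS).2 ⟨s.1, ρ, v, hv, rfl, hg⟩
      · exact Eq.subst (motive := (G.growing h hN hS).IsDer (e (keptIdx hv.mem v j)))
          (hget j) (he _ (keptIdx_none hv.mem v j)).2.1
      · rw [Ctx.val_fill]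
        refine hv.val_newRule (y := fun i => DTree.val (ts i)) (fun i => (hd.2.2 i).isForest)
          hsome (fun j => DTree.val (e (keptIdx hv.mem v j))) (fun i j hi hij => ?_) S' hc
        have hij' := Rule.get_injective hv.mem ((hget j).trans hij)
        exact hij' ▸ (he i hi).2.2
    · rw [nullOut, dif_neg hg]
      have hm := (ho.resolve_left hg).choose_spec
      generalize (ho.resolve_left hg).choose = i at hm
      have hnull' := hv.isNull_extend hm
      obtain ⟨d', h₁, h₂, h₃⟩ := ih i (toState_val hnull') hnull'
        (hv.rep_extend hc hm hd.2.2 hsome) (hd.2.2 i) (.inr (hnone i hm.none))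
      refine ⟨fun _ => d', fun p hp => ?_, h₂, h₃.trans ?_⟩
      · rw [OutTree.str_leaf, List.mem_singleton, Sum.inl.injEq] at hp
        subst hp
        exact h₁
      · rw [Ctx.fill_append]
        exact congrArg (fun d => DTree.val (c.fill d)) (Step.fill_self ρ ts i)

theorem FinitelyAmbiguous.exists_growing (hD : G.FinitelyAmbiguous D) :
    ∃ G' : MCFTG, G'.StartSeparated ∧ G.LDTREquiv G' ∧ G'.Growing D ∧
      G'.width = G.width ∧ G'.multiplicity = G.multiplicity := by
  have h := (finitelyAmbiguous_iff_bounded D).1 hD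
  obtain ⟨S', hN, hS⟩ := G.exists_fresh
  refine ⟨G.growing h hN hS, growing_startSeparated h hN hS,
    ⟨fun σ => Iff.rfl, ⟨growingTransducer h hN hS, fun d hd => ?_⟩,
      ⟨originTransducer h hN hS, fun d' hd' => ?_⟩⟩,
    growing_growing h hN hS, growing_width h hN hS, growing_multiplicity h hN hS⟩
  · have hnull : G.IsNull D (NullCtx.initial G) :=
      ⟨fun _ => rfl, ⟨[], rfl⟩, ⟨_, NullCtx.rep_initial⟩, d, hd⟩
    exact growingTransducer_trans h hN hS (s := ⟨NullCtx.initial G, .inr rfl⟩) rfl hnull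
      NullCtx.rep_initial hd (.inl rfl)
  · obtain ⟨d, h₁, h₂, h₃⟩ := originTransducer_trans h hN hS hd'
    rw [if_pos (show [(G.growing h hN hS).S] = [S'] from rfl)] at h₂
    exact ⟨d, h₁, h₂, h₃⟩

end MCFTG
end MCFT

theorem mainTheorem2 :
    (∃ p : MCFT.GrammarCode × List MCFT.Sym → Prop, ComputablePred p ∧
      ∀ (G : MCFT.MCFTG) (D : List MCFT.Sym), D ⊆ G.Sig →
        (p (G.code, D) ↔ G.FinitelyAmbiguous D)) ∧
    (∀ (G : MCFT.MCFTG) (D : List MCFT.Sym), D ⊆ G.Sig → G.FinitelyAmbiguous D →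
      ∃ G' : MCFT.MCFTG, G'.StartSeparated ∧ G.LDTREquiv G' ∧ G'.Growing D ∧
        G'.width = G.width ∧ G'.multiplicity = G.multiplicity) :=
  ⟨⟨MCFT.Decide, MCFT.primrecPred_decide.computablePred, fun _ D _ => MCFT.MCFTG.decide_iff D⟩,
    fun _ _ _ hD => hD.exists_growing⟩
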